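/- \textbf{Setting.} An instance of Bayesian multi-parameter unit-demand mechanism design consists of finitely many agents, a finite set $J$ of services partitioned into groups $J_i$ (the services targeted at agent $i$), independent values $v_j\ge 0$ for the services, $v_j$ having an arbitrary known distribution $F_j$ and being private to the agent $i$ with $j\in J_i$, and a downward closed family $\mathcal J\ni\emptyset$ of feasible sets $S\subseteq J$ with $|S\cap J_i|\le 1$ for all $i$. A (deterministic) mechanism maps each bid vector to a set in $\mathcal J$ and to payments of the agents. It is truthful if bidding true values is a dominant strategy, and individually rational if a served agent never pays more than her value of the service she receives and an unserved agent pays nothing. $\mathrm{OPT}$ is the supremum of the expected revenue over truthful individually rational mechanisms; it is assumed to be finite. A sequential posted-price mechanism (SPM) consists of a price $p_j\ge 0$ for every service and an ordering of all services, both announced in advance. Services are considered in this order; if adding $j\in J_i$ to the set $A$ of services sold so far is feasible, $j$ is offered to $i$ at price $p_j$, and is added to $A$ if $i$ accepts. A plan of an agent says which offers to accept, depending on the history; a strategy chooses a plan depending on the agent's own values. For an agent with given values, a plan $t$ dominates a plan $s$ if against all plans of the other agents $s$ yields no more utility than $t$, and against some plans strictly less. A strategy is undominated if for all values of the agent no plan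 dominates the plan it chooses. An SPM implements an $\alpha$-approximation in undominated strategies if its expected revenue is at least $\mathrm{OPT}/\alpha$ whenever all agents play undominated strategies. This implementation is algorithmic if, moreover, there are sets $D_i(v_i)$ of plans such that the revenue is at least $\mathrm{OPT}/\alpha$ whenever all agents play in these sets, and every plan $s\notin D_i(v_i)$ is dominated by a plan in $D_i(v_i)$ that is easily computed from $s$: its answer to each offer is determined by the comparisons of the agent's own values with the prices of her own services and by the answer of $s$ to the same offer. \textbf{Theorem.} (a) Suppose that there are two matroids on $J$ (arbitrary ones) such that $S\in\mathcal J$ if and only if $S$ is independent in both and $|S\cap J_i|\le 1$ for every agent $i$. Then some SPM is an algorithmic implementation of an $8$-approximation in undominated strategies. (b) Suppose that the instance is a combinatorial auction with known bundles of size $2$: the seller has a given number of copies of each of several items, each service $j$ is a bundle of at most $2$ items, and $S\in\mathcal J$ if and only if no item occurs in more bundles of $S$ than it has copies and $|S\cap J_i|\le 1$ for every agent $i$. Then some SPM is an algorithmic implementation of an $8$-approximation in undominated strategies. -/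

import Mathlib

open MeasureTheory
open scoped NNReal ENNReal

/-- An instance of Bayesian multi-parameter unit-demand mechanism design with agents `N` and
services `J`.  Service `j` is targeted at the agent `owner j`, so the services of agent `i` are
the fibre of `owner` over `i`.  The value of `owner j` for `j` is drawn from `dist j`,
independently of all other values.  The seller may provide any set of services in `feasible`. -/
structure BMUMD (N J : Type*) [DecidableEq N] where
  owner : J → N
  dist : J → Measure ℝ≥0
  isProb : ∀ j, IsProbabilityMeasure (dist j)
  feasible : Set (Finset J)
  empty_mem : ∅ ∈ feasible
  downward : ∀ S ∈ feasible, ∀ T, T ⊆ S → T ∈ feasible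
  unitDemand : ∀ S ∈ feasible, ∀ i, (S.filter (fun j => owner j = i)).card ≤ 1

namespace BMUMD

attribute [instance] BMUMD.isProb

variable {N J : Type*} [Fintype N] [DecidableEq N] [Fintype J] [DecidableEq J]

/-- The group of services targeted at agent `i`. -/
abbrev Services (I : BMUMD N J) (i : N) : Type _ := {j : J // I.owner j = i}

/-- The joint law of the values (product measure: the values are independent). -/
noncomputable def law (I : BMUMD N J) : Measure (J → ℝ≥0) := Measure.pi I.dist

/-! ### The benchmark: truthful, individually rational (deterministic) mechanisms -/

/-- A mechanism maps every vector of bids to a feasible set of services and a payment for each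
agent. -/
structure Mechanism (I : BMUMD N J) where
  alloc : (J → ℝ≥0) → Finset J
  pay : (J → ℝ≥0) → N → ℝ
  alloc_feasible : ∀ b, alloc b ∈ I.feasible
  measurable_alloc : ∀ j, MeasurableSet {b | j ∈ alloc b}
  measurable_pay : ∀ i, Measurable (fun b => pay b i)

namespace Mechanism

variable {I : BMUMD N J}

/-- Utility of agent `i` when the values are `v` and the submitted bids are `b`. -/
noncomputable def utility (A : I.Mechanism) (i : N) (v b : J → ℝ≥0) : ℝ :=
  (∑ j ∈ (A.alloc b).filter (fun j => I.owner j = i), (v j : ℝ)) - A.pay b i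

/-- A served agent pays at most the value of the service received; an agent that is not served
pays nothing. -/
def IndividuallyRational (A : I.Mechanism) : Prop :=
  ∀ (v : J → ℝ≥0) (i : N),
    (∀ j ∈ A.alloc v, I.owner j = i → A.pay v i ≤ (v j : ℝ)) ∧
    ((∀ j ∈ A.alloc v, I.owner j ≠ i) → A.pay v i = 0)

/-- Bidding the true values is a dominant strategy for every agent. -/
def Truthful (A : I.Mechanism) : Prop :=
  ∀ (i : N) (v b : J → ℝ≥0), (∀ j, I.owner j ≠ i → b j = v j) →
    A.utility i v b ≤ A.utility i v v

/-- Expected revenue under truthful bidding, as the expected positive part minus the expected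
negative part of the total payment (a negative expectation is recorded as `0`, which is the
revenue of the mechanism that never serves anybody). -/
noncomputable def revenue (A : I.Mechanism) : ℝ≥0∞ :=
  (∫⁻ v, ENNReal.ofReal (∑ i, A.pay v i) ∂I.law) -
    ∫⁻ v, ENNReal.ofReal (-∑ i, A.pay v i) ∂I.law

end Mechanism

/-- The optimal revenue over truthful, individually rational mechanisms. -/
noncomputable def optRevenue (I : BMUMD N J) : ℝ≥0∞ :=
  ⨆ (A : I.Mechanism) (_ : A.IndividuallyRational) (_ : A.Truthful), A.revenue

/-! ### Sequential posted-price mechanisms and the game that they induce -/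

/-- A sequential posted-price mechanism: a posted price for every service and an ordering of all
services. -/
structure SPM (I : BMUMD N J) where
  price : J → ℝ≥0
  order : List J
  nodup : order.Nodup
  mem_order : ∀ j, j ∈ order

/-- A plan of agent `i` in a sequential posted-price mechanism: whether to accept service `j` when
it is offered and the set of services sold so far is `A`.  The order being fixed, `j` and `A`
determine the whole history of earlier offers and answers, so this is the most general pure plan
for agents who observe the entire history. -/
abbrev Plan (I : BMUMD N J) (i : N) : Type _ := I.Services i → Finset J → Bool

/-- A strategy of agent `i`: a plan for each vector of own values. -/
abbrev Strategy (I : BMUMD N J) (i : N) : Type _ := (I.Services i → ℝ≥0) → I.Plan i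

namespace SPM

variable {I : BMUMD N J}

open Classical in
/-- One step: offer `j` to its owner if this is feasible given the set `A` of services sold so
far, and sell it if the owner accepts. -/
noncomputable def step (x : ∀ i, I.Plan i) (A : Finset J) (j : J) : Finset J :=
  if insert j A ∈ I.feasible ∧ x (I.owner j) ⟨j, rfl⟩ A = true then insert j A else A

/-- The set of services sold when the agents follow the plans `x`. -/
noncomputable def outcome (P : I.SPM) (x : ∀ i, I.Plan i) : Finset J :=
  P.order.foldl (step x) ∅

/-- Utility of agent `i` with own values `v` when the plans `x` are followed. -/
noncomputable def utility (P : I.SPM) (i : N) (v : I.Services i → ℝ≥0) (x : ∀ i, I.Plan i) : ℝ :=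
  ∑ j : I.Services i, if (j : J) ∈ P.outcome x then (v j : ℝ) - (P.price j : ℝ) else 0

/-- For agent `i` with own values `v`, plan `t` dominates plan `s`: whatever the other agents do,
`s` is no better than `t`, and for some behaviour of the others it is strictly worse.
(The entry `i` of `x` is overwritten.) -/
def Dominates (P : I.SPM) (i : N) (v : I.Services i → ℝ≥0) (t s : I.Plan i) : Prop :=
  (∀ x : ∀ i, I.Plan i,
      P.utility i v (Function.update x i s) ≤ P.utility i v (Function.update x i t)) ∧
    ∃ x : ∀ i, I.Plan i,
      P.utility i v (Function.update x i s) < P.utility i v (Function.update x i t)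

/-- A strategy is undominated if, for all own values, no plan dominates the plan it prescribes. -/
def Undominated (P : I.SPM) (i : N) (s : I.Strategy i) : Prop :=
  ∀ (v : I.Services i → ℝ≥0) (t : I.Plan i), ¬ P.Dominates i v t (s v)

/-- Expected revenue when the agents play the strategies `s`. -/
noncomputable def revenue (P : I.SPM) (s : ∀ i, I.Strategy i) : ℝ≥0∞ :=
  ∫⁻ v, ∑ j ∈ P.outcome (fun i => s i (fun k => v k)), (P.price j : ℝ≥0∞) ∂I.law

/-- Whatever undominated strategies the agents play, the expected revenue is within a factor `α`
of the optimal revenue. -/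
def ImplementsInUndominated (P : I.SPM) (α : ℝ≥0∞) : Prop :=
  ∀ s : ∀ i, I.Strategy i, (∀ i, P.Undominated i (s i)) → I.optRevenue ≤ α * P.revenue s

/-- A modification rule of agent `i`: the new answer to an offer of `j` is computed from the
outcomes of the comparisons of own values with posted prices and from the old answer to the same
offer. -/
abbrev Rule (I : BMUMD N J) (i : N) : Type _ :=
  (I.Services i → Bool) → I.Services i → Bool → Bool

/-- The plan obtained from plan `s` by a modification rule. -/
noncomputable def modify (P : I.SPM) {i : N} (r : Rule I i) (v : I.Services i → ℝ≥0)
    (s : I.Plan i) : I.Plan i :=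
  fun j A => r (fun k => decide (P.price k ≤ v k)) j (s j A)

/-- The algorithmic part of implementation in undominated strategies: there are sets `D` of plans
such that every plan outside is dominated by a plan inside that is easily computed from it, namely
with one comparison for each own service and one look at the old plan per offer, and the
approximation already holds when all agents play in these sets. -/
def HasEasyImprovements (P : I.SPM) (α : ℝ≥0∞) : Prop :=
  ∃ (D : ∀ i, (I.Services i → ℝ≥0) → Set (I.Plan i)) (r : ∀ i, Rule I i),
    (∀ (i : N) (v : I.Services i → ℝ≥0) (s : I.Plan i), s ∉ D i v →
      P.modify (r i) v s ∈ D i v ∧ P.Dominates i v (P.modify (r i) v s) s) ∧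
    ∀ s : ∀ i, I.Strategy i, (∀ i v, s i v ∈ D i v) → I.optRevenue ≤ α * P.revenue s

end SPM

/-! ### The two kinds of feasibility constraints -/

/-- A set of services is feasible iff it is independent in both matroids and contains at most one
service for each agent.  (If the unit-demand requirement already follows from the two matroids, the
last conjunct is redundant.) -/
def IsMatroidIntersection (I : BMUMD N J) (M₁ M₂ : Matroid J) : Prop :=
  ∀ S : Finset J, S ∈ I.feasible ↔
    M₁.Indep (S : Set J) ∧ M₂.Indep (S : Set J) ∧
      ∀ i, (S.filter (fun j => I.owner j = i)).card ≤ 1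

/-- A combinatorial auction with known bundles of size (at most) `m`: the seller has `mult k` copies
of item `k`, service `j` is the bundle `bundle j`, and a set of services is feasible iff it contains
at most one bundle for each agent and no item is used more often than its multiplicity. -/
def IsBundleAuction {K : Type*} [DecidableEq K] (I : BMUMD N J) (m : ℕ) (mult : K → ℕ)
    (bundle : J → Finset K) : Prop :=
  (∀ j, (bundle j).card ≤ m) ∧
  ∀ S : Finset J, S ∈ I.feasible ↔
    (∀ k, (S.filter (fun j => k ∈ bundle j)).card ≤ mult k) ∧
      ∀ i, (S.filter (fun j => I.owner j = i)).card ≤ 1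

end BMUMD

/-! Fix a nearly optimal truthful mechanism. Once the other bids are fixed, a service is sold above
a threshold of its own bid, and its buyer pays at most this threshold. Rounding thresholds to a
geometric grid `c`, let `w e n` be the probability that the threshold lies in the `n`-th cell and
that `e` represents a sold service. Then OPT is at most about `∑ c n * w e n`, and the weights obey
linear constraints (`exists_gridWeights`): the weight of a service at level `n` is at most its
threshold mass times the probability of a value above `c n`, because threshold and value are
independent; every agent has total weight at most 1; and the elements lying in or blocked by an
independent set `T` weigh at most `2 * |T|`.

The prices are first drawn at random, independently for the services, such that `e` is the only
acceptable representative of its owner, at level `n`, with probability `0.3678 * w e n`; the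
constant is just below `1/e` (`exists_lottery`). An agent with a single acceptable offer has, up to
ties, no strategic freedom: declining that offer, or buying something overpriced, can be improved by
an easy rule. If expensive services are offered first, the services sold at a price of at least `c
a` thus contain or block every isolated service of level at least `a`, so their number is at least
half the rank of the isolated representatives (`SPM.choiceRank_isolatedChoice_le`). Summing over `a`
with the grid steps as coefficients turns these counts into revenue.

The rank has to be a quarter of the weight on average. Let `F s` be its expectation when agents
independently are represented by `e` with probability `s * w e`, and `ω` the total weight. Redrawing
one agent at a time gives `(1 - s) * F' ≥ ω - 3 * F`: blocking costs `2 * F` and the loss of the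
agent's old element costs `F`. This yields only `ω * (1 - (1 - s) ^ 3) / 3`, about `0.2491 * ω` at
`s = 0.3678`. The missing bit comes from old elements that are used although the rank would be the
same without them. Losing such an element `a` is harmless unless the new element `b` fits the old
optimum but fails to raise the rank, that is, unless `a` loses to `b`. An exchange property shared
by matroid intersections and matchings (`PairSystem`) forbids `a`, `b`, `c` with `a` losing to `b`
and `c` and `b` losing to `c`, so such losses are limited (`sum_mul_one_sub_out_ge`). The result is
`(1 - 2 * s / 3) * F' ≥ (1 - s / 18) * ω - 8 / 3 * F` and `F 0.3678 ≥ 0.25008 * ω`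
(`prodExp_choiceRank_ge`).

The factor is `8 = 2 * 4`; the excess over `1/4` absorbs the discretization, and some outcome of the
price lottery is as good as the average. -/

set_option linter.unusedSectionVars false

/-! ### Expectations over finite product spaces -/

section ProductExpectation

variable {ι : Type*} [Fintype ι] [DecidableEq ι] {β : ι → Type*} [∀ i, Fintype (β i)]

/-- The expectation of `g` when the coordinates are drawn independently with weights `p i`. -/
def prodExp (p : ∀ i, β i → ℝ) (g : (∀ i, β i) → ℝ) : ℝ :=
  ∑ t, (∏ i, p i (t i)) * g t

theorem prodExp_add (p : ∀ i, β i → ℝ) (g h : (∀ i, β i) → ℝ) :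
    prodExp p (fun t => g t + h t) = prodExp p g + prodExp p h := by
  simp [prodExp, mul_add, Finset.sum_add_distrib]

theorem prodExp_sub (p : ∀ i, β i → ℝ) (g h : (∀ i, β i) → ℝ) :
    prodExp p (fun t => g t - h t) = prodExp p g - prodExp p h := by
  simp [prodExp, mul_sub, Finset.sum_sub_distrib]

theorem prodExp_const_mul (p : ∀ i, β i → ℝ) (c : ℝ) (g : (∀ i, β i) → ℝ) :
    prodExp p (fun t => c * g t) = c * prodExp p g := by
  simp only [prodExp, Finset.mul_sum]
  exact Finset.sum_congr rfl fun t _ => by ring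

theorem prodExp_sum {κ : Type*} (s : Finset κ) (p : ∀ i, β i → ℝ) (g : κ → (∀ i, β i) → ℝ) :
    prodExp p (fun t => ∑ k ∈ s, g k t) = ∑ k ∈ s, prodExp p (g k) := by
  simp only [prodExp, Finset.mul_sum]
  exact Finset.sum_comm

theorem prodExp_mono {p : ∀ i, β i → ℝ} (hp : ∀ i o, 0 ≤ p i o) {g h : (∀ i, β i) → ℝ}
    (hgh : ∀ t, g t ≤ h t) : prodExp p g ≤ prodExp p h :=
  Finset.sum_le_sum fun t _ =>
    mul_le_mul_of_nonneg_left (hgh t) (Finset.prod_nonneg fun i _ => hp i _)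

theorem prodExp_const {p : ∀ i, β i → ℝ} (hp : ∀ i, ∑ o, p i o = 1) (c : ℝ) :
    prodExp p (fun _ => c) = c := by
  classical
  rw [prodExp, ← Finset.sum_mul, ← Fintype.prod_sum]
  simp [hp]

/-- On the left, coordinate `i` is summed without its weight. Since `p i` has total mass 1, a fresh
coordinate with weight `p i` can be added and the old one treated as the variable `o`. -/
theorem sum_prod_erase_eq_prodExp_update {p : ∀ i, β i → ℝ} (i : ι) (hp : ∑ o, p i o = 1)
    (c : β i → ℝ) (g : (∀ i, β i) → ℝ) :
    ∑ t : ∀ i, β i, (∏ j ∈ Finset.univ.erase i, p j (t j)) * (c (t i) * g t) =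
      prodExp p (fun t => ∑ o, c o * g (Function.update t i o)) := by
  classical
  have key : ∀ G : (∀ i, β i) → ℝ, ∑ t, G t =
      ∑ r : (∀ j : {j // j ≠ i}, β j), ∑ o : β i, G ((Equiv.piSplitAt i β).symm (o, r)) := by
    intro G
    rw [← Equiv.sum_comp (Equiv.piSplitAt i β).symm G, Fintype.sum_prod_type_right]
  have e1 : ∀ o r, (Equiv.piSplitAt i β).symm (o, r) i = o := by
    intro o r; simp [Equiv.piSplitAt]
  have e2 : ∀ o o' r, Function.update ((Equiv.piSplitAt i β).symm (o, r)) i o' =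
      (Equiv.piSplitAt i β).symm (o', r) := by
    intro o o' r
    funext j
    by_cases h : j = i
    · subst h; simp [Equiv.piSplitAt]
    · simp [Equiv.piSplitAt, h]
  have e3 : ∀ o r, (∏ j ∈ Finset.univ.erase i, p j ((Equiv.piSplitAt i β).symm (o, r) j)) =
      ∏ j : {j // j ≠ i}, p j (r j) := by
    intro o r
    rw [Finset.prod_subtype (Finset.univ.erase i) (p := fun j => j ≠ i) (by simp)]
    refine Finset.prod_congr rfl fun j _ => ?_
    simp [Equiv.piSplitAt, j.2]
  rw [prodExp, key, key]
  refine Finset.sum_congr rfl fun r _ => ?_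
  simp_rw [e2, e1, e3, ← Finset.mul_prod_erase Finset.univ _ (Finset.mem_univ i), e1, e3]
  rw [← Finset.mul_sum]
  rw [← Finset.sum_mul, ← Finset.sum_mul, hp, one_mul]

theorem prodExp_eq_update {p : ∀ i, β i → ℝ} (i : ι) (hp : ∑ o, p i o = 1)
    (g : (∀ i, β i) → ℝ) :
    prodExp p g = prodExp p (fun t => ∑ o, p i o * g (Function.update t i o)) := by
  rw [← sum_prod_erase_eq_prodExp_update i hp, prodExp]
  refine Finset.sum_congr rfl fun t _ => ?_
  rw [← Finset.mul_prod_erase Finset.univ _ (Finset.mem_univ i)]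
  ring

/-- A formula of Russo type: the product rule differentiates one weight at a time, and each term is
again an expectation under the original law. -/
theorem hasDerivAt_prodExp {p p' : ℝ → ∀ i, β i → ℝ} {s : ℝ}
    (hp : ∀ i, ∑ o, p s i o = 1) (hd : ∀ i o, HasDerivAt (fun r => p r i o) (p' s i o) s)
    (g : (∀ i, β i) → ℝ) :
    HasDerivAt (fun r => prodExp (p r) g)
      (∑ i, prodExp (p s) (fun t => ∑ o, p' s i o * g (Function.update t i o))) s := by
  have h1 : ∀ t : ∀ i, β i, HasDerivAt (fun r => (∏ i, p r i (t i)) * g t)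
      ((∑ i, (∏ j ∈ Finset.univ.erase i, p s j (t j)) • p' s i (t i)) * g t) s := by
    intro t
    exact (HasDerivAt.fun_finsetProd fun i _ => hd i (t i)).mul_const _
  have h2 := HasDerivAt.fun_sum (u := Finset.univ) fun t _ => h1 t
  refine h2.congr_deriv ?_
  simp_rw [Finset.sum_mul]
  rw [Finset.sum_comm]
  refine Finset.sum_congr rfl fun i _ => ?_
  rw [← sum_prod_erase_eq_prodExp_update i (hp i)]
  exact Finset.sum_congr rfl fun t _ => by rw [smul_eq_mul]; ring

end ProductExpectation

/-! ### The combinatorial inequality for a single agent -/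

/-- If the out-neighbourhoods of `loss` contain no `loss` pairs, then many pairs are not related. -/
theorem sum_mul_one_sub_out_ge {F : Type*} [Fintype F] [DecidableEq F] (w : F → ℝ)
    (hw : ∀ e, 0 ≤ w e) (hw1 : ∑ e, w e ≤ 1) (K : Finset F) (loss : F → F → Prop)
    [∀ a b, Decidable (loss a b)]
    (hl : ∀ a ∈ K, ∀ b ∈ K, ∀ c, loss a b → loss a c → ¬ loss b c) (α : ℝ) :
    α * ∑ e ∈ K, w e - α ^ 2 / 2 * ∑ e, w e ≤
      ∑ a ∈ K, w a * (1 - ∑ b, if loss a b then w b else 0) := by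
  classical
  set Q := ∑ e, w e with hQ
  have hQ0 : 0 ≤ Q := Finset.sum_nonneg fun e _ => hw e
  rcases K.eq_empty_or_nonempty with rfl | hK
  · simp; positivity
  set out : F → ℝ := fun a => ∑ b, if loss a b then w b else 0 with hout
  -- An element `m` of largest out-weight `o`. Elements of `K` in its out-neighbourhood `O` have no
  -- out-neighbour in `O`, hence out-weight at most `Q - o`; the other elements of `K` have at most
  -- `o`.
  obtain ⟨m, hm, hmax⟩ := K.exists_max_image out hK
  set O : Finset F := Finset.univ.filter (fun b => loss m b) with hO
  set o := out m with ho
  have hoO : o = ∑ b ∈ O, w b := by rw [ho, hout, hO, Finset.sum_filter]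
  have hcompl : ∑ b ∈ Oᶜ, w b = Q - o := by
    rw [hoO, hQ, ← Finset.sum_add_sum_compl O w]; ring
  set k1 := ∑ e ∈ K.filter (· ∈ O), w e with hk1
  set k2 := ∑ e ∈ K.filter (· ∉ O), w e with hk2
  have hk : ∑ e ∈ K, w e = k1 + k2 := by
    rw [hk1, hk2, Finset.sum_filter_add_sum_filter_not]
  have hk1o : k1 ≤ o := by
    rw [hoO]
    exact Finset.sum_le_sum_of_subset_of_nonneg (fun e he => (Finset.mem_filter.1 he).2)
      fun e _ _ => hw e
  have hk2o : k2 ≤ Q - o := by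
    rw [← hcompl]
    exact Finset.sum_le_sum_of_subset_of_nonneg
      (fun e he => by simpa using (Finset.mem_filter.1 he).2) fun e _ _ => hw e
  have hk10 : 0 ≤ k1 := Finset.sum_nonneg fun e _ => hw e
  have hk20 : 0 ≤ k2 := Finset.sum_nonneg fun e _ => hw e
  have hin : ∀ a ∈ K, a ∈ O → out a ≤ Q - o := by
    intro a ha haO
    rw [← hcompl, hout]
    simp only
    rw [← Finset.sum_filter]
    refine Finset.sum_le_sum_of_subset_of_nonneg (fun b hb => ?_) fun e _ _ => hw e
    simp only [Finset.mem_compl, hO, Finset.mem_filter, Finset.mem_univ, true_and] at haO hb ⊢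
    exact fun hb' => hl m hm a ha b haO hb' hb
  have hsum : k1 * (1 - (Q - o)) + k2 * (1 - o) ≤ ∑ a ∈ K, w a * (1 - out a) := by
    rw [← Finset.sum_filter_add_sum_filter_not K (· ∈ O), hk1, hk2, Finset.sum_mul,
      Finset.sum_mul]
    refine add_le_add (Finset.sum_le_sum fun a ha => ?_) (Finset.sum_le_sum fun a ha => ?_)
    · have := hin a (Finset.mem_filter.1 ha).1 (Finset.mem_filter.1 ha).2
      exact mul_le_mul_of_nonneg_left (by linarith) (hw a)
    · have := hmax a (Finset.mem_filter.1 ha).1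
      exact mul_le_mul_of_nonneg_left (by linarith) (hw a)
  refine le_trans ?_ hsum
  rw [hk]
  have a1 : k1 * k1 ≤ k1 * o := mul_le_mul_of_nonneg_left hk1o hk10
  have a2 : k2 * k2 ≤ k2 * (Q - o) := mul_le_mul_of_nonneg_left hk2o hk20
  set κ := k1 + k2 with hκ
  have hκ0 : 0 ≤ κ := by positivity
  have hκQ : κ ≤ Q := by linarith
  have a3 : κ ^ 2 / 2 ≤ k1 * k1 + k2 * k2 := by nlinarith [sq_nonneg (k1 - k2)]
  have a4 : κ * (1 - Q) + κ ^ 2 / 2 ≤ k1 * (1 - (Q - o)) + k2 * (1 - o) := by nlinarith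
  -- What remains is affine in `Q` between `κ` and 1. `b1` and `b2` are its nonnegative values at `Q
  -- = κ` and `Q = 1` with the weights of a convex combination, cleared of denominators; hence the
  -- case `κ = 1` is separate.
  refine le_trans ?_ a4
  rcases hκ0.eq_or_lt with h | h
  · rw [← h]; nlinarith [sq_nonneg α]
  · have b1 : 0 ≤ (1 - Q) * (κ * ((1 - α) ^ 2 + (1 - κ))) :=
      mul_nonneg (by linarith) (mul_nonneg hκ0 (by nlinarith [sq_nonneg (1 - α)]))
    have b2 : 0 ≤ (Q - κ) * (κ - α) ^ 2 := mul_nonneg (by linarith) (sq_nonneg _)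
    by_cases hκ1 : κ = 1
    · have : Q = 1 := by linarith
      rw [this, hκ1]; nlinarith [sq_nonneg (1 - α)]
    · have hlt : 0 < 1 - κ := by
        rcases lt_or_eq_of_le (hκQ.trans hw1) with h' | h'
        · linarith
        · exact absurd h' hκ1
      have : 0 ≤ (1 - κ) * (2 * (κ * (1 - Q) + κ ^ 2 / 2 - (α * κ - α ^ 2 / 2 * Q))) := by
        nlinarith
      have := nonneg_of_mul_nonneg_right this hlt
      linarith

/-! ### Independence systems of matching type -/

section PairSystem

variable {E : Type*} [DecidableEq E]

open Classical in
/-- The largest cardinality of an independent subset. -/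
noncomputable def indepRank (Ind : Finset E → Prop) (X : Finset E) : ℕ :=
  (X.powerset.filter Ind).sup Finset.card

/-- A downward closed family of finite sets with the exchange property that common independent sets
of two matroids and matchings have. -/
structure PairSystem (Ind : Finset E → Prop) : Prop where
  empty : Ind ∅
  mono : ∀ S T, Ind S → T ⊆ S → Ind T
  exch : ∀ (X T₁ T₂ : Finset E) (a b c : E), a ∉ X → b ∉ X → c ∉ X →
    T₁ ⊆ insert a X → T₂ ⊆ insert b X → a ∈ T₁ → b ∈ T₂ → b ∉ T₁ → c ∉ T₁ → c ∉ T₂ →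
    Ind T₁ → Ind T₂ → Ind (insert b T₁) → Ind (insert c T₁) → Ind (insert c T₂) →
    T₁.card = indepRank Ind X → T₂.card = indepRank Ind X →
    (∀ e, e = a ∨ e = b ∨ e = c → indepRank Ind (insert e X) = indepRank Ind X) → False

theorem card_le_indepRank {Ind : Finset E → Prop} {X T : Finset E} (hT : Ind T) (h : T ⊆ X) :
    T.card ≤ indepRank Ind X := by
  classical
  exact Finset.le_sup (f := Finset.card) (by simp [hT, h])

theorem exists_card_eq_indepRank {Ind : Finset E → Prop} (h0 : Ind ∅) (X : Finset E) :
    ∃ T, T ⊆ X ∧ Ind T ∧ T.card = indepRank Ind X := by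
  classical
  have hne : (X.powerset.filter Ind).Nonempty := ⟨∅, by simp [h0]⟩
  obtain ⟨T, hT, h⟩ := Finset.exists_mem_eq_sup _ hne Finset.card
  simp only [Finset.mem_filter, Finset.mem_powerset] at hT
  exact ⟨T, hT.1, hT.2, h.symm⟩

theorem indepRank_mono {Ind : Finset E → Prop} {X Y : Finset E} (h : X ⊆ Y) :
    indepRank Ind X ≤ indepRank Ind Y := by
  classical
  refine Finset.sup_mono fun T hT => ?_
  simp only [Finset.mem_filter, Finset.mem_powerset] at hT ⊢
  exact ⟨hT.1.trans h, hT.2⟩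

theorem indepRank_insert_le {Ind : Finset E → Prop} (hI : PairSystem Ind) (e : E) (X : Finset E) :
    indepRank Ind (insert e X) ≤ indepRank Ind X + 1 := by
  obtain ⟨T, hT, hi, hc⟩ := exists_card_eq_indepRank hI.empty (insert e X)
  rw [← hc]
  have h1 : (T.erase e).card ≤ indepRank Ind X :=
    card_le_indepRank (hI.mono _ _ hi (Finset.erase_subset _ _)) (by
      intro x hx
      rw [Finset.mem_erase] at hx
      exact Finset.mem_of_mem_insert_of_ne (hT hx.2) hx.1)
  have := Finset.pred_card_le_card_erase (s := T) (a := e)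
  omega

/-- A largest independent subset. -/
noncomputable def bestIndep {Ind : Finset E → Prop} (hI : PairSystem Ind) (X : Finset E) :
    Finset E :=
  (exists_card_eq_indepRank hI.empty X).choose

variable {Ind : Finset E → Prop} (hI : PairSystem Ind)

theorem bestIndep_subset (X : Finset E) : bestIndep hI X ⊆ X :=
  (exists_card_eq_indepRank hI.empty X).choose_spec.1

theorem indep_bestIndep (X : Finset E) : Ind (bestIndep hI X) :=
  (exists_card_eq_indepRank hI.empty X).choose_spec.2.1

theorem card_bestIndep (X : Finset E) : (bestIndep hI X).card = indepRank Ind X :=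
  (exists_card_eq_indepRank hI.empty X).choose_spec.2.2

/-- Adding `a` to `X` leaves the rank unchanged, but `a` is used. -/
def Displaces (X : Finset E) (a : E) : Prop :=
  a ∈ bestIndep hI (insert a X) ∧ indepRank Ind (insert a X) = indepRank Ind X

/-- `b` fits to the largest independent subset of `insert a X`, but adding it to `X` does not
increase the rank. -/
def LosesTo (X : Finset E) (a b : E) : Prop :=
  b ∉ bestIndep hI (insert a X) ∧ Ind (insert b (bestIndep hI (insert a X))) ∧
    indepRank Ind (insert b X) = indepRank Ind X

/-- This is the only use of `PairSystem.exch`, which is tailored to it: since `a` and `b` displace,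
the sets `T₁` and `T₂` are largest independent subsets of `insert a X` and `insert b X` with the
same cardinality as those of `X`. -/
theorem not_losesTo {X : Finset E} {a b c : E} (ha : a ∉ X) (hb : b ∉ X) (hc : c ∉ X)
    (hKa : Displaces hI X a) (hKb : Displaces hI X b) (hab : LosesTo hI X a b)
    (hac : LosesTo hI X a c) : ¬ LosesTo hI X b c := by
  intro hbc
  refine hI.exch X (bestIndep hI (insert a X)) (bestIndep hI (insert b X)) a b c ha hb hc
    (bestIndep_subset hI _) (bestIndep_subset hI _) hKa.1 hKb.1 hab.1 hac.1 hbc.1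
    (indep_bestIndep hI _) (indep_bestIndep hI _) hab.2.1 hac.2.1 hbc.2.1
    (by rw [card_bestIndep, hKa.2]) (by rw [card_bestIndep, hKb.2]) ?_
  rintro e (rfl | rfl | rfl)
  · exact hKa.2
  · exact hab.2.2
  · exact hac.2.2

end PairSystem

/-! ### Random sets with at most one element per agent -/

section RandomSupport

variable {N E : Type*} [Fintype N] [DecidableEq N] [Fintype E] [DecidableEq E] {own : E → N}

/-- The set of the elements that occur in a choice of at most one element per agent. -/
def choiceSupport (t : ∀ i, Option {e // own e = i}) : Finset E :=
  Finset.univ.filter fun e => t (own e) = some ⟨e, rfl⟩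

theorem mem_choiceSupport {t : ∀ i, Option {e // own e = i}} {e : E} :
    e ∈ choiceSupport t ↔ t (own e) = some ⟨e, rfl⟩ := by
  simp [choiceSupport]

theorem coe_mem_choiceSupport {t : ∀ i, Option {e // own e = i}} {i : N} (e : {e // own e = i}) :
    (e : E) ∈ choiceSupport t ↔ t i = some e := by
  obtain ⟨e, rfl⟩ := e
  exact mem_choiceSupport

theorem choiceSupport_update_some (t : ∀ i, Option {e // own e = i}) (i : N)
    (a : {e // own e = i}) :
    choiceSupport (Function.update t i (some a)) =
      insert (a : E) (choiceSupport (Function.update t i none)) := by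
  ext e
  rw [Finset.mem_insert]
  by_cases h : own e = i
  · subst h
    rw [mem_choiceSupport, mem_choiceSupport]
    simp only [Function.update_self, Option.some.injEq, reduceCtorEq, or_false]
    rw [eq_comm, Subtype.ext_iff, eq_comm]
  · have : e ≠ a := fun h' => h (h' ▸ a.2)
    rw [mem_choiceSupport, mem_choiceSupport]
    simp [Function.update_of_ne h, this]

theorem notMem_choiceSupport_update_none (t : ∀ i, Option {e // own e = i}) (i : N)
    (a : {e // own e = i}) : (a : E) ∉ choiceSupport (Function.update t i none) := by
  rw [coe_mem_choiceSupport]; simp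

theorem own_injOn_choiceSupport (t : ∀ i, Option {e // own e = i}) :
    Set.InjOn own (choiceSupport t : Set E) := by
  intro a ha b hb hab
  rw [Finset.mem_coe, mem_choiceSupport] at ha
  rw [Finset.mem_coe, coe_mem_choiceSupport ⟨b, hab.symm⟩, ha] at hb
  simpa using hb

end RandomSupport

/-! ### ### Effect on the rank of redrawing the element of one agent -/

section RandomRank

variable {N E : Type*} [Fintype N] [DecidableEq N] [Fintype E] [DecidableEq E] {own : E → N}

/-- Weights under which agent `i` is represented by `e` with probability `s * w e`. -/
def choiceWeight (own : E → N) (w : E → ℝ) (s : ℝ) (i : N) : Option {e // own e = i} → ℝ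
  | none => 1 - s * ∑ e : {e // own e = i}, w e
  | some e => s * w e

theorem sum_choiceWeight (w : E → ℝ) (s : ℝ) (i : N) : ∑ o, choiceWeight own w s i o = 1 := by
  rw [Fintype.sum_option]
  simp [choiceWeight, Finset.mul_sum]

theorem choiceWeight_nonneg {w : E → ℝ} (hw : ∀ e, 0 ≤ w e)
    (hw1 : ∀ i, ∑ e : {e // own e = i}, w e ≤ 1) {s : ℝ} (h0 : 0 ≤ s) (h1 : s ≤ 1) (i : N)
    (o : Option {e // own e = i}) : 0 ≤ choiceWeight own w s i o := by
  cases o with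
  | none =>
    have h2 : 0 ≤ ∑ e : {e // own e = i}, w e := Finset.sum_nonneg fun e _ => hw e
    have := hw1 i
    simp only [choiceWeight]
    nlinarith
  | some e => exact mul_nonneg h0 (hw e)

theorem sum_fiber (own : E → N) (g : E → ℝ) :
    ∑ i, ∑ e : {e // own e = i}, g e = ∑ e, g e := by
  rw [← Fintype.sum_fiberwise own g]

variable {Ind : Finset E → Prop} (hI : PairSystem Ind)

/-- The rank of the support, as a real number. -/
noncomputable def choiceRank (Ind : Finset E → Prop) (t : ∀ i, Option {e // own e = i}) : ℝ :=
  indepRank Ind (choiceSupport t)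

open Classical in
/-- The indicator of `Displaces`. -/
noncomputable def displaceInd (i : N) (X : Finset E) : Option {e // own e = i} → ℝ
  | none => 0
  | some a => if Displaces hI X a then 1 else 0

open Classical in
/-- A lower bound for what resampling a displacing element gains beyond the trivial estimate. -/
noncomputable def displaceGain (w : E → ℝ) (i : N) (X : Finset E) :
    Option {e // own e = i} → ℝ
  | none => 0
  | some a => if Displaces hI X a then
      1 - ∑ b : {e // own e = i}, if LosesTo hI X a b then w b else 0 else 0

theorem le_sum_choiceWeight_one_mul {w : E → ℝ} (hw : ∀ e, 0 ≤ w e) (i : N)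
    (hw1 : ∑ e : {e // own e = i}, w e ≤ 1) (r : Option {e // own e = i} → ℝ) (r₀ : ℝ)
    (y : {e // own e = i} → ℝ) (h0 : r₀ ≤ r none) (h1 : ∀ b, r₀ + y b ≤ r (some b)) :
    r₀ + ∑ b : {e // own e = i}, w b * y b ≤ ∑ o, choiceWeight own w 1 i o * r o := by
  rw [Fintype.sum_option]
  simp only [choiceWeight, one_mul]
  have h2 : (1 - ∑ e : {e // own e = i}, w e) * r₀ ≤
      (1 - ∑ e : {e // own e = i}, w e) * r none :=
    mul_le_mul_of_nonneg_left h0 (by linarith)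
  have h3 : ∑ b : {e // own e = i}, w b * (r₀ + y b) ≤
      ∑ b : {e // own e = i}, w b * r (some b) :=
    Finset.sum_le_sum fun b _ => mul_le_mul_of_nonneg_left (h1 b) (hw b)
  simp only [mul_add, Finset.sum_add_distrib, ← Finset.sum_mul] at h3
  linarith

open Classical in
-- After agent `i` is redrawn, the part of `T` not owned by `i` is still available, and a new
-- element that fits `T` can be added. So at most the old element of `i` is lost. If that element
-- displaces, the rank is at least `T.card` even without it, and only the elements it loses to fail
-- to contribute.
theorem resample_choiceRank_ge {w : E → ℝ} (hw : ∀ e, 0 ≤ w e) (i : N)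
    (hw1 : ∑ e : {e // own e = i}, w e ≤ 1) (t : ∀ i, Option {e // own e = i}) (T : Finset E)
    (hT : T = bestIndep hI (choiceSupport t)) :
    (∑ b : {e // own e = i}, if (b : E) ∉ T ∧ Ind (insert (b : E) T) then w b else 0)
      - ((T.filter fun e => own e = i).card : ℝ)
      + displaceGain hI w i (choiceSupport (Function.update t i none)) (t i) ≤
    (∑ o, choiceWeight own w 1 i o * choiceRank Ind (Function.update t i o)) -
      choiceRank Ind t := by
  set X := choiceSupport (Function.update t i none) with hX
  have hTi : Ind T := hT ▸ indep_bestIndep hI _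
  have hTs : T ⊆ choiceSupport t := hT ▸ bestIndep_subset hI _
  have hTc : choiceRank Ind t = (T.card : ℝ) := by
    rw [choiceRank, hT, card_bestIndep]
  have hr : ∀ o, choiceRank Ind (Function.update t i o) =
      (indepRank Ind (choiceSupport (Function.update t i o)) : ℝ) := fun _ => rfl
  have hself : Function.update t i (t i) = t := Function.update_eq_self i t
  by_cases hcase : ∃ a, t i = some a ∧ (a : E) ∈ T
  · obtain ⟨a, ha, haT⟩ := hcase
    have hsup : choiceSupport t = insert (a : E) X := by
      rw [hX, ← choiceSupport_update_some, ← ha, hself]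
    have hcard : (T.filter fun e => own e = i).card = 1 := by
      rw [Finset.card_eq_one]
      refine ⟨a, ?_⟩
      ext e
      simp only [Finset.mem_filter, Finset.mem_singleton]
      constructor
      · rintro ⟨h1, h2⟩
        exact own_injOn_choiceSupport t (Finset.mem_coe.2 (hTs h1))
          (Finset.mem_coe.2 (hTs haT)) (h2.trans a.2.symm)
      · rintro rfl; exact ⟨haT, a.2⟩
    rw [hcard, ha]
    have hTe : T.erase a ⊆ X := by
      intro e he
      rw [Finset.mem_erase] at he
      have := hTs he.2
      rw [hsup] at this
      exact Finset.mem_of_mem_insert_of_ne this he.1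
    by_cases hd : Displaces hI X a
    -- Here `X` itself has rank `T.card`. A new `b` that fits `T` raises the rank, except exactly
    -- when `a` loses to `b`.
    · have h1 := le_sum_choiceWeight_one_mul hw i hw1
        (fun o => choiceRank Ind (Function.update t i o)) (T.card : ℝ)
        (fun b => (if (b : E) ∉ T ∧ Ind (insert (b : E) T) then 1 else 0) -
          (if LosesTo hI X a b then 1 else 0)) ?_ ?_
      · have e1 : ∑ b : {e // own e = i}, w b *
            ((if (b : E) ∉ T ∧ Ind (insert (b : E) T) then (1 : ℝ) else 0) -
              (if LosesTo hI X a b then 1 else 0)) =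
            (∑ b : {e // own e = i}, if (b : E) ∉ T ∧ Ind (insert (b : E) T) then w b else 0) -
            ∑ b : {e // own e = i}, if LosesTo hI X a b then w b else 0 := by
          rw [← Finset.sum_sub_distrib]
          refine Finset.sum_congr rfl fun b _ => ?_
          split_ifs <;> simp
        rw [e1] at h1
        simp only [displaceGain, if_pos hd]
        rw [hTc]
        push_cast
        linarith
      · simp only [hr, ← hX, ← hd.2, ← hsup]
        rw [← hTc]; rfl
      · intro b
        simp only [hr, choiceSupport_update_some, ← hX]
        have hge : (T.card : ℝ) ≤ indepRank Ind (insert (b : E) X) := by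
          rw [← hTc, choiceRank, hsup, hd.2]
          exact_mod_cast indepRank_mono (Finset.subset_insert _ _)
        by_cases hadd : (b : E) ∉ T ∧ Ind (insert (b : E) T)
        · by_cases hl : LosesTo hI X a b
          · rw [if_pos hadd, if_pos hl]; linarith
          · rw [if_pos hadd, if_neg hl]
            have hne : indepRank Ind (insert (b : E) X) ≠ indepRank Ind X := by
              intro h
              refine hl ⟨?_, ?_, h⟩
              · rw [← hsup, ← hT]; exact hadd.1
              · rw [← hsup, ← hT]; exact hadd.2
            have h2 := indepRank_mono (Ind := Ind) (Finset.subset_insert (b : E) X)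
            have h3 : T.card = indepRank Ind X := by
              rw [hT, card_bestIndep, hsup, hd.2]
            have h4 : T.card + 1 ≤ indepRank Ind (insert (b : E) X) := by omega
            have : ((T.card + 1 : ℕ) : ℝ) ≤ indepRank Ind (insert (b : E) X) := by exact_mod_cast h4
            push_cast at this
            linarith
        · have hl : ¬ LosesTo hI X a b := by
            intro h
            refine hadd ?_
            have := h.1
            have h' := h.2.1
            rw [← hsup, ← hT] at this h'
            exact ⟨this, h'⟩
          rw [if_neg hadd, if_neg hl]; linarith
    -- Without displacement the fallback set is `T.erase a`, to which any `b` that fits `T` can be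
    -- added.
    · have h1 := le_sum_choiceWeight_one_mul hw i hw1
        (fun o => choiceRank Ind (Function.update t i o)) ((T.erase a).card : ℝ)
        (fun b => (if (b : E) ∉ T ∧ Ind (insert (b : E) T) then 1 else 0)) ?_ ?_
      · simp only [displaceGain, if_neg hd]
        rw [hTc]
        have : ((T.erase a).card : ℝ) = T.card - 1 := by
          rw [← Finset.card_erase_add_one haT]; push_cast; ring
        simp only [mul_ite, mul_one, mul_zero] at h1
        push_cast
        linarith
      · simp only [hr, ← hX]
        exact_mod_cast card_le_indepRank (hI.mono _ _ hTi (Finset.erase_subset _ _)) hTe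
      · intro b
        simp only [hr, choiceSupport_update_some, ← hX]
        split_ifs with hadd
        · have h2 : (insert (b : E) (T.erase a)).card ≤ indepRank Ind (insert (b : E) X) :=
            card_le_indepRank (hI.mono _ _ hadd.2
              (Finset.insert_subset_insert _ (Finset.erase_subset _ _)))
              (Finset.insert_subset_insert _ hTe)
          rw [Finset.card_insert_of_notMem (fun h => hadd.1 (Finset.mem_of_mem_erase h))] at h2
          exact_mod_cast h2
        · rw [add_zero]
          exact_mod_cast card_le_indepRank (hI.mono _ _ hTi (Finset.erase_subset _ _))
            (hTe.trans (Finset.subset_insert _ _))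
  · have hTX : T ⊆ X := by
      intro e he
      have h1 := hTs he
      cases hti : t i with
      | none => rw [hX, ← hti, hself]; exact h1
      | some a =>
        have hsup : choiceSupport t = insert (a : E) X := by
          rw [hX, ← choiceSupport_update_some, ← hti, hself]
        rw [hsup, Finset.mem_insert] at h1
        rcases h1 with rfl | h1
        · exact absurd ⟨a, hti, he⟩ hcase
        · exact h1
    have hcard : (T.filter fun e => own e = i).card = 0 := by
      rw [Finset.card_eq_zero, Finset.filter_eq_empty_iff]
      intro e he hei
      refine hcase ⟨⟨e, hei⟩, ?_, he⟩
      rw [← coe_mem_choiceSupport ⟨e, hei⟩]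
      exact hTs he
    have hgain : displaceGain hI w i X (t i) = 0 := by
      cases hti : t i with
      | none => rfl
      | some a =>
        have hsup : choiceSupport t = insert (a : E) X := by
          rw [hX, ← choiceSupport_update_some, ← hti, hself]
        simp only [displaceGain]
        rw [if_neg]
        rintro ⟨h, -⟩
        rw [← hsup, ← hT] at h
        exact hcase ⟨a, hti, h⟩
    have h1 := le_sum_choiceWeight_one_mul hw i hw1
        (fun o => choiceRank Ind (Function.update t i o)) (T.card : ℝ)
        (fun b => (if (b : E) ∉ T ∧ Ind (insert (b : E) T) then 1 else 0)) ?_ ?_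
    · rw [hcard, hgain, hTc]
      simp only [mul_ite, mul_one, mul_zero] at h1
      push_cast
      linarith
    · simp only [hr, ← hX]
      exact_mod_cast card_le_indepRank hTi hTX
    · intro b
      simp only [hr, choiceSupport_update_some, ← hX]
      split_ifs with hadd
      · have h2 := card_le_indepRank hadd.2 (Finset.insert_subset_insert (b : E) hTX)
        rw [Finset.card_insert_of_notMem hadd.1] at h2
        exact_mod_cast h2
      · rw [add_zero]
        exact_mod_cast card_le_indepRank hTi (hTX.trans (Finset.subset_insert _ _))

open Classical in
-- If the element of agent `i` is used, then either it displaces or its removal lowers the rank by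
-- exactly one. If it is not used, removing it changes nothing.
theorem displaceInd_eq (i : N) (t : ∀ i, Option {e // own e = i}) :
    displaceInd hI i (choiceSupport (Function.update t i none)) (t i) =
      (((bestIndep hI (choiceSupport t)).filter fun e => own e = i).card : ℝ) -
        (choiceRank Ind t - choiceRank Ind (Function.update t i none)) := by
  set X := choiceSupport (Function.update t i none) with hX
  set T := bestIndep hI (choiceSupport t) with hT
  have hTi : Ind T := indep_bestIndep hI _
  have hTs : T ⊆ choiceSupport t := bestIndep_subset hI _
  have hTc : T.card = indepRank Ind (choiceSupport t) := card_bestIndep hI _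
  have hself : Function.update t i (t i) = t := Function.update_eq_self i t
  have hr : choiceRank Ind (Function.update t i none) = (indepRank Ind X : ℝ) := rfl
  have hr' : choiceRank Ind t = (indepRank Ind (choiceSupport t) : ℝ) := rfl
  rw [hr, hr']
  cases hti : t i with
  | none =>
    have hsup : choiceSupport t = X := by rw [hX, ← hti, hself]
    have : (T.filter fun e => own e = i).card = 0 := by
      rw [Finset.card_eq_zero, Finset.filter_eq_empty_iff]
      intro e he hei
      have := (coe_mem_choiceSupport ⟨e, hei⟩).1 (hTs he)
      rw [hti] at this
      simp at this
    rw [this, hsup]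
    simp [displaceInd]
  | some a =>
    have hsup : choiceSupport t = insert (a : E) X := by
      rw [hX, ← choiceSupport_update_some, ← hti, hself]
    simp only [displaceInd]
    by_cases haT : (a : E) ∈ T
    · have hcard : (T.filter fun e => own e = i).card = 1 := by
        rw [Finset.card_eq_one]
        refine ⟨a, ?_⟩
        ext e
        simp only [Finset.mem_filter, Finset.mem_singleton]
        constructor
        · rintro ⟨h1, h2⟩
          exact own_injOn_choiceSupport t (Finset.mem_coe.2 (hTs h1))
            (Finset.mem_coe.2 (hTs haT)) (h2.trans a.2.symm)
        · rintro rfl; exact ⟨haT, a.2⟩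
      rw [hcard, hsup]
      have h1 := indepRank_insert_le hI (a : E) X
      have h2 := indepRank_mono (Ind := Ind) (Finset.subset_insert (a : E) X)
      by_cases hd : indepRank Ind (insert (a : E) X) = indepRank Ind X
      · rw [if_pos ⟨by rw [← hsup, ← hT]; exact haT, hd⟩, hd]; simp
      · rw [if_neg (fun h => hd h.2)]
        have : indepRank Ind (insert (a : E) X) = indepRank Ind X + 1 := by omega
        rw [this]; push_cast; ring
    · have hcard : (T.filter fun e => own e = i).card = 0 := by
        rw [Finset.card_eq_zero, Finset.filter_eq_empty_iff]
        intro e he hei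
        have := (coe_mem_choiceSupport ⟨e, hei⟩).1 (hTs he)
        rw [hti, Option.some.injEq] at this
        exact haT (this ▸ he)
      have hTX : T ⊆ X := by
        intro e he
        have h1 := hTs he
        rw [hsup, Finset.mem_insert] at h1
        rcases h1 with rfl | h1
        · exact absurd he haT
        · exact h1
      have h1 := card_le_indepRank hTi hTX
      have h2 := indepRank_mono (Ind := Ind) (Finset.subset_insert (a : E) X)
      rw [if_neg (fun h => haT (by rw [hT, hsup]; exact h.1)), hcard]
      have : indepRank Ind (choiceSupport t) = indepRank Ind X := by
        rw [hsup] at hTc ⊢; omega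
      rw [this]; simp

end RandomRank

/-! ### ### The differential inequality for the expected rank -/

section ExpectedRank

variable {N E : Type*} [Fintype N] [DecidableEq N] [Fintype E] [DecidableEq E] {own : E → N}
variable {Ind : Finset E → Prop} (hI : PairSystem Ind)

open Classical in
-- The factor 3 is `2 + 1`: elements that lie in `T` or do not fit weigh at most `2 * T.card` by
-- `hP`, and the lost elements of all agents together are the `T.card` elements of `T`.
theorem sum_resample_choiceRank_ge {w : E → ℝ} (hw : ∀ e, 0 ≤ w e)
    (hw1 : ∀ i, ∑ e : {e // own e = i}, w e ≤ 1)
    (hP : ∀ T, Ind T → ∑ e, (if e ∈ T ∨ ¬ Ind (insert e T) then w e else 0) ≤ 2 * T.card)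
    (t : ∀ i, Option {e // own e = i}) :
    (∑ e, w e) - 3 * choiceRank Ind t +
      ∑ i, displaceGain hI w i (choiceSupport (Function.update t i none)) (t i) ≤
    ∑ i, ((∑ o, choiceWeight own w 1 i o * choiceRank Ind (Function.update t i o)) -
      choiceRank Ind t) := by
  set T := bestIndep hI (choiceSupport t) with hT
  have h1 := Finset.sum_le_sum fun i (_ : i ∈ Finset.univ) =>
    resample_choiceRank_ge hI hw i (hw1 i) t T hT
  refine le_trans ?_ h1
  rw [Finset.sum_add_distrib, Finset.sum_sub_distrib,
    sum_fiber own fun b => if b ∉ T ∧ Ind (insert b T) then w b else 0]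
  have h2 := hP T (indep_bestIndep hI _)
  have h3 : ∑ e, w e = (∑ b, if b ∉ T ∧ Ind (insert b T) then w b else 0) +
      ∑ e, (if e ∈ T ∨ ¬ Ind (insert e T) then w e else 0) := by
    rw [← Finset.sum_add_distrib]
    refine Finset.sum_congr rfl fun e _ => ?_
    by_cases ha : e ∈ T <;> by_cases hb : Ind (insert e T) <;> simp [ha, hb]
  have h4 : ∑ i, ((T.filter fun e => own e = i).card : ℝ) = T.card := by
    rw [← Nat.cast_sum, Finset.card_eq_sum_card_fiberwise (f := own) (t := Finset.univ)
      (fun x _ => Finset.mem_coe.2 (Finset.mem_univ _))]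
  have h5 : choiceRank Ind t = (T.card : ℝ) := by rw [choiceRank, hT, card_bestIndep]
  rw [h4, h5]
  linarith

theorem choiceSupport_update_update (t : ∀ i, Option {e // own e = i}) (i : N)
    (o : Option {e // own e = i}) :
    choiceSupport (Function.update (Function.update t i o) i none) =
      choiceSupport (Function.update t i none) := by
  rw [Function.update_idem]

/-- Given the other agents, `X` is fixed and the elements of agent `i` carry the relation `LosesTo`,
so `sum_mul_one_sub_out_ge` applies with `α = 1/3`; then `1/18` is `α ^ 2 / 2`. -/
theorem prodExp_displaceGain_ge {w : E → ℝ} (hw : ∀ e, 0 ≤ w e)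
    (hw1 : ∀ i, ∑ e : {e // own e = i}, w e ≤ 1) {s : ℝ} (h0 : 0 ≤ s) (h1 : s ≤ 1) (i : N) :
    (1 / 3) * prodExp (choiceWeight own w s) (fun t =>
        displaceInd hI i (choiceSupport (Function.update t i none)) (t i)) -
      s / 18 * ∑ e : {e // own e = i}, w e ≤
    prodExp (choiceWeight own w s) (fun t =>
        displaceGain hI w i (choiceSupport (Function.update t i none)) (t i)) := by
  classical
  rw [prodExp_eq_update i (sum_choiceWeight w s i) fun t =>
      displaceInd hI i (choiceSupport (Function.update t i none)) (t i),
    prodExp_eq_update i (sum_choiceWeight w s i) fun t =>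
      displaceGain hI w i (choiceSupport (Function.update t i none)) (t i)]
  simp only [choiceSupport_update_update, Function.update_self]
  rw [← prodExp_const (sum_choiceWeight (own := own) w s) (s / 18 * ∑ e : {e // own e = i}, w e),
    ← prodExp_const_mul, ← prodExp_sub]
  refine prodExp_mono (choiceWeight_nonneg hw hw1 h0 h1) fun t => ?_
  set X := choiceSupport (Function.update t i none) with hX
  rw [Fintype.sum_option, Fintype.sum_option]
  simp only [displaceInd, displaceGain, choiceWeight, mul_zero, zero_add]
  have hn : ∀ a : {e // own e = i}, (a : E) ∉ X := notMem_choiceSupport_update_none t i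
  have := sum_mul_one_sub_out_ge (fun e : {e // own e = i} => w e) (fun e => hw e) (hw1 i)
    (Finset.univ.filter fun a => Displaces hI X a) (fun a b => LosesTo hI X a b) (by
      intro a ha b hb c hab hac
      simp only [Finset.mem_filter, Finset.mem_univ, true_and] at ha hb
      exact not_losesTo hI (hn a) (hn b) (hn c) ha hb hab hac) (1 / 3)
  rw [Finset.sum_filter, Finset.sum_filter] at this
  have h2 := mul_le_mul_of_nonneg_left this h0
  rw [mul_sub] at h2
  rw [Finset.mul_sum]
  have e1 : ∑ x : {e // own e = i}, 1 / 3 * (s * w x * if Displaces hI X x then 1 else 0) =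
      ∑ x : {e // own e = i}, s * (1 / 3 * if Displaces hI X x then w x else 0) :=
    Finset.sum_congr rfl fun x _ => by split_ifs <;> ring
  have e2 : ∑ x : {e // own e = i}, s * w x * (if Displaces hI X x then
      1 - ∑ b : {e // own e = i}, if LosesTo hI X x b then w b else 0 else 0) =
      ∑ x : {e // own e = i}, s * (if Displaces hI X x then
      w x * (1 - ∑ b : {e // own e = i}, if LosesTo hI X x b then w b else 0) else 0) :=
    Finset.sum_congr rfl fun x _ => by split_ifs <;> ring
  rw [e1, e2, ← Finset.mul_sum, ← Finset.mul_sum, ← Finset.mul_sum]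
  linarith

/-- The law of each agent at `s` is the mixture of "no element" with weight `1 - s` and the law at 1
with weight `s`. The derivative `D` sums the differences between these two extremes; the law at `s`
is at distance `1 - s` from one and `s` from the other. -/
theorem prodExp_choiceRank_diff (w : E → ℝ) (s : ℝ) :
    ∃ D, HasDerivAt (fun r => prodExp (choiceWeight own w r) (choiceRank Ind)) D s ∧
      ∑ i, prodExp (choiceWeight own w s) (fun t =>
        (∑ o, choiceWeight own w 1 i o * choiceRank Ind (Function.update t i o)) -
          choiceRank Ind t) = (1 - s) * D ∧
      ∑ i, prodExp (choiceWeight own w s) (fun t =>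
        choiceRank Ind t - choiceRank Ind (Function.update t i none)) = s * D := by
  set p' : ∀ i, Option {e // own e = i} → ℝ := fun i o =>
    choiceWeight own w 1 i o - choiceWeight own w 0 i o with hp'
  have hd : ∀ i o, HasDerivAt (fun r => choiceWeight own w r i o) (p' i o) s := by
    intro i o
    cases o with
    | none =>
      have := ((hasDerivAt_id s).mul_const (∑ e : {e // own e = i}, w e)).const_sub 1
      refine this.congr_deriv ?_
      simp [hp', choiceWeight]
    | some e =>
      have := (hasDerivAt_id s).mul_const (w e)
      refine this.congr_deriv ?_
      simp [hp', choiceWeight]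
  set B : N → ℝ := fun i => prodExp (choiceWeight own w s) (fun t =>
    ∑ o, choiceWeight own w 1 i o * choiceRank Ind (Function.update t i o)) with hB
  set C : N → ℝ := fun i => prodExp (choiceWeight own w s) (fun t =>
    choiceRank Ind (Function.update t i none)) with hC
  set F := prodExp (choiceWeight own w s) (choiceRank Ind) with hF
  have hz : ∀ i (t : ∀ i, Option {e // own e = i}),
      ∑ o, choiceWeight own w 0 i o * choiceRank Ind (Function.update t i o) =
      choiceRank Ind (Function.update t i none) := by
    intro i t
    rw [Fintype.sum_option]
    simp [choiceWeight]
  have hFB : ∀ i, F = (1 - s) * C i + s * B i := by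
    intro i
    rw [hF, prodExp_eq_update i (sum_choiceWeight w s i), hC, hB, ← prodExp_const_mul,
      ← prodExp_const_mul, ← prodExp_add]
    congr 1
    funext t
    rw [← hz, Finset.mul_sum, Finset.mul_sum, ← Finset.sum_add_distrib]
    refine Finset.sum_congr rfl fun o _ => ?_
    cases o <;> simp only [choiceWeight] <;> ring
  refine ⟨_, hasDerivAt_prodExp (p' := fun _ => p') (sum_choiceWeight w s) hd _, ?_, ?_⟩
  all_goals
    have hD : ∀ i, prodExp (choiceWeight own w s) (fun t =>
        ∑ o, p' i o * choiceRank Ind (Function.update t i o)) = B i - C i := by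
      intro i
      rw [hB, hC, ← prodExp_sub]
      congr 1
      funext t
      rw [← hz, ← Finset.sum_sub_distrib]
      exact Finset.sum_congr rfl fun o _ => by rw [hp']; ring
    rw [Finset.mul_sum]
    refine Finset.sum_congr rfl fun i _ => ?_
    rw [prodExp_sub, hD]
  · change B i - F = _
    linear_combination -(hFB i)
  · change F - C i = _
    linear_combination hFB i

/-- The number of displacing agents has expectation `F - s * D`: all used elements, minus the rank
lost by removing agents. A third of it is added to `(1 - s) * D ≥ ω - 3 * F`, at the price of `s /
18 * ω`. -/
theorem deriv_prodExp_choiceRank_ge {w : E → ℝ} (hI : PairSystem Ind) (hw : ∀ e, 0 ≤ w e)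
    (hw1 : ∀ i, ∑ e : {e // own e = i}, w e ≤ 1)
    (hP : ∀ T, Ind T → (∑ e, open Classical in if e ∈ T ∨ ¬ Ind (insert e T) then w e else 0) ≤
      2 * T.card) {s : ℝ} (h0 : 0 ≤ s) (h1 : s ≤ 1) :
    ∃ D, HasDerivAt (fun r => prodExp (choiceWeight own w r) (choiceRank Ind)) D s ∧
      (∑ e, w e) * (1 - s / 18) -
        8 / 3 * prodExp (choiceWeight own w s) (choiceRank Ind) ≤ (1 - 2 * s / 3) * D := by
  classical
  obtain ⟨D, hD, hA, hC⟩ := prodExp_choiceRank_diff (own := own) (Ind := Ind) w s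
  refine ⟨D, hD, ?_⟩
  have hp := choiceWeight_nonneg hw hw1 h0 h1
  have hk := prodExp_mono hp (sum_resample_choiceRank_ge hI hw hw1 (by convert hP))
  rw [prodExp_sum, hA, prodExp_add, prodExp_sub, prodExp_const_mul,
    prodExp_const (sum_choiceWeight w s), prodExp_sum] at hk
  have hg := Finset.sum_le_sum fun i (_ : i ∈ Finset.univ) =>
    prodExp_displaceGain_ge hI hw hw1 h0 h1 i
  rw [Finset.sum_sub_distrib, ← Finset.mul_sum, ← Finset.mul_sum, sum_fiber own w] at hg
  have hd : ∑ i, prodExp (choiceWeight own w s) (fun t =>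
      displaceInd hI i (choiceSupport (Function.update t i none)) (t i)) =
      prodExp (choiceWeight own w s) (choiceRank Ind) - s * D := by
    simp_rw [displaceInd_eq]
    rw [← hC, ← prodExp_sum, ← prodExp_sum, ← prodExp_sub]
    congr 1
    funext t
    rw [Finset.sum_sub_distrib]
    congr 1
    rw [← Nat.cast_sum, choiceRank, ← card_bestIndep hI,
      Finset.card_eq_sum_card_fiberwise (f := own) (t := Finset.univ)
        (fun x _ => Finset.mem_coe.2 (Finset.mem_univ _))]
  rw [hd] at hg
  linarith

/-- The solution of the differential equation that bounds the expected rank. -/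
noncomputable def rankCurve (s : ℝ) : ℝ :=
  3 / 2 * (11 / 48 * (1 - (1 - 2 * s / 3) ^ 4) +
    1 / 36 * ((1 - 2 * s / 3) - (1 - 2 * s / 3) ^ 4))

theorem hasDerivAt_rankCurve (s : ℝ) :
    HasDerivAt rankCurve (11 / 12 * (1 - 2 * s / 3) ^ 3 - 1 / 36 +
      1 / 9 * (1 - 2 * s / 3) ^ 3) s := by
  have h1 : HasDerivAt (fun s : ℝ => 1 - 2 * s / 3) (-(2 / 3)) s := by
    have := (((hasDerivAt_id s).const_mul 2).div_const 3).const_sub 1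
    refine this.congr_deriv ?_
    norm_num
  have h4 := h1.fun_pow 4
  have := (((h4.const_sub 1).const_mul (11 / 48)).fun_add
    ((h1.fun_sub h4).const_mul (1 / 36))).const_mul (3 / 2)
  refine this.congr_deriv ?_
  push_cast
  ring

/-- The expected size of a largest independent set of represented elements. -/
theorem prodExp_choiceRank_ge {w : E → ℝ} (hI : PairSystem Ind) (hw : ∀ e, 0 ≤ w e)
    (hw1 : ∀ i, ∑ e : {e // own e = i}, w e ≤ 1)
    (hP : ∀ T, Ind T → (∑ e, open Classical in if e ∈ T ∨ ¬ Ind (insert e T) then w e else 0) ≤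
      2 * T.card) {s : ℝ} (h0 : 0 ≤ s) (h1 : s ≤ 1) :
    rankCurve s * ∑ e, w e ≤ prodExp (choiceWeight own w s) (choiceRank Ind) := by
  set F : ℝ → ℝ := fun r => prodExp (choiceWeight own w r) (choiceRank Ind) with hF
  set ω := ∑ e, w e with hω
  choose! D hD hDge using fun r (hr : r ∈ Set.Icc (0 : ℝ) 1) =>
    deriv_prodExp_choiceRank_ge hI hw hw1 hP hr.1 hr.2
  have hupos : ∀ r ∈ Set.Icc (0 : ℝ) 1, 0 < 1 - 2 * r / 3 := fun r hr => by linarith [hr.2]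
  -- With the integrating factor `(1 - 2 * r / 3) ^ (-4)`, the differential inequality says that the
  -- normalized difference from `rankCurve` increases. The exponent is `8 / 3` divided by `2 / 3`.
  set G : ℝ → ℝ := fun r => (F r - rankCurve r * ω) * ((1 - 2 * r / 3) ^ 4)⁻¹ with hG
  have hGd : ∀ r ∈ Set.Icc (0 : ℝ) 1, ∃ G', HasDerivAt G G' r ∧ 0 ≤ G' := by
    intro r hr
    have hu := hupos r hr
    have hu1 : HasDerivAt (fun s : ℝ => 1 - 2 * s / 3) (-(2 / 3)) r := by
      have := (((hasDerivAt_id r).const_mul 2).div_const 3).const_sub 1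
      refine this.congr_deriv ?_
      norm_num
    have hu4 := (hu1.fun_pow 4).fun_inv (pow_ne_zero 4 hu.ne')
    have hm := ((hD r hr).fun_sub ((hasDerivAt_rankCurve r).mul_const ω)).fun_mul hu4
    refine ⟨_, hm, ?_⟩
    have h2 := hDge r hr
    set u := 1 - 2 * r / 3 with hu'
    have hr' : r = 3 / 2 * (1 - u) := by rw [hu']; ring
    have h3 : 0 ≤ u * D r - (ω * (1 - r / 18) - 8 / 3 * F r) := by
      rw [hF]; linarith
    have : 0 ≤ (u * D r - (ω * (1 - r / 18) - 8 / 3 * F r)) * (u ^ 5)⁻¹ :=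
      mul_nonneg h3 (by positivity)
    convert this using 1
    rw [rankCurve, ← hu', hr']
    field_simp
    push_cast
    ring
  have hmono : MonotoneOn G (Set.Icc 0 1) := by
    refine monotoneOn_of_deriv_nonneg (convex_Icc 0 1) ?_ ?_ ?_
    · intro r hr
      obtain ⟨G', h, -⟩ := hGd r hr
      exact h.continuousAt.continuousWithinAt
    · intro r hr
      obtain ⟨G', h, -⟩ := hGd r (interior_subset hr)
      exact h.differentiableAt.differentiableWithinAt
    · intro r hr
      obtain ⟨G', h, hn⟩ := hGd r (interior_subset hr)
      rw [h.deriv]; exact hn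
  have hG0 : 0 ≤ G 0 := by
    have : 0 ≤ F 0 := by
      rw [hF]
      simp only [prodExp]
      exact Finset.sum_nonneg fun t _ => mul_nonneg
        (Finset.prod_nonneg fun i _ => choiceWeight_nonneg hw hw1 le_rfl zero_le_one i _)
        (Nat.cast_nonneg _)
    simp only [hG, rankCurve]
    norm_num
    exact this
  have h2 := hG0.trans (hmono (Set.left_mem_Icc.2 zero_le_one) ⟨h0, h1⟩ h0)
  have h3 : 0 < ((1 - 2 * s / 3) ^ 4)⁻¹ := by
    have := hupos s ⟨h0, h1⟩
    positivity
  have h4 := nonneg_of_mul_nonneg_left h2 h3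
  linarith

/-- The excess over `1/4` is all that is available for rounding errors. Without the displacement
gain, the value would be about `0.2491`. -/
theorem quarter_lt_rankCurve : 0.25008 ≤ rankCurve 0.3678 := by
  norm_num [rankCurve]

end ExpectedRank

/-! ### Common independent sets of two matroids -/

section MatroidPair

variable {E : Type*} [DecidableEq E]

theorem Matroid.Indep.exists_grow {M : Matroid E} {A B : Finset E} (hA : M.Indep (A : Set E))
    (hB : M.Indep (B : Set E)) (h : A.card ≤ B.card) :
    ∃ C : Finset E, A ⊆ C ∧ C ⊆ A ∪ B ∧ C.card = B.card ∧ M.Indep (C : Set E) := by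
  obtain ⟨n, hn⟩ := Nat.exists_eq_add_of_le h
  induction n generalizing A with
  | zero => exact ⟨A, subset_rfl, Finset.subset_union_left, by omega, hA⟩
  | succ n ih =>
    obtain ⟨e, heB, heA, hi⟩ := hA.augment_finset hB (by omega)
    rw [← Finset.coe_insert] at hi
    have hc := Finset.card_insert_of_notMem heA
    obtain ⟨C, h1, h2, h3, h4⟩ := ih hi (by omega) (by omega)
    refine ⟨C, (Finset.subset_insert _ _).trans h1, h2.trans ?_, h3, h4⟩
    rw [Finset.insert_union]
    exact Finset.insert_subset (Finset.mem_union_right _ heB) subset_rfl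

theorem Matroid.Indep.card_filter_le {M : Matroid E} {S T : Finset E} (hS : M.Indep (S : Set E))
    (hT : M.Indep (T : Set E)) (h : ∀ e ∈ S, e ∈ T ∨ ¬ M.Indep (insert e T : Finset E)) :
    S.card ≤ T.card := by
  by_contra! hlt
  obtain ⟨e, he, heT, hi⟩ := hT.augment_finset hS hlt
  rw [← Finset.coe_insert] at hi
  exact (h e he).elim heT fun h' => h' hi

/-- Independence in all of a family of matroids. -/
def CommonIndep (M : Bool → Matroid E) (S : Finset E) : Prop := ∀ c, (M c).Indep (S : Set E)

variable {M : Bool → Matroid E}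

theorem CommonIndep.subset {S T : Finset E} (hS : CommonIndep M S) (h : T ⊆ S) :
    CommonIndep M T := fun c => (hS c).subset (Finset.coe_subset.2 h)

/-- Every element outside `T` is blocked in one of the two matroids, and in each of them an
independent set spanned by `T` has at most `T.card` elements. -/
theorem CommonIndep.card_le_two_mul {S T : Finset E} (hS : CommonIndep M S)
    (hT : CommonIndep M T) (h : ∀ e ∈ S, e ∈ T ∨ ¬ CommonIndep M (insert e T)) :
    S.card ≤ 2 * T.card := by
  classical
  have key : ∀ c, (S.filter fun e => e ∈ T ∨ ¬ (M c).Indep (insert e T : Finset E)).card ≤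
      T.card := fun c =>
    ((hS c).subset (by exact_mod_cast Finset.filter_subset _ _)).card_filter_le (hT c)
      fun e he => (Finset.mem_filter.1 he).2
  have hsub : S ⊆ (S.filter fun e => e ∈ T ∨ ¬ (M true).Indep (insert e T : Finset E)) ∪
      (S.filter fun e => e ∈ T ∨ ¬ (M false).Indep (insert e T : Finset E)) := by
    intro e he
    simp only [Finset.mem_union, Finset.mem_filter, he, true_and]
    rcases h e he with h | h
    · exact Or.inl (Or.inl h)
    · rw [CommonIndep, Bool.forall_bool] at h
      tauto
  have := (Finset.card_le_card hsub).trans (Finset.card_union_le _ _)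
  have h1 := key true
  have h2 := key false
  omega

/-- The effect of an augmenting path: the larger set spans `R` in both matroids. Choose `T` with the
largest intersection with `R`. If `x ∈ R` were not spanned in `M c`, grow `insert x (T ∩ R)` inside
`insert x T` in the other matroid; the result is independent in both and meets `R` in more elements.
-/
theorem CommonIndep.exists_augment {X R : Finset E} (hR : CommonIndep M R) (hRX : R ⊆ X)
    (hlt : R.card < indepRank (CommonIndep M) X) (h0 : CommonIndep M ∅) :
    ∃ T ⊆ X, CommonIndep M T ∧ T.card = R.card + 1 ∧
      ∀ c, ∀ x ∈ R, x ∈ T ∨ ¬ (M c).Indep (insert x T : Finset E) := by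
  classical
  set 𝒯 := X.powerset.filter fun T => CommonIndep M T ∧ T.card = R.card + 1 with h𝒯
  have hne : 𝒯.Nonempty := by
    obtain ⟨S, hS, hi, hc⟩ := exists_card_eq_indepRank h0 X
    obtain ⟨T, hT, hTc⟩ := Finset.exists_subset_card_eq (s := S) (n := R.card + 1) (by omega)
    exact ⟨T, by
      simp only [h𝒯, Finset.mem_filter, Finset.mem_powerset]
      exact ⟨hT.trans hS, hi.subset hT, hTc⟩⟩
  obtain ⟨T, hT, hmax⟩ := 𝒯.exists_max_image (fun T => (T ∩ R).card) hne
  simp only [h𝒯, Finset.mem_filter, Finset.mem_powerset] at hT hmax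
  obtain ⟨hTX, hTi, hTc⟩ := hT
  refine ⟨T, hTX, hTi, hTc, fun c x hx => ?_⟩
  by_contra! hcon
  obtain ⟨hxT, hxi⟩ := hcon
  have hxTR : x ∉ T ∩ R := fun h => hxT (Finset.mem_inter.1 h).1
  have hcard := Finset.card_insert_of_notMem hxTR
  have hsub : insert x (T ∩ R) ⊆ R :=
    Finset.insert_subset hx Finset.inter_subset_right
  obtain ⟨C, h1, h2, h3, h4⟩ := ((hR.subset hsub) (!c)).exists_grow (hTi (!c)) (by
    have := Finset.card_le_card hsub; omega)
  have h5 : C ⊆ insert x T := h2.trans (by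
    intro y hy
    simp only [Finset.mem_union, Finset.mem_insert, Finset.mem_inter] at hy ⊢
    tauto)
  have hC : CommonIndep M C := by
    intro d
    by_cases hd : d = c
    · subst hd; exact hxi.subset (by exact_mod_cast h5)
    · have : d = !c := by cases d <;> cases c <;> simp_all
      rw [this]; exact h4
  have := hmax C ⟨h5.trans (Finset.insert_subset (hRX hx) hTX), hC, by omega⟩
  have h6 := Finset.card_le_card (Finset.subset_inter h1 hsub)
  omega

/-- If `T₁ = T₂`, then `e` can simply be added. Otherwise `T₂` is moved towards `T₁`, by induction
on the number of elements of `T₁` missing from it, while it stays a largest common independent set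
to which `e` can be added in `M (!c)`. -/
theorem CommonIndep.lt_indepRank_insert {X : Finset E} {m : ℕ}
    (hm : indepRank (CommonIndep M) X = m) {e : E} {c : Bool} :
    ∀ T₁ T₂ : Finset E, T₁ ⊆ X → T₂ ⊆ X → e ∉ X → CommonIndep M T₁ → CommonIndep M T₂ →
      T₁.card = m → T₂.card = m → (M c).Indep (insert e T₁ : Finset E) →
      (M (!c)).Indep (insert e T₂ : Finset E) → m < indepRank (CommonIndep M) (insert e X) := by
  intro T₁ T₂ hT₁X hT₂X heX hT₁ hT₂ hc₁ hc₂ hi₁ hi₂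
  obtain ⟨n, hn⟩ : ∃ n, n + (T₂ ∩ T₁).card = m :=
    ⟨m - (T₂ ∩ T₁).card, Nat.sub_add_cancel
      (hc₁ ▸ Finset.card_le_card Finset.inter_subset_right)⟩
  have hall : ∀ {S : Finset E}, (M c).Indep (S : Set E) → (M (!c)).Indep (S : Set E) →
      CommonIndep M S := by
    intro S h1 h2 d
    by_cases hd : d = c
    · exact hd ▸ h1
    · have : d = !c := by cases d <;> cases c <;> simp_all
      exact this ▸ h2
  induction n generalizing T₂ with
  | zero =>
    have h12 : T₂ ∩ T₁ = T₁ := Finset.eq_of_subset_of_card_le Finset.inter_subset_right (by omega)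
    have h21 : T₂ ∩ T₁ = T₂ := Finset.eq_of_subset_of_card_le Finset.inter_subset_left (by omega)
    have : T₂ = T₁ := h21.symm.trans h12
    subst this
    have := card_le_indepRank (hall hi₁ hi₂) (Finset.insert_subset_insert e hT₂X)
    rw [Finset.card_insert_of_notMem fun h => heX (hT₂X h)] at this
    omega
  | succ n ih =>
    have heT₁ : e ∉ T₁ := fun h => heX (hT₁X h)
    have heT₂ : e ∉ T₂ := fun h => heX (hT₂X h)
    obtain ⟨x, hx, hxT₂, hxi⟩ := (hT₂ c).augment_finset hi₁ (by
      rw [Finset.card_insert_of_notMem heT₁]; omega)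
    rw [← Finset.coe_insert] at hxi
    rcases Finset.mem_insert.1 hx with rfl | hxT₁
    · have := card_le_indepRank (hall hxi hi₂) (Finset.insert_subset_insert x hT₂X)
      rw [Finset.card_insert_of_notMem heT₂] at this
      omega
    have hnot : ¬ (M (!c)).Indep (insert x T₂ : Finset E) := by
      intro h
      have := card_le_indepRank (hall hxi h) (Finset.insert_subset (hT₁X hxT₁) hT₂X)
      rw [Finset.card_insert_of_notMem hxT₂] at this
      omega
    have hxI : x ∉ T₂ ∩ T₁ := fun h => hxT₂ (Finset.mem_inter.1 h).1
    have hsub : insert x (T₂ ∩ T₁) ⊆ T₁ := Finset.insert_subset hxT₁ Finset.inter_subset_right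
    have hcard := Finset.card_insert_of_notMem hxI
    have heq := Finset.card_insert_of_notMem heT₂
    -- In `M (!c)`, the part shared with `T₁`, enlarged by `x`, grows from `insert e T₂`. By `hnot`
    -- the result must use `e`; without `e` it lies in `insert x T₂`, which is independent in `M c`.
    -- So `C.erase e` replaces `T₂`.
    obtain ⟨C, h1, h2, h3, h4⟩ := ((hT₁.subset hsub) (!c)).exists_grow hi₂ (by omega)
    have h5 : C ⊆ insert e (insert x T₂) := h2.trans (by
      intro y hy
      simp only [Finset.mem_union, Finset.mem_insert, Finset.mem_inter] at hy ⊢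
      tauto)
    have hxe : x ≠ e := fun h => heX (h ▸ hT₁X hxT₁)
    have heC : e ∈ C := by
      by_contra heC
      have h6 : C ⊆ insert x T₂ := fun y hy =>
        Finset.mem_of_mem_insert_of_ne (h5 hy) fun h => heC (h ▸ hy)
      have h7 : C = insert x T₂ := Finset.eq_of_subset_of_card_le h6 (by
        rw [Finset.card_insert_of_notMem hxT₂]; omega)
      exact hnot (h7 ▸ h4)
    have h6 : C.erase e ⊆ insert x T₂ := by
      intro y hy
      rw [Finset.mem_erase] at hy
      exact Finset.mem_of_mem_insert_of_ne (h5 hy.2) hy.1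
    have h7 : insert x (T₂ ∩ T₁) ⊆ C.erase e ∩ T₁ := by
      intro y hy
      refine Finset.mem_inter.2 ⟨Finset.mem_erase.2 ⟨?_, h1 hy⟩, hsub hy⟩
      rintro rfl
      exact heT₁ (hsub hy)
    have h8 := Finset.card_le_card h7
    have h9 := Finset.card_erase_add_one heC
    have h10 : (C.erase e ∩ T₁).card = (T₂ ∩ T₁).card + 1 := by
      refine le_antisymm ?_ (hcard ▸ h8)
      rw [← hcard]
      refine Finset.card_le_card fun y hy => ?_
      rw [Finset.mem_inter] at hy
      have := h6 hy.1
      simp only [Finset.mem_insert, Finset.mem_inter] at this ⊢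
      tauto
    refine ih (C.erase e) (h6.trans (Finset.insert_subset (hT₁X hxT₁) hT₂X))
      (hall (hxi.subset (by exact_mod_cast h6))
        (h4.subset (by exact_mod_cast Finset.erase_subset _ _))) (by omega) ?_ (by omega)
    rw [Finset.insert_erase heC]
    exact h4

/-- `T` spans all of `S`, including `a`. The augmentation of `T` from `insert e S` can therefore
only pick `e`. -/
theorem Matroid.Indep.indep_insert_of_spanned {M : Matroid E} {S T : Finset E} {a e : E}
    (hT : M.Indep (T : Set E)) (hcard : S.card = T.card)
    (hS : ∀ x ∈ S.erase a, x ∈ T ∨ ¬ M.Indep (insert x T : Finset E))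
    (ha : ¬ M.Indep (insert a T : Finset E)) (heS : e ∉ S)
    (he : M.Indep (insert e S : Finset E)) : M.Indep (insert e T : Finset E) := by
  obtain ⟨x, hx, hxT, hi⟩ := hT.augment_finset he (by
    rw [Finset.card_insert_of_notMem heS]; omega)
  rw [← Finset.coe_insert] at hi
  rcases Finset.mem_insert.1 hx with rfl | hxS
  · exact hi
  · by_cases hxa : x = a
    · subst hxa; exact absurd hi ha
    · exact ((hS x (Finset.mem_erase.2 ⟨hxa, hxS⟩)).elim hxT fun h => h hi).elim

/-- Let `S₁`, `S₂` be largest in `X` and span `T₁.erase a`, `T₂.erase b` in both matroids. As `a`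
does not fit `S₁`, it is spanned in some `M d`, so `b` and `c` fit `S₁` in `M d`. By
`lt_indepRank_insert`, `b` cannot fit `S₂` in the other matroid, so there `S₂` spans `T₂` and `c`
fits it. Now `c` fits `S₁` in one matroid and `S₂` in the other, which would raise the rank. -/
theorem pairSystem_commonIndep (M : Bool → Matroid E) : PairSystem (CommonIndep M) := by
  have h0 : CommonIndep M ∅ := fun c => by simp
  refine ⟨h0, fun S T hS h => hS.subset h, ?_⟩
  intro X T₁ T₂ a b c ha hb hc hT₁ hT₂ haT hbT hbT₁ hcT₁ hcT₂ hi₁ hi₂ hib hic hic₂ hr₁ hr₂ hex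
  set m := indepRank (CommonIndep M) X with hm
  have hmax : ∀ T ⊆ X, CommonIndep M T → T.card = m → ∀ e, e = a ∨ e = b ∨ e = c →
      ¬ CommonIndep M (insert e T) := by
    intro T hT hTi hTm e he hcon
    have heX : e ∉ X := by rcases he with rfl | rfl | rfl <;> assumption
    have := card_le_indepRank hcon (Finset.insert_subset_insert e hT)
    rw [hex e he, Finset.card_insert_of_notMem fun h => heX (hT h)] at this
    omega
  have hH : ∀ T₁ T₂ : Finset E, T₁ ⊆ X → T₂ ⊆ X → CommonIndep M T₁ → CommonIndep M T₂ →
      T₁.card = m → T₂.card = m → ∀ d e, (e = a ∨ e = b ∨ e = c) →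
      (M d).Indep (insert e T₁ : Finset E) → ¬ (M (!d)).Indep (insert e T₂ : Finset E) := by
    intro T₁ T₂ h1 h2 h3 h4 h5 h6 d e he h7 h8
    have heX : e ∉ X := by rcases he with rfl | rfl | rfl <;> assumption
    have := CommonIndep.lt_indepRank_insert hm.symm T₁ T₂ h1 h2 heX h3 h4 h5 h6 h7 h8
    rw [hex e he] at this
    omega
  have aug : ∀ (T : Finset E) (x : E), T ⊆ insert x X → x ∈ T → CommonIndep M T → T.card = m →
      ∃ S ⊆ X, CommonIndep M S ∧ S.card = m ∧
      ∀ d, ∀ y ∈ T.erase x, y ∈ S ∨ ¬ (M d).Indep (insert y S : Finset E) := by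
    intro T x hTX hxT hTi hTm
    have h1 := Finset.card_erase_add_one hxT
    obtain ⟨S, h2, h3, h4, h5⟩ := (hTi.subset (Finset.erase_subset x T)).exists_augment (X := X)
      (fun y hy => by
        rw [Finset.mem_erase] at hy
        exact Finset.mem_of_mem_insert_of_ne (hTX hy.2) hy.1) (by omega) h0
    exact ⟨S, h2, h3, by omega, h5⟩
  obtain ⟨S₁, hS₁X, hS₁, hS₁m, hsp₁⟩ := aug T₁ a hT₁ haT hi₁ hr₁
  obtain ⟨S₂, hS₂X, hS₂, hS₂m, hsp₂⟩ := aug T₂ b hT₂ hbT hi₂ hr₂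
  obtain ⟨d, hd⟩ := not_forall.1 (hmax S₁ hS₁X hS₁ hS₁m a (Or.inl rfl))
  have hb₁ : (M d).Indep (insert b S₁ : Finset E) :=
    (hS₁ d).indep_insert_of_spanned (hr₁.trans hS₁m.symm) (hsp₁ d) hd hbT₁ (hib d)
  have hc₁ : (M d).Indep (insert c S₁ : Finset E) :=
    (hS₁ d).indep_insert_of_spanned (hr₁.trans hS₁m.symm) (hsp₁ d) hd hcT₁ (hic d)
  have hd₂ : ¬ (M (!d)).Indep (insert b S₂ : Finset E) :=
    hH S₁ S₂ hS₁X hS₂X hS₁ hS₂ hS₁m hS₂m d b (Or.inr (Or.inl rfl)) hb₁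
  have hc₂ : (M (!d)).Indep (insert c S₂ : Finset E) :=
    (hS₂ (!d)).indep_insert_of_spanned (hr₂.trans hS₂m.symm) (hsp₂ (!d)) hd₂ hcT₂ (hic₂ (!d))
  exact hH S₁ S₂ hS₁X hS₂X hS₁ hS₂ hS₁m hS₂m d c (Or.inr (Or.inr rfl)) hc₁ hc₂

end MatroidPair

/-! ### Matchings -/

section Matching

variable {E W : Type*} [DecidableEq E] [DecidableEq W]

/-- Sets of edges without common endpoints. -/
def MatchIndep (V : E → Finset W) (T : Finset E) : Prop :=
  (T : Set E).PairwiseDisjoint V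

variable {V : E → Finset W}

theorem MatchIndep.subset {S T : Finset E} (hS : MatchIndep V S) (h : T ⊆ S) : MatchIndep V T :=
  Set.PairwiseDisjoint.subset hS (Finset.coe_subset.2 h)

theorem MatchIndep.card_biUnion (hV : ∀ e, (V e).card = 2) {T : Finset E}
    (hT : MatchIndep V T) : (T.biUnion V).card = 2 * T.card := by
  rw [Finset.card_biUnion hT, Finset.sum_congr rfl fun e _ => hV e]
  simp [mul_comm]

theorem MatchIndep.insert_of_disjoint {T : Finset E} (hT : MatchIndep V T) {e : E}
    (h : ∀ f ∈ T, f ≠ e → Disjoint (V e) (V f)) : MatchIndep V (insert e T) := by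
  intro a ha b hb hab
  rw [Finset.mem_coe, Finset.mem_insert] at ha hb
  rcases ha with rfl | ha <;> rcases hb with rfl | hb
  · exact absurd rfl hab
  · exact h b hb hab.symm
  · exact (h a ha hab).symm
  · exact hT ha hb hab

theorem MatchIndep.disjoint_of_insert {T : Finset E} {e f : E} (hT : MatchIndep V (insert e T))
    (hf : f ∈ T) (he : e ∉ T) : Disjoint (V e) (V f) :=
  hT (by simp) (by simp [hf]) (fun h => he (h ▸ hf))

theorem MatchIndep.card_le_of_meets {S : Finset E} (hS : MatchIndep V S) (U : Finset W)
    (h : ∀ e ∈ S, ¬ Disjoint (V e) U) : S.card ≤ U.card := by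
  have h1 : (S.biUnion fun e => V e ∩ U).card = ∑ e ∈ S, (V e ∩ U).card :=
    Finset.card_biUnion fun a ha b hb hab =>
      (hS ha hb hab).mono Finset.inter_subset_left Finset.inter_subset_left
  have h2 : (S.biUnion fun e => V e ∩ U).card ≤ U.card :=
    Finset.card_le_card (Finset.biUnion_subset.2 fun e _ => Finset.inter_subset_right)
  have h3 : ∑ e ∈ S, 1 ≤ ∑ e ∈ S, (V e ∩ U).card := Finset.sum_le_sum fun e he =>
    Finset.card_pos.2 (Finset.not_disjoint_iff_nonempty_inter.1 (h e he))
  rw [Finset.sum_const, smul_eq_mul, mul_one] at h3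
  omega

/-- The effect of an augmenting path: the larger matching covers every vertex that `R` covers.
Choose `T` sharing most edges with `R`; if it missed an endpoint of `e ∈ R`, then `e` could replace
an edge of `T` outside `R`. -/
theorem MatchIndep.exists_augment {X R : Finset E} (hV : ∀ e, (V e).card = 2)
    (hR : MatchIndep V R) (hRX : R ⊆ X) (hlt : R.card < indepRank (MatchIndep V) X) :
    ∃ T ⊆ X, MatchIndep V T ∧ T.card = R.card + 1 ∧ R.biUnion V ⊆ T.biUnion V := by
  classical
  have h0 : MatchIndep V ∅ := by simp [MatchIndep]
  set 𝒯 := X.powerset.filter fun T => MatchIndep V T ∧ T.card = R.card + 1 with h𝒯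
  have hne : 𝒯.Nonempty := by
    obtain ⟨S, hS, hi, hc⟩ := exists_card_eq_indepRank h0 X
    obtain ⟨T, hT, hTc⟩ := Finset.exists_subset_card_eq (s := S) (n := R.card + 1) (by omega)
    exact ⟨T, by
      simp only [h𝒯, Finset.mem_filter, Finset.mem_powerset]
      exact ⟨hT.trans hS, hi.subset hT, hTc⟩⟩
  obtain ⟨T, hT, hmax⟩ := 𝒯.exists_max_image (fun T => (T ∩ R).card) hne
  simp only [h𝒯, Finset.mem_filter, Finset.mem_powerset] at hT hmax
  obtain ⟨hTX, hTi, hTc⟩ := hT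
  refine ⟨T, hTX, hTi, hTc, ?_⟩
  by_contra hcon
  obtain ⟨x, hxR, hxT⟩ := Finset.not_subset.1 hcon
  obtain ⟨e, heR, hxe⟩ := Finset.mem_biUnion.1 hxR
  have heT : e ∉ T := fun h => hxT (Finset.mem_biUnion.2 ⟨e, h, hxe⟩)
  have hex : ∃ f ∈ T, f ∉ R ∧ ∀ g ∈ T, g ≠ f → Disjoint (V e) (V g) := by
    obtain ⟨y, hy⟩ : ∃ y, (V e).erase x = {y} := Finset.card_eq_one.1 (by
      rw [Finset.card_erase_of_mem hxe, hV])
    have hVe : ∀ z ∈ V e, z = x ∨ z = y := by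
      intro z hz
      by_cases h : z = x
      · exact Or.inl h
      · have : z ∈ (V e).erase x := Finset.mem_erase.2 ⟨h, hz⟩
        rw [hy, Finset.mem_singleton] at this
        exact Or.inr this
    have hye : y ∈ V e := Finset.mem_of_mem_erase (hy ▸ Finset.mem_singleton_self y)
    have hdis : ∀ g ∈ T, y ∉ V g → Disjoint (V e) (V g) := by
      intro g hg hyg
      rw [Finset.disjoint_left]
      intro z hz hzg
      rcases hVe z hz with rfl | rfl
      · exact hxT (Finset.mem_biUnion.2 ⟨g, hg, hzg⟩)
      · exact hyg hzg
    -- The edge of `T` at the other endpoint `y` must go; it is not in `R` because `e` is. If there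
    -- is none, any edge of `T` outside `R` may go.
    by_cases hyT : ∃ f ∈ T, y ∈ V f
    · obtain ⟨f, hf, hyf⟩ := hyT
      refine ⟨f, hf, fun hfR => ?_, fun g hg hgf => hdis g hg fun hyg => ?_⟩
      · exact Finset.disjoint_left.1 (hR heR hfR (fun h => heT (h ▸ hf))) hye hyf
      · exact Finset.disjoint_left.1 (hTi hg hf hgf) hyg hyf
    · push Not at hyT
      obtain ⟨f, hf, hfR⟩ := Finset.exists_mem_notMem_of_card_lt_card (s := R) (t := T) (by omega)
      exact ⟨f, hf, hfR, fun g hg _ => hdis g hg (hyT g hg)⟩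
  obtain ⟨f, hfT, hfR, hf⟩ := hex
  have hnew : MatchIndep V (insert e (T.erase f)) :=
    (hTi.subset (Finset.erase_subset f T)).insert_of_disjoint fun g hg _ => by
      rw [Finset.mem_erase] at hg
      exact hf g hg.2 hg.1
  have heE : e ∉ T.erase f := fun h => heT (Finset.mem_of_mem_erase h)
  have hle := hmax (insert e (T.erase f)) ⟨Finset.insert_subset (hRX heR)
    ((Finset.erase_subset f T).trans hTX), hnew, by
      rw [Finset.card_insert_of_notMem heE, Finset.card_erase_add_one hfT, hTc]⟩
  have hsub : insert e (T ∩ R) ⊆ insert e (T.erase f) ∩ R := by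
    intro z hz
    simp only [Finset.mem_insert, Finset.mem_inter, Finset.mem_erase] at hz ⊢
    rcases hz with rfl | ⟨h1, h2⟩
    · exact ⟨Or.inl rfl, heR⟩
    · exact ⟨Or.inr ⟨fun h => hfR (h ▸ h2), h1⟩, h2⟩
  have := Finset.card_le_card hsub
  rw [Finset.card_insert_of_notMem fun h => heT (Finset.mem_inter.1 h).1] at this
  omega

/-- A largest matching `T` in `X` covers the vertices of `T₁.erase a` and just two more. The edges
`a`, `b`, `c` are pairwise disjoint and avoid `T₁.erase a`, and each must meet these two vertices,
or else it could be added to `T`. Three disjoint edges cannot all meet two vertices. -/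
theorem pairSystem_matchIndep (hV : ∀ e, (V e).card = 2) : PairSystem (MatchIndep V) := by
  have h0 : MatchIndep V ∅ := by simp [MatchIndep]
  refine ⟨h0, fun S T hS h => hS.subset h, ?_⟩
  intro X T₁ T₂ a b c ha hb hc hT₁ hT₂ haT hbT hbT₁ hcT₁ hcT₂ hi₁ hi₂ hib hic hic₂ hr₁ hr₂ hex
  have hR := hi₁.subset (Finset.erase_subset a T₁)
  have h1 := Finset.card_erase_add_one haT
  obtain ⟨T, hTX, hT, hTc, hsub⟩ := hR.exists_augment (X := X) hV
    (fun y hy => by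
      rw [Finset.mem_erase] at hy
      exact Finset.mem_of_mem_insert_of_ne (hT₁ hy.2) hy.1) (by omega)
  have hab : a ≠ b := fun h => hbT₁ (h ▸ haT)
  have hac : a ≠ c := fun h => hcT₁ (h ▸ haT)
  have hbc : b ≠ c := fun h => hcT₂ (h ▸ hbT)
  have hS : MatchIndep V {a, b, c} := by
    have d1 := hib.disjoint_of_insert haT hbT₁
    have d2 := hic.disjoint_of_insert haT hcT₁
    have d3 := hic₂.disjoint_of_insert hbT hcT₂
    refine MatchIndep.insert_of_disjoint (MatchIndep.insert_of_disjoint (by simp [MatchIndep]) ?_) ?_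
    · simp only [Finset.mem_singleton]
      rintro f rfl -
      exact d3.symm
    · simp only [Finset.mem_insert, Finset.mem_singleton]
      rintro f (rfl | rfl) -
      · exact d1.symm
      · exact d2.symm
  have hmeet : ∀ e ∈ ({a, b, c} : Finset E), ¬ Disjoint (V e) (T.biUnion V \ (T₁.erase a).biUnion V) := by
    intro e he hdis
    simp only [Finset.mem_insert, Finset.mem_singleton] at he
    have heX : e ∉ X := by rcases he with rfl | rfl | rfl <;> assumption
    have heT : e ∉ T := fun h => heX (hTX h)
    have hdR : Disjoint (V e) ((T₁.erase a).biUnion V) := by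
      rw [Finset.disjoint_biUnion_right]
      intro g hg
      rw [Finset.mem_erase] at hg
      rcases he with rfl | rfl | rfl
      · exact hi₁ haT hg.2 hg.1.symm
      · exact hib.disjoint_of_insert hg.2 hbT₁
      · exact hic.disjoint_of_insert hg.2 hcT₁
    have hd : Disjoint (V e) (T.biUnion V) := by
      rw [Finset.disjoint_left] at hdis hdR ⊢
      intro z hz hzT
      exact hdis hz (Finset.mem_sdiff.2 ⟨hzT, hdR hz⟩)
    rw [Finset.disjoint_biUnion_right] at hd
    have := card_le_indepRank (hT.insert_of_disjoint (e := e) fun f hf _ => hd f hf)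
      (Finset.insert_subset_insert e hTX)
    rw [hex e he, Finset.card_insert_of_notMem heT] at this
    omega
  have h2 := hS.card_le_of_meets _ hmeet
  rw [Finset.card_sdiff_of_subset hsub, hT.card_biUnion hV, hR.card_biUnion hV,
    Finset.card_eq_three.2 ⟨a, b, c, hab, hac, hbc, rfl⟩] at h2
  omega

open Classical in
theorem MatchIndep.card_blocked_le (hV : ∀ e, (V e).card = 2) {S T : Finset E}
    (hS : MatchIndep V S) (hT : MatchIndep V T)
    (h : ∀ e ∈ S, e ∈ T ∨ ¬ MatchIndep V (insert e T)) : S.card ≤ 2 * T.card := by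
  rw [← hT.card_biUnion hV]
  refine hS.card_le_of_meets _ fun e he hd => ?_
  rw [Finset.disjoint_biUnion_right] at hd
  rcases h e he with h | h
  · have h1 := hd e h
    rw [disjoint_self, Finset.bot_eq_empty] at h1
    have := hV e
    rw [h1] at this
    simp at this
  · exact h (hT.insert_of_disjoint fun f hf _ => hd f hf)

end Matching

/-! ### Linear relaxations of the feasible sets -/

/-- A representation of the feasible sets by independent sets of a system of matching type on a
set `E` of representatives of services. -/
structure ServiceSystem {N J : Type*} [DecidableEq N] [DecidableEq J] (I : BMUMD N J) {E : Type*}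
    [DecidableEq E] (svc : E → J) (IndServ : Finset J → Prop) (Ind : Finset E → Prop) : Prop where
  feasible_iff : ∀ S, S ∈ I.feasible ↔
    IndServ S ∧ ∀ i, (S.filter (fun j => I.owner j = i)).card ≤ 1
  indServ_mono : ∀ S T, IndServ S → T ⊆ S → IndServ T
  pairSystem : PairSystem Ind
  card_blocked_le : ∀ S T, Ind S → Ind T → (∀ e ∈ S, e ∈ T ∨ ¬ Ind (insert e T)) →
    S.card ≤ 2 * T.card
  exists_lift : ∀ S, IndServ S → ∃ T, Ind T ∧ Set.InjOn svc T ∧ T.image svc = S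
  card_cover_le : ∀ A T, IndServ A → Ind T → Set.InjOn svc T →
    (∀ e ∈ T, svc e ∈ A ∨ ¬ IndServ (insert (svc e) A)) → T.card ≤ 2 * A.card

/-! ### ### Matroid intersections and bundle auctions as service systems -/

section Instances

variable {N J : Type*} [Fintype N] [DecidableEq N] [Fintype J] [DecidableEq J]

theorem BMUMD.IsMatroidIntersection.serviceSystem {I : BMUMD N J} {M₁ M₂ : Matroid J}
    (h : I.IsMatroidIntersection M₁ M₂) :
    ServiceSystem I (id : J → J) (CommonIndep fun c => if c then M₁ else M₂)
      (CommonIndep fun c => if c then M₁ else M₂) where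
  feasible_iff S := by
    rw [h S, CommonIndep, Bool.forall_bool]
    simp only [Bool.false_eq_true, if_false, if_true]
    tauto
  indServ_mono _ _ hS h := hS.subset h
  pairSystem := pairSystem_commonIndep _
  card_blocked_le S T hS hT h := hS.card_le_two_mul hT h
  exists_lift S hS := ⟨S, hS, Function.injective_id.injOn, Finset.image_id⟩
  card_cover_le A T hA hT _ h := hT.card_le_two_mul hA h

variable {K : Type*} [DecidableEq K]

/-- A bundle together with a copy of each of its items. -/
abbrev CopyChoice (mult : K → ℕ) (bundle : J → Finset K) : Type _ :=
  Σ j, ∀ k : {k // k ∈ bundle j}, Fin (mult k)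

/-- The copies chosen, and private dummies such that there are two of them. -/
def copyEnds (mult : K → ℕ) (bundle : J → Finset K) (e : CopyChoice mult bundle) :
    Finset ((K × ℕ) ⊕ (J × ℕ)) :=
  ((bundle e.1).attach.map ⟨fun k => (k.1, (e.2 k : ℕ)), fun a b h => by
    simp only [Prod.mk.injEq] at h; exact Subtype.ext h.1⟩).disjSum
    ((Finset.range (2 - (bundle e.1).card)).map ⟨fun n => (e.1, n), fun a b h => by simpa using h⟩)

theorem card_copyEnds {mult : K → ℕ} {bundle : J → Finset K} (h : ∀ j, (bundle j).card ≤ 2)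
    (e : CopyChoice mult bundle) : (copyEnds mult bundle e).card = 2 := by
  have := h e.1
  simp [copyEnds]
  omega

theorem inl_mem_copyEnds {mult : K → ℕ} {bundle : J → Finset K} {e : CopyChoice mult bundle}
    {k : K} {n : ℕ} : Sum.inl (k, n) ∈ copyEnds mult bundle e ↔
      ∃ hk : k ∈ bundle e.1, (e.2 ⟨k, hk⟩ : ℕ) = n := by
  simp only [copyEnds, Finset.inl_mem_disjSum, Finset.mem_map, Finset.mem_attach, true_and]
  constructor
  · rintro ⟨⟨k', hk'⟩, h⟩
    obtain ⟨rfl, h2⟩ := Prod.mk.inj h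
    exact ⟨hk', h2⟩
  · rintro ⟨hk, h⟩
    exact ⟨⟨k, hk⟩, Prod.ext rfl h⟩

theorem inr_mem_copyEnds {mult : K → ℕ} {bundle : J → Finset K} {e : CopyChoice mult bundle}
    {j : J} {n : ℕ} : Sum.inr (j, n) ∈ copyEnds mult bundle e → e.1 = j := by
  simp only [copyEnds, Finset.inr_mem_disjSum, Finset.mem_map]
  rintro ⟨_, _, h⟩
  exact (Prod.mk.inj h).1

theorem disjoint_copyEnds {mult : K → ℕ} {bundle : J → Finset K} {e f : CopyChoice mult bundle}
    (hne : e.1 ≠ f.1)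
    (h : ∀ k (he : k ∈ bundle e.1) (hf : k ∈ bundle f.1), e.2 ⟨k, he⟩ ≠ f.2 ⟨k, hf⟩) :
    Disjoint (copyEnds mult bundle e) (copyEnds mult bundle f) := by
  rw [Finset.disjoint_left]
  rintro (⟨k, n⟩ | ⟨j, n⟩) h1 h2
  · obtain ⟨he, h1⟩ := inl_mem_copyEnds.1 h1
    obtain ⟨hf, h2⟩ := inl_mem_copyEnds.1 h2
    exact h k he hf (Fin.ext (h1.trans h2.symm))
  · exact hne ((inr_mem_copyEnds h1).trans (inr_mem_copyEnds h2).symm)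

/-- For each item, the bundles of `S` containing it are injected into its copies; distinct bundles
then get disjoint ends. -/
theorem exists_copyChoice {mult : K → ℕ} {bundle : J → Finset K} {S : Finset J}
    (hS : ∀ k, (S.filter fun j => k ∈ bundle j).card ≤ mult k) :
    ∃ T : Finset (CopyChoice mult bundle), MatchIndep (copyEnds mult bundle) T ∧
      Set.InjOn Sigma.fst (T : Set (CopyChoice mult bundle)) ∧ T.image Sigma.fst = S := by
  have h1 : ∀ k, Nonempty ({j // j ∈ S.filter fun j => k ∈ bundle j} ↪ Fin (mult k)) := by
    intro k
    refine Function.Embedding.nonempty_of_card_le ?_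
    rw [Fintype.card_coe, Fintype.card_fin]
    exact hS k
  have f := fun k => (h1 k).some
  set g : {j // j ∈ S} → CopyChoice mult bundle := fun j =>
    ⟨j, fun k => f k ⟨j, Finset.mem_filter.2 ⟨j.2, k.2⟩⟩⟩ with hg
  refine ⟨S.attach.image g, ?_, ?_, ?_⟩
  · intro a ha b hb hab
    simp only [Finset.coe_image, Set.mem_image, Finset.mem_coe, Finset.mem_attach,
      true_and] at ha hb
    obtain ⟨a, rfl⟩ := ha
    obtain ⟨b, rfl⟩ := hb
    have hab' : (a : J) ≠ b := fun h => hab (by rw [Subtype.ext h])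
    refine disjoint_copyEnds hab' fun k he hf h => hab' ?_
    have := (f k).injective h
    simpa using this
  · intro a ha b hb hab
    simp only [Finset.coe_image, Set.mem_image, Finset.mem_coe, Finset.mem_attach,
      true_and] at ha hb
    obtain ⟨a, rfl⟩ := ha
    obtain ⟨b, rfl⟩ := hb
    have : a = b := Subtype.ext hab
    rw [this]
  · ext j
    simp only [Finset.mem_image, Finset.mem_attach, true_and, exists_exists_eq_and]
    constructor
    · rintro ⟨a, rfl⟩; exact a.2
    · intro hj; exact ⟨⟨j, hj⟩, rfl⟩

/-- A charging argument on items that `A` exhausts. Representatives with an exhausted item `k`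
number at most `mult k`, hence at most the bundles of `A` containing `k`. The remaining ones have
their service in `A`, without exhausted items. So `j ∈ A` is charged once per exhausted item, at
most twice, or at most once if it has none. -/
theorem card_copyChoice_le {mult : K → ℕ} {bundle : J → Finset K} (h2 : ∀ j, (bundle j).card ≤ 2)
    {A : Finset J} (hA : ∀ k, (A.filter fun j => k ∈ bundle j).card ≤ mult k)
    {T : Finset (CopyChoice mult bundle)} (hT : MatchIndep (copyEnds mult bundle) T)
    (hinj : Set.InjOn Sigma.fst (T : Set (CopyChoice mult bundle)))
    (h : ∀ e ∈ T, e.1 ∈ A ∨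
      ¬ ∀ k, ((insert e.1 A).filter fun j => k ∈ bundle j).card ≤ mult k) :
    T.card ≤ 2 * A.card := by
  classical
  set sat : K → Prop := fun k => mult k ≤ (A.filter fun j => k ∈ bundle j).card with hsat
  set 𝒦 : Finset K := (T.biUnion fun e => bundle e.1).filter sat with h𝒦
  have hcount : ∀ k, (T.filter fun e => k ∈ bundle e.1).card ≤ mult k := by
    intro k
    have hm : ∀ e ∈ T.filter (fun e => k ∈ bundle e.1), ∃ n, n < mult k ∧
        Sum.inl (k, n) ∈ copyEnds mult bundle e := by
      intro e he
      have hk := (Finset.mem_filter.1 he).2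
      exact ⟨e.2 ⟨k, hk⟩, (e.2 ⟨k, hk⟩).2, inl_mem_copyEnds.2 ⟨hk, rfl⟩⟩
    have := (hT.subset (Finset.filter_subset (fun e => k ∈ bundle e.1) T)).card_le_of_meets
      ((Finset.range (mult k)).image fun n => Sum.inl (k, n)) (fun e he => by
        obtain ⟨n, hn, hmem⟩ := hm e he
        rw [Finset.not_disjoint_iff]
        exact ⟨_, hmem, Finset.mem_image_of_mem _ (Finset.mem_range.2 hn)⟩)
    exact this.trans (Finset.card_image_le.trans (Finset.card_range _).le)
  have hsplit := Finset.card_filter_add_card_filter_not (s := T) (fun e => ∃ k ∈ bundle e.1, sat k)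
  have hsatc : (T.filter fun e => ∃ k ∈ bundle e.1, sat k).card ≤
      ∑ j ∈ A, (𝒦.filter fun k => k ∈ bundle j).card := by
    calc (T.filter fun e => ∃ k ∈ bundle e.1, sat k).card
        ≤ (𝒦.biUnion fun k => T.filter fun e => k ∈ bundle e.1).card := by
          refine Finset.card_le_card fun e he => ?_
          obtain ⟨heT, k, hk, hs⟩ := Finset.mem_filter.1 he
          exact Finset.mem_biUnion.2 ⟨k, Finset.mem_filter.2
            ⟨Finset.mem_biUnion.2 ⟨e, heT, hk⟩, hs⟩, Finset.mem_filter.2 ⟨heT, hk⟩⟩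
      _ ≤ ∑ k ∈ 𝒦, (T.filter fun e => k ∈ bundle e.1).card := Finset.card_biUnion_le
      _ ≤ ∑ k ∈ 𝒦, (A.filter fun j => k ∈ bundle j).card :=
          Finset.sum_le_sum fun k hk => (hcount k).trans (Finset.mem_filter.1 hk).2
      _ = ∑ j ∈ A, (𝒦.filter fun k => k ∈ bundle j).card := by
          simp_rw [Finset.card_filter]
          exact Finset.sum_comm
  have hunsat : (T.filter fun e => ¬ ∃ k ∈ bundle e.1, sat k).card ≤
      ∑ j ∈ A, if ∃ k ∈ bundle j, sat k then 0 else 1 := by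
    have e1 : ∑ j ∈ A, (if ∃ k ∈ bundle j, sat k then 0 else 1) =
        (A.filter fun j => ¬ ∃ k ∈ bundle j, sat k).card := by
      rw [Finset.card_filter]
      exact Finset.sum_congr rfl fun j _ => by split_ifs <;> simp_all
    rw [e1]
    refine Finset.card_le_card_of_injOn Sigma.fst (fun e he => ?_) (hinj.mono (by
      exact_mod_cast Finset.filter_subset _ _))
    rw [Finset.mem_coe, Finset.mem_filter] at he ⊢
    refine ⟨(h e he.1).resolve_right fun hn => hn fun k => ?_, he.2⟩
    rw [Finset.filter_insert]
    split_ifs with hk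
    · have : ¬ sat k := fun hs => he.2 ⟨k, hk, hs⟩
      refine (Finset.card_insert_le _ _).trans ?_
      rw [hsat] at this
      omega
    · exact hA k
  have hterm : ∀ j ∈ A, (𝒦.filter fun k => k ∈ bundle j).card +
      (if ∃ k ∈ bundle j, sat k then 0 else 1) ≤ 2 := by
    intro j _
    have h3 : (𝒦.filter fun k => k ∈ bundle j).card ≤ (bundle j).card :=
      Finset.card_le_card fun k hk => (Finset.mem_filter.1 hk).2
    have h4 := h2 j
    split_ifs with hs
    · omega
    · have : 𝒦.filter (fun k => k ∈ bundle j) = ∅ := by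
        rw [Finset.filter_eq_empty_iff]
        intro k hk hkj
        exact hs ⟨k, hkj, (Finset.mem_filter.1 hk).2⟩
      rw [this]; simp
  have h5 := Finset.sum_le_sum hterm
  rw [Finset.sum_add_distrib, Finset.sum_const, smul_eq_mul] at h5
  omega

/-- Choosing copies turns capacities into a matching problem, needed for `PairSystem`. The
posted-price mechanism sells bundles without naming copies, so its sold sets are compared with
matchings through `card_copyChoice_le`. -/
theorem BMUMD.IsBundleAuction.serviceSystem {I : BMUMD N J} {mult : K → ℕ} {bundle : J → Finset K}
    (h : I.IsBundleAuction 2 mult bundle) :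
    ServiceSystem I (Sigma.fst : CopyChoice mult bundle → J)
      (fun S => ∀ k, (S.filter (fun j => k ∈ bundle j)).card ≤ mult k)
      (MatchIndep (copyEnds mult bundle)) where
  feasible_iff := h.2
  indServ_mono _ _ hS h k := (Finset.card_le_card (Finset.filter_subset_filter _ h)).trans (hS k)
  pairSystem := pairSystem_matchIndep (card_copyEnds h.1)
  card_blocked_le _ _ hS hT := hS.card_blocked_le (card_copyEnds h.1) hT
  exists_lift _ hS := exists_copyChoice hS
  card_cover_le _ _ hA hT := card_copyChoice_le h.1 hA hT

end Instances

/-! ### Sequential posted-price mechanisms -/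

namespace BMUMD.SPM

variable {N J : Type*} [Fintype N] [DecidableEq N] [Fintype J] [DecidableEq J] {I : BMUMD N J}

theorem subset_step (x : ∀ i, I.Plan i) (A : Finset J) (j : J) : A ⊆ step x A j := by
  unfold step; split_ifs
  · exact Finset.subset_insert _ _
  · exact subset_rfl

theorem step_subset (x : ∀ i, I.Plan i) (A : Finset J) (j : J) : step x A j ⊆ insert j A := by
  unfold step; split_ifs
  · exact subset_rfl
  · exact Finset.subset_insert _ _

theorem subset_foldl_step (x : ∀ i, I.Plan i) (l : List J) (A : Finset J) :
    A ⊆ l.foldl (step x) A := by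
  induction l generalizing A with
  | nil => exact subset_rfl
  | cons j l ih => exact (subset_step x A j).trans (ih _)

theorem mem_of_mem_foldl_step {x : ∀ i, I.Plan i} {l : List J} {A : Finset J} {k : J}
    (hk : k ∈ l.foldl (step x) A) : k ∈ A ∨ k ∈ l := by
  induction l generalizing A with
  | nil => exact Or.inl hk
  | cons j l ih =>
    rcases ih hk with h | h
    · rcases Finset.mem_insert.1 (step_subset x A j h) with rfl | h
      · exact Or.inr List.mem_cons_self
      · exact Or.inl h
    · exact Or.inr (List.mem_cons_of_mem _ h)

theorem foldl_step_feasible (x : ∀ i, I.Plan i) (l : List J) {A : Finset J}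
    (hA : A ∈ I.feasible) : l.foldl (step x) A ∈ I.feasible := by
  induction l generalizing A with
  | nil => exact hA
  | cons j l ih =>
    refine ih ?_
    unfold step; split_ifs with h
    · exact h.1
    · exact hA

theorem outcome_feasible (P : I.SPM) (x : ∀ i, I.Plan i) : P.outcome x ∈ I.feasible :=
  foldl_step_feasible x _ I.empty_mem

/-- A constant answer that agrees with the final outcome does not change the run: a service that
ends up sold was accepted when offered, and for an unsold one a refusal has no effect. -/
theorem foldl_step_congr {x x' : ∀ i, I.Plan i} {l : List J} (hl : l.Nodup) {A : Finset J}
    (hA : ∀ j ∈ l, j ∉ A)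
    (h : ∀ j ∈ l, ∀ B, x' (I.owner j) ⟨j, rfl⟩ B = x (I.owner j) ⟨j, rfl⟩ B ∨
      x' (I.owner j) ⟨j, rfl⟩ B = decide (j ∈ l.foldl (step x) A)) :
    l.foldl (step x') A = l.foldl (step x) A := by
  induction l generalizing A with
  | nil => rfl
  | cons j l ih =>
    rw [List.nodup_cons] at hl
    have hjA := hA j List.mem_cons_self
    have hmem : j ∈ l.foldl (step x) (step x A j) ↔ j ∈ step x A j :=
      ⟨fun h => (mem_of_mem_foldl_step h).resolve_right hl.1, fun h => subset_foldl_step x l _ h⟩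
    have hstep : step x' A j = step x A j := by
      rcases h j List.mem_cons_self A with h1 | h1
      · unfold step; rw [h1]
      · rw [List.foldl_cons] at h1
        by_cases hj : j ∈ step x A j
        · have h2 : x' (I.owner j) ⟨j, rfl⟩ A = true := by
            rw [h1]; exact decide_eq_true (hmem.2 hj)
          unfold step at hj ⊢
          split_ifs at hj with h3
          · rw [if_pos h3, if_pos ⟨h3.1, h2⟩]
          · exact absurd hj hjA
        · have h2 : x' (I.owner j) ⟨j, rfl⟩ A = false := by
            rw [h1]; exact decide_eq_false fun h => hj (hmem.1 h)
          unfold step at hj ⊢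
          split_ifs at hj with h3
          · exact absurd (Finset.mem_insert_self j A) hj
          · rw [if_neg h3, if_neg]
            rintro ⟨-, h4⟩
            rw [h2] at h4
            exact Bool.false_ne_true h4
    rw [List.foldl_cons, List.foldl_cons, hstep]
    refine ih hl.2 (fun k hk hkA => ?_) fun k hk B => h k (List.mem_cons_of_mem _ hk) B
    rcases Finset.mem_insert.1 (step_subset x A j hkA) with rfl | h'
    · exact hl.1 hk
    · exact hA k (List.mem_cons_of_mem _ hk) h'

theorem outcome_congr (P : I.SPM) {x x' : ∀ i, I.Plan i}
    (h : ∀ j B, x' (I.owner j) ⟨j, rfl⟩ B = x (I.owner j) ⟨j, rfl⟩ B ∨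
      x' (I.owner j) ⟨j, rfl⟩ B = decide (j ∈ P.outcome x)) : P.outcome x' = P.outcome x :=
  foldl_step_congr P.nodup (by simp) fun j _ B => h j B

theorem eq_of_mem_feasible {S : Finset J} (hS : S ∈ I.feasible) {j k : J} (hj : j ∈ S)
    (hk : k ∈ S) (h : I.owner j = I.owner k) : j = k :=
  Finset.card_le_one.1 (I.unitDemand S hS (I.owner k)) j (Finset.mem_filter.2 ⟨hj, h⟩) k
    (Finset.mem_filter.2 ⟨hk, rfl⟩)

variable (P : I.SPM) {i : N} {v : I.Services i → ℝ≥0}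

theorem utility_of_mem {x : ∀ i, I.Plan i} {j : I.Services i} (hj : (j : J) ∈ P.outcome x) :
    P.utility i v x = (v j : ℝ) - (P.price j : ℝ) := by
  unfold utility
  rw [Finset.sum_eq_single j, if_pos hj]
  · intro k _ hk
    rw [if_neg]
    intro hkO
    exact hk (Subtype.ext (eq_of_mem_feasible (P.outcome_feasible x) hkO hj (k.2.trans j.2.symm)))
  · simp

theorem utility_of_forall_notMem {x : ∀ i, I.Plan i}
    (h : ∀ j : I.Services i, (j : J) ∉ P.outcome x) : P.utility i v x = 0 := by
  unfold utility
  exact Finset.sum_eq_zero fun j _ => if_neg (h j)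

/-- Accept only offers at a price that is at most the value; and accept them for sure if no other
own service has such a price. -/
def easyRule (I : BMUMD N J) (i : N) : Rule I i := fun c j a =>
  c j && (decide (∀ k, c k = true → k = j) || a)

theorem modify_easyRule_eq_true {s : I.Plan i} {j : I.Services i} {A : Finset J} :
    P.modify (easyRule I i) v s j A = true ↔
      P.price j ≤ v j ∧ ((∀ k : I.Services i, P.price k ≤ v k → k = j) ∨ s j A = true) := by
  simp [modify, easyRule]

theorem modify_easyRule_idem (s : I.Plan i) :
    P.modify (easyRule I i) v (P.modify (easyRule I i) v s) = P.modify (easyRule I i) v s := by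
  funext j A
  rw [Bool.eq_iff_iff, modify_easyRule_eq_true, modify_easyRule_eq_true]
  tauto

/-- In the run with plans `x`, an accepted offer was accepted at its time. -/
theorem exists_accept_of_mem_outcome {x : ∀ i, I.Plan i} {j : I.Services i}
    (hj : (j : J) ∈ P.outcome x) : ∃ A, x i j A = true := by
  obtain ⟨j, rfl⟩ := j
  have key : ∀ (l : List J) (A : Finset J), j ∉ A → j ∈ l.foldl (step x) A →
      ∃ A, x (I.owner j) ⟨j, rfl⟩ A = true := by
    intro l
    induction l with
    | nil => intro A h h'; exact absurd h' h
    | cons k l ih =>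
      intro A h h'
      rw [List.foldl_cons] at h'
      by_cases hk : j ∈ step x A k
      · unfold step at hk
        split_ifs at hk with hc
        · rcases Finset.mem_insert.1 hk with rfl | hk
          · exact ⟨A, hc.2⟩
          · exact absurd hk h
        · exact absurd hk h
      · exact ih _ hk h'
  exact key P.order ∅ (by simp) hj

theorem price_le_of_mem_outcome_modify {x : ∀ i, I.Plan i} {s : I.Plan i} {j : I.Services i}
    (hj : (j : J) ∈ P.outcome (Function.update x i (P.modify (easyRule I i) v s))) :
    P.price j ≤ v j := by
  obtain ⟨A, hA⟩ := P.exists_accept_of_mem_outcome hj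
  rw [Function.update_self] at hA
  exact (P.modify_easyRule_eq_true.1 hA).1

theorem utility_modify_nonneg (x : ∀ i, I.Plan i) (s : I.Plan i) :
    0 ≤ P.utility i v (Function.update x i (P.modify (easyRule I i) v s)) := by
  by_cases h : ∃ j : I.Services i,
      (j : J) ∈ P.outcome (Function.update x i (P.modify (easyRule I i) v s))
  · obtain ⟨j, hj⟩ := h
    rw [P.utility_of_mem hj, sub_nonneg]
    exact_mod_cast P.price_le_of_mem_outcome_modify hj
  · push Not at h
    rw [P.utility_of_forall_notMem h]

/-- If `s` buys an affordable `j`, the rule changes nothing in the run: another own service is not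
the only affordable one, so it is accepted only if `s` accepts it. If `s` overpays or buys nothing,
its utility is at most 0, while the modified plan never overpays. -/
theorem utility_le_utility_modify (x : ∀ i, I.Plan i) (s : I.Plan i) :
    P.utility i v (Function.update x i s) ≤
      P.utility i v (Function.update x i (P.modify (easyRule I i) v s)) := by
  by_cases h : ∃ j : I.Services i, (j : J) ∈ P.outcome (Function.update x i s)
  · obtain ⟨j, hj⟩ := h
    by_cases hjC : P.price j ≤ v j
    · suffices h : P.outcome (Function.update x i (P.modify (easyRule I i) v s)) =
          P.outcome (Function.update x i s) by
        unfold utility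
        rw [h]
      refine P.outcome_congr fun k B => ?_
      by_cases hk : I.owner k = i
      · subst hk
        rw [Function.update_self, Function.update_self]
        by_cases hkj : (j : J) = k
        · rw [or_iff_not_imp_right]
          intro hne
          have hkj' : j = ⟨k, rfl⟩ := Subtype.ext hkj
          subst hkj'
          rw [decide_eq_true hj, P.modify_easyRule_eq_true] at hne
          rw [Bool.eq_iff_iff, P.modify_easyRule_eq_true]
          tauto
        · have hkO : k ∉ P.outcome (Function.update x (I.owner k) s) := fun h =>
            hkj (eq_of_mem_feasible (P.outcome_feasible _) hj h j.2)
          rw [decide_eq_false hkO, or_iff_not_imp_right]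
          intro hne
          rw [Bool.not_eq_false, P.modify_easyRule_eq_true] at hne
          rcases hne.2 with h1 | h1
          · exact absurd (congrArg Subtype.val (h1 j hjC)) hkj
          · rw [h1, P.modify_easyRule_eq_true]
            exact ⟨hne.1, Or.inr h1⟩
      · rw [Function.update_of_ne hk, Function.update_of_ne hk]
        exact Or.inl rfl
    · rw [P.utility_of_mem hj]
      refine le_trans ?_ (P.utility_modify_nonneg x s)
      rw [sub_nonpos]
      exact_mod_cast (not_le.1 hjC).le
  · push Not at h
    rw [P.utility_of_forall_notMem h]
    exact P.utility_modify_nonneg x s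

variable (i v) in
/-- The plans that are not dominated by their modification. -/
def unimprovable : Set (I.Plan i) :=
  {s | ¬ P.Dominates i v (P.modify (easyRule I i) v s) s}

theorem utility_eq_of_mem_unimprovable {s : I.Plan i} (hs : s ∈ P.unimprovable i v)
    (x : ∀ i, I.Plan i) : P.utility i v (Function.update x i s) =
      P.utility i v (Function.update x i (P.modify (easyRule I i) v s)) := by
  refine (P.utility_le_utility_modify x s).antisymm ?_
  by_contra! h
  exact hs ⟨fun y => P.utility_le_utility_modify y s, x, h⟩

/-- Both notions reduce to plans that their own modification does not dominate. Undominated plans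
are of this kind, and so are modified plans, since the rule is idempotent. -/
theorem implements_of_forall_unimprovable {α : ℝ≥0∞}
    (h : ∀ s : ∀ i, I.Strategy i, (∀ i v, s i v ∈ P.unimprovable i v) →
      I.optRevenue ≤ α * P.revenue s) :
    P.ImplementsInUndominated α ∧ P.HasEasyImprovements α := by
  refine ⟨fun s hs => h s fun i v => hs i v _, P.unimprovable, easyRule I, fun i v s hs => ?_, h⟩
  refine ⟨?_, by simpa [unimprovable] using hs⟩
  rintro ⟨-, x, hx⟩
  rw [modify_easyRule_idem] at hx
  exact lt_irrefl _ hx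

theorem notMem_outcome_of_unimprovable {x : ∀ i, I.Plan i}
    (hx : x i ∈ P.unimprovable i v)
    {j k : I.Services i} (hC : ∀ l : I.Services i, P.price l ≤ v l → l = j) (hkj : k ≠ j) :
    (k : J) ∉ P.outcome x := by
  intro hk
  have h1 := P.utility_eq_of_mem_unimprovable hx x
  rw [Function.update_eq_self] at h1
  have h2 := P.utility_modify_nonneg (v := v) x (x i)
  rw [← h1, P.utility_of_mem hk, sub_nonneg] at h2
  exact hkj (hC k (by exact_mod_cast h2))

/-- Compare with the modified plan. Up to the offer of `j` the runs agree, as neither plan buys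
another service of the agent. If `j` were still feasible, the modified plan would buy it with
utility nonzero by `htie`, whereas the original plan buys nothing; but the utilities agree for
unimprovable plans. -/
theorem mem_outcome_or_infeasible {x : ∀ i, I.Plan i}
    (hx : x i ∈ P.unimprovable i v) (htie : ∀ k : I.Services i, v k ≠ P.price k)
    {j : I.Services i} (hj : P.price j ≤ v j)
    (hC : ∀ l : I.Services i, P.price l ≤ v l → l = j) {l₁ l₂ : List J}
    (hl : P.order = l₁ ++ (j : J) :: l₂) :
    (j : J) ∈ P.outcome x ∨ insert (j : J) (l₁.foldl (step x) ∅) ∉ I.feasible := by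
  rw [or_iff_not_imp_left]
  intro hjO hfe
  obtain ⟨j, rfl⟩ := j
  set m := P.modify (easyRule I (I.owner j)) v (x (I.owner j)) with hm
  set x' := Function.update x (I.owner j) m with hx'
  have hnod := P.nodup
  rw [hl] at hnod
  have hO : P.outcome x = (l₂.foldl (step x) (step x (l₁.foldl (step x) ∅) j)) := by
    rw [outcome, hl, List.foldl_append, List.foldl_cons]
  have hO' : P.outcome x' = (l₂.foldl (step x') (step x' (l₁.foldl (step x') ∅) j)) := by
    rw [outcome, hl, List.foldl_append, List.foldl_cons]
  have hpre : l₁.foldl (step x') ∅ = l₁.foldl (step x) ∅ := by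
    refine foldl_step_congr (List.Nodup.of_append_left hnod) (by simp) fun k hk B => ?_
    have hkj : k ≠ j := by
      rintro rfl
      exact (List.nodup_append.1 hnod).2.2 k hk k List.mem_cons_self rfl
    by_cases ho : I.owner k = I.owner j
    · right
      have hkO : k ∉ l₁.foldl (step x) ∅ := by
        intro h
        have h1 : k ∈ P.outcome x := by
          rw [hO]; exact subset_foldl_step _ _ _ (subset_step _ _ _ h)
        exact P.notMem_outcome_of_unimprovable hx (k := ⟨k, ho⟩) hC
          (fun h => hkj (congrArg Subtype.val h)) h1
      rw [decide_eq_false hkO, ← Bool.not_eq_true]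
      have hgen : ∀ (i' : N) (hi' : I.owner k = i'), i' = I.owner j →
          x' i' ⟨k, hi'⟩ B ≠ true := by
        rintro i' hi' rfl h
        rw [hx', Function.update_self, hm, P.modify_easyRule_eq_true] at h
        exact hkj (congrArg Subtype.val (hC _ h.1))
      exact hgen _ rfl ho
    · left
      rw [hx', Function.update_of_ne ho]
  have hjO' : j ∈ P.outcome x' := by
    rw [hO', hpre]
    refine subset_foldl_step _ _ _ ?_
    unfold step
    rw [if_pos]
    · exact Finset.mem_insert_self _ _
    · refine ⟨hfe, ?_⟩
      rw [hx', Function.update_self, hm, P.modify_easyRule_eq_true]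
      exact ⟨hj, Or.inl hC⟩
  have h1 := P.utility_eq_of_mem_unimprovable hx x
  rw [Function.update_eq_self, ← hm, ← hx', P.utility_of_mem (j := ⟨j, rfl⟩) hjO',
    P.utility_of_forall_notMem] at h1
  · exact htie ⟨j, rfl⟩ (by exact_mod_cast (sub_eq_zero.1 h1.symm))
  · intro k
    by_cases hkj : k = ⟨j, rfl⟩
    · rw [hkj]; exact hjO
    · exact P.notMem_outcome_of_unimprovable hx hC hkj

/-- Among the services with a price of at least `c`, those sold block every service that is the only
one of its owner with a price of at most the value. -/
theorem mem_or_not_indServ_of_isolated {E : Type*} [DecidableEq E] {svc : E → J}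
    {IndServ : Finset J → Prop} {Ind : Finset E → Prop} (hsys : ServiceSystem I svc IndServ Ind)
    (hord : P.order.Pairwise fun a b => P.price b ≤ P.price a) {x : ∀ i, I.Plan i}
    (hx : x i ∈ P.unimprovable i v) (htie : ∀ k : I.Services i, v k ≠ P.price k)
    {j : I.Services i} (hj : P.price j ≤ v j)
    (hC : ∀ l : I.Services i, P.price l ≤ v l → l = j) {c : ℝ≥0} (hc : c ≤ P.price j) :
    (j : J) ∈ (P.outcome x).filter (fun k => c ≤ P.price k) ∨
      ¬ IndServ (insert (j : J) ((P.outcome x).filter fun k => c ≤ P.price k)) := by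
  obtain ⟨l₁, l₂, hl⟩ := List.append_of_mem (P.mem_order j)
  rcases P.mem_outcome_or_infeasible hx htie hj hC hl with h | h
  · exact Or.inl (Finset.mem_filter.2 ⟨h, hc⟩)
  by_cases hjO : (j : J) ∈ P.outcome x
  · exact Or.inl (Finset.mem_filter.2 ⟨hjO, hc⟩)
  right
  intro hind
  have hpre : l₁.foldl (step x) ∅ ⊆ P.outcome x := by
    rw [outcome, hl, List.foldl_append]
    exact subset_foldl_step _ _ _
  have hown : ∀ k ∈ P.outcome x, I.owner k ≠ i := by
    intro k hk ho
    by_cases hkj : (⟨k, ho⟩ : I.Services i) = j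
    · subst hkj; exact hjO hk
    · exact P.notMem_outcome_of_unimprovable hx hC hkj hk
  -- The decreasing order enters here: everything sold before `j` costs at least `P.price j`, hence
  -- at least `c`, and so belongs to the filtered set.
  refine h ((hsys.feasible_iff _).2 ⟨hsys.indServ_mono _ _ hind
    (Finset.insert_subset_insert _ fun k hk => Finset.mem_filter.2 ⟨hpre hk, hc.trans ?_⟩), ?_⟩)
  · rw [hl, List.pairwise_append] at hord
    have hk1 : k ∈ l₁ := (mem_of_mem_foldl_step hk).resolve_left (by simp)
    exact hord.2.2 k hk1 j List.mem_cons_self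
  · intro i'
    rw [Finset.filter_insert]
    split_ifs with hji
    · rw [j.2] at hji
      subst hji
      have : (l₁.foldl (step x) ∅).filter (fun k => I.owner k = i) = ∅ := by
        rw [Finset.filter_eq_empty_iff]
        exact fun k hk => hown k (hpre hk)
      rw [this]; simp
    · exact I.unitDemand _ (foldl_step_feasible x l₁ I.empty_mem) i'

/-- A posted-price mechanism that offers expensive services first. -/
theorem exists_price_eq (I : BMUMD N J) (p : J → ℝ≥0) :
    ∃ P : I.SPM, P.price = p ∧ P.order.Pairwise fun a b => P.price b ≤ P.price a := by
  classical
  have hperm := List.perm_insertionSort (fun a b => p b ≤ p a) (Finset.univ : Finset J).toList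
  have : Std.Total (fun a b : J => p b ≤ p a) := ⟨fun a b => le_total _ _⟩
  have : IsTrans J (fun a b : J => p b ≤ p a) := ⟨fun a b c h1 h2 => h2.trans h1⟩
  refine ⟨⟨p, (Finset.univ : Finset J).toList.insertionSort (fun a b => p b ≤ p a),
    hperm.nodup_iff.2 (Finset.nodup_toList _), fun j => hperm.mem_iff.2 (by simp)⟩, rfl, ?_⟩
  exact List.pairwise_insertionSort _ _

end BMUMD.SPM

/-! ### Truthful mechanisms -/

namespace BMUMD

variable {N J : Type*} [Fintype N] [DecidableEq N] [Fintype J] [DecidableEq J] {I : BMUMD N J}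

instance (I : BMUMD N J) : IsProbabilityMeasure I.law := by
  unfold law; infer_instance

namespace Mechanism

variable {A : I.Mechanism}

theorem utility_of_mem {b : J → ℝ≥0} {j : J} (hj : j ∈ A.alloc b) (v : J → ℝ≥0) :
    A.utility (I.owner j) v b = v j - A.pay b (I.owner j) := by
  have : (A.alloc b).filter (fun k => I.owner k = I.owner j) = {j} := by
    ext k
    simp only [Finset.mem_filter, Finset.mem_singleton]
    constructor
    · rintro ⟨hk, h⟩
      exact SPM.eq_of_mem_feasible (A.alloc_feasible b) hk hj h
    · rintro rfl; exact ⟨hj, rfl⟩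
  rw [utility, this, Finset.sum_singleton]

theorem utility_update_of_notMem {b : J → ℝ≥0} {j : J} (hj : j ∉ A.alloc b) (v : J → ℝ≥0)
    (z : ℝ≥0) (i : N) : A.utility i (Function.update v j z) b = A.utility i v b := by
  unfold utility
  congr 1
  refine Finset.sum_congr rfl fun k hk => ?_
  rw [Function.update_of_ne]
  rintro rfl
  exact hj (Finset.mem_filter.1 hk).1

theorem Truthful.utility_update_le (hA : A.Truthful) (v : J → ℝ≥0) (j : J) (z : ℝ≥0) :
    A.utility (I.owner j) v (Function.update v j z) ≤ A.utility (I.owner j) v v :=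
  hA _ _ _ fun _ hk => Function.update_of_ne (fun h => hk (congrArg I.owner h)) _ _

theorem Truthful.update_utility_le (hA : A.Truthful) (v : J → ℝ≥0) (j : J) (z : ℝ≥0) :
    A.utility (I.owner j) (Function.update v j z) v ≤
      A.utility (I.owner j) (Function.update v j z) (Function.update v j z) :=
  hA _ _ _ fun _ hk => (Function.update_of_ne (fun h => hk (congrArg I.owner h)) _ _).symm

/-- If `j` were lost by raising its bid to `z`, the utility from the new bid would not depend on the
value of `j`. The two truthfulness inequalities for the values `v j` and `z` then give `z ≤ v j`. -/
theorem Truthful.mem_alloc_update (hA : A.Truthful) {v : J → ℝ≥0} {j : J} (hj : j ∈ A.alloc v)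
    {z : ℝ≥0} (hz : v j ≤ z) : j ∈ A.alloc (Function.update v j z) := by
  rcases hz.eq_or_lt with rfl | hz
  · rwa [Function.update_eq_self]
  by_contra h
  have h1 := hA.utility_update_le v j z
  have h2 := hA.update_utility_le v j z
  rw [utility_of_mem hj] at h1 h2
  rw [utility_update_of_notMem h] at h2
  rw [Function.update_self] at h2
  have : (v j : ℝ) < z := by exact_mod_cast hz
  linarith

theorem Truthful.pay_le_pay_update (hA : A.Truthful) {v : J → ℝ≥0} {j : J} (hj : j ∈ A.alloc v) {z : ℝ≥0}
    (hz : j ∈ A.alloc (Function.update v j z)) :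
    A.pay v (I.owner j) ≤ A.pay (Function.update v j z) (I.owner j) := by
  have h2 := hA.utility_update_le v j z
  rw [utility_of_mem hj, utility_of_mem hz] at h2
  linarith

/-- A lower winning bid for `j` cannot have a lower payment, and by individual rationality its
payment is at most that bid. So the payment is at most every winning bid. -/
theorem Truthful.pay_le (hA : A.Truthful) (hIR : A.IndividuallyRational) {v : J → ℝ≥0} {j : J}
    (hj : j ∈ A.alloc v) {z : ℝ≥0} (hz : j ∈ A.alloc (Function.update v j z)) :
    A.pay v (I.owner j) ≤ z := by
  refine (hA.pay_le_pay_update hj hz).trans ?_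
  have := (hIR (Function.update v j z) (I.owner j)).1 j hz rfl
  rwa [Function.update_self] at this

/-- The valuations for which the price of service `j` lies between `c n` and `c (n + 1)`. -/
def thresholdSet (A : I.Mechanism) (c : ℕ → ℝ≥0) (j : J) (n : ℕ) : Set (J → ℝ≥0) :=
  {v | j ∉ A.alloc (Function.update v j (c n)) ∧ j ∈ A.alloc (Function.update v j (c (n + 1)))}

theorem measurableSet_update (A : I.Mechanism) (j : J) (z : ℝ≥0) :
    MeasurableSet {v | j ∈ A.alloc (Function.update v j z)} :=
  (A.measurable_alloc j).preimage measurable_update_left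

theorem measurableSet_thresholdSet (A : I.Mechanism) (c : ℕ → ℝ≥0) (j : J) (n : ℕ) :
    MeasurableSet (A.thresholdSet c j n) :=
  (A.measurableSet_update j _).compl.inter (A.measurableSet_update j _)

theorem update_mem_thresholdSet (c : ℕ → ℝ≥0) (j : J) (n : ℕ) (v : J → ℝ≥0) (z : ℝ≥0) :
    Function.update v j z ∈ A.thresholdSet c j n ↔ v ∈ A.thresholdSet c j n := by
  simp [thresholdSet]

theorem Truthful.mem_alloc_update_of_le (hA : A.Truthful) {v : J → ℝ≥0} {j : J} {y z : ℝ≥0}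
    (h : j ∈ A.alloc (Function.update v j y)) (hyz : y ≤ z) :
    j ∈ A.alloc (Function.update v j z) := by
  have := hA.mem_alloc_update h (z := z) (by simpa using hyz)
  rwa [Function.update_idem] at this

theorem Truthful.eq_of_mem_thresholdSet (hA : A.Truthful) {c : ℕ → ℝ≥0} (hc : Monotone c) {j : J}
    {m n : ℕ} {v : J → ℝ≥0} (hm : v ∈ A.thresholdSet c j m) (hn : v ∈ A.thresholdSet c j n) :
    m = n := by
  by_contra hne
  rcases lt_or_gt_of_ne hne with h | h
  · exact hn.1 (hA.mem_alloc_update_of_le hm.2 (hc h))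
  · exact hm.1 (hA.mem_alloc_update_of_le hn.2 (hc h))

theorem Truthful.lt_of_mem_thresholdSet (hA : A.Truthful) {c : ℕ → ℝ≥0} {j : J}
    {n : ℕ} {v : J → ℝ≥0} (hn : v ∈ A.thresholdSet c j n) (hj : j ∈ A.alloc v) : c n < v j := by
  by_contra! h
  exact hn.1 (hA.mem_alloc_update hj h)

/-- Every positive payment is bounded by the end of the grid interval of the threshold. -/
theorem Truthful.ofReal_pay_le (hA : A.Truthful) (hIR : A.IndividuallyRational) {c : ℕ → ℝ≥0}
    (hc : Filter.Tendsto c Filter.atTop Filter.atTop) {v : J → ℝ≥0} {j : J}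
    (hj : j ∈ A.alloc v) :
    ENNReal.ofReal (A.pay v (I.owner j)) ≤ (c 0 : ℝ≥0∞) +
      ∑' n, (A.thresholdSet c j n ∩ {v | j ∈ A.alloc v}).indicator
        (fun _ => (c (n + 1) : ℝ≥0∞)) v := by
  classical
  have hex : ∃ n, j ∈ A.alloc (Function.update v j (c n)) := by
    obtain ⟨n, hn⟩ := (hc.eventually_ge_atTop (v j)).exists
    exact ⟨n, hA.mem_alloc_update hj hn⟩
  have key : ∀ n, j ∈ A.alloc (Function.update v j (c n)) →
      ENNReal.ofReal (A.pay v (I.owner j)) ≤ c n := by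
    intro n hn
    rw [← ENNReal.ofReal_coe_nnreal]
    exact ENNReal.ofReal_le_ofReal (hA.pay_le hIR hj hn)
  have hspec := Nat.find_spec hex
  have hmin := fun m => Nat.find_min hex (m := m)
  -- The first winning grid point bounds the payment. If it is `c 0`, no cell contains the
  -- threshold; this case is paid for by the extra summand `c 0`.
  cases hn : Nat.find hex with
  | zero =>
    rw [hn] at hspec
    exact (key 0 hspec).trans le_self_add
  | succ n =>
    rw [hn] at hspec hmin
    refine (key _ hspec).trans (le_trans ?_ le_add_self)
    refine le_trans ?_ (ENNReal.le_tsum n)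
    rw [Set.indicator_of_mem]
    exact ⟨⟨hmin n (Nat.lt_succ_self n), hspec⟩, hj⟩

theorem revenue_le_lintegral (A : I.Mechanism) (hIR : A.IndividuallyRational)
    (h : J → (J → ℝ≥0) → ℝ≥0∞)
    (hh : ∀ v, ∀ j ∈ A.alloc v, ENNReal.ofReal (A.pay v (I.owner j)) ≤ h j v) :
    A.revenue ≤ ∫⁻ v, ∑ j, h j v ∂I.law := by
  refine tsub_le_self.trans (lintegral_mono fun v => ?_)
  have h1 : ENNReal.ofReal (∑ i, A.pay v i) ≤ ∑ i, ENNReal.ofReal (A.pay v i) :=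
    Finset.le_sum_of_subadditive _ ENNReal.ofReal_zero.le (fun _ _ => ENNReal.ofReal_add_le) _ _
  refine h1.trans ?_
  rw [← Finset.sum_fiberwise Finset.univ I.owner]
  refine Finset.sum_le_sum fun i _ => ?_
  by_cases hs : ∃ j ∈ A.alloc v, I.owner j = i
  · obtain ⟨j, hj, rfl⟩ := hs
    refine (hh v j hj).trans ?_
    exact Finset.single_le_sum (f := fun k => h k v) (fun _ _ => zero_le)
      (Finset.mem_filter.2 ⟨Finset.mem_univ j, rfl⟩)
  · push Not at hs
    rw [(hIR v i).2 hs]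
    simp

/-- Membership in the threshold set does not depend on coordinate `j`, so integrating out this
coordinate alone gives the product. -/
theorem law_thresholdSet_inter (A : I.Mechanism) (c : ℕ → ℝ≥0) (j : J) (n : ℕ) {B : Set ℝ≥0}
    (hB : MeasurableSet B) :
    I.law (A.thresholdSet c j n ∩ {v | v j ∈ B}) =
      I.law (A.thresholdSet c j n) * I.dist j B := by
  have hG := A.measurableSet_thresholdSet c j n
  have hjB : MeasurableSet {v : J → ℝ≥0 | v j ∈ B} := hB.preimage (measurable_pi_apply j)
  rw [← lintegral_indicator_one (hG.inter hjB), mul_comm, ← lintegral_indicator_const hG, law]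
  refine lintegral_eq_of_lmarginal_eq {j} (measurable_one.indicator (hG.inter hjB))
    (measurable_const.indicator hG) ?_
  rw [lmarginal_singleton, lmarginal_singleton]
  funext v
  by_cases hv : v ∈ A.thresholdSet c j n
  · have e1 : ∀ z, (A.thresholdSet c j n ∩ {v | v j ∈ B}).indicator (1 : (J → ℝ≥0) → ℝ≥0∞)
        (Function.update v j z) = B.indicator 1 z := by
      intro z
      by_cases hz : z ∈ B
      · rw [Set.indicator_of_mem, Set.indicator_of_mem hz]
        · rfl
        · exact ⟨(update_mem_thresholdSet c j n v z).2 hv, by simpa using hz⟩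
      · rw [Set.indicator_of_notMem, Set.indicator_of_notMem hz]
        exact fun h => hz (by simpa using h.2)
    have e2 : ∀ z, (A.thresholdSet c j n).indicator (fun _ => I.dist j B)
        (Function.update v j z) = I.dist j B := fun z =>
      Set.indicator_of_mem ((update_mem_thresholdSet c j n v z).2 hv) _
    simp_rw [e1, e2]
    rw [lintegral_indicator_one hB]
    simp
  · have e1 : ∀ z, (A.thresholdSet c j n ∩ {v | v j ∈ B}).indicator (1 : (J → ℝ≥0) → ℝ≥0∞)
        (Function.update v j z) = 0 := fun z =>
      Set.indicator_of_notMem (fun h => hv ((update_mem_thresholdSet c j n v z).1 h.1)) _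
    have e2 : ∀ z, (A.thresholdSet c j n).indicator (fun _ => I.dist j B)
        (Function.update v j z) = 0 := fun z =>
      Set.indicator_of_notMem (fun h => hv ((update_mem_thresholdSet c j n v z).1 h)) _
    simp_rw [e1, e2]

end Mechanism

end BMUMD

/-- If every point of `B` lies in at most `C` of the sets, and the other points in none, then the
sum of the probabilities is at most `C` times the probability of `B`. -/
theorem sum_measureReal_le {Ω κ : Type*} [MeasurableSpace Ω] (μ : Measure Ω)
    [IsProbabilityMeasure μ] (s : Finset κ) (S : κ → Set Ω) (hS : ∀ k ∈ s, MeasurableSet (S k))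
    {B : Set Ω} (hB : MeasurableSet B) (hSB : ∀ k ∈ s, S k ⊆ B) (C : ℕ)
    (hC : ∀ x ∈ B, ∀ t ⊆ s, (∀ k ∈ t, x ∈ S k) → t.card ≤ C) :
    ∑ k ∈ s, μ.real (S k) ≤ C * μ.real B := by
  classical
  have h1 : ∑ k ∈ s, μ (S k) ≤ C * μ B := by
    rw [← lintegral_indicator_const hB, Finset.sum_congr rfl fun k hk =>
      (lintegral_indicator_one (μ := μ) (hS k hk)).symm,
      ← lintegral_finsetSum' _ fun k hk => (measurable_one.indicator (hS k hk)).aemeasurable]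
    refine lintegral_mono fun x => ?_
    by_cases hx : x ∈ B
    · rw [Set.indicator_of_mem hx]
      have h2 := hC x hx (s.filter fun k => x ∈ S k) (Finset.filter_subset _ _)
        fun k hk => (Finset.mem_filter.1 hk).2
      have h3 : ∑ k ∈ s, (S k).indicator (1 : Ω → ℝ≥0∞) x = (s.filter fun k => x ∈ S k).card := by
        rw [Finset.card_filter, Nat.cast_sum]
        refine Finset.sum_congr rfl fun k _ => ?_
        by_cases hk : x ∈ S k <;> simp [hk]
      rw [h3]
      exact Nat.cast_le.2 h2
    · rw [Set.indicator_of_notMem hx]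
      refine le_of_eq (Finset.sum_eq_zero fun k hk => ?_)
      exact Set.indicator_of_notMem (fun h => hx (hSB k hk h)) _
  have h4 : ENNReal.toReal (∑ k ∈ s, μ (S k)) ≤ ENNReal.toReal (C * μ B) :=
    ENNReal.toReal_mono (ENNReal.mul_ne_top (ENNReal.natCast_ne_top C) (measure_ne_top μ B)) h1
  rw [ENNReal.toReal_sum fun k _ => measure_ne_top μ _, ENNReal.toReal_mul,
    ENNReal.toReal_natCast] at h4
  exact h4

/-- Arbitrarily small geometric progressions avoid the atoms of countably many measures. -/
theorem exists_pos_forall_measure_singleton_eq_zero {ι : Type*} [Countable ι]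
    (μ : ι → Measure ℝ≥0) [∀ i, IsProbabilityMeasure (μ i)] {ρ : ℝ≥0} (hρ : 0 < ρ) {b : ℝ≥0}
    (hb : 0 < b) : ∃ c, 0 < c ∧ c < b ∧ ∀ i (n : ℕ), μ i {c * ρ ^ n} = 0 := by
  have hat : ∀ i, {x : ℝ≥0 | μ i {x} ≠ 0}.Countable := by
    intro i
    have := Measure.countable_meas_level_set_pos (μ := μ i) (g := (id : ℝ≥0 → ℝ≥0)) measurable_id
    refine this.mono fun x hx => ?_
    simpa [pos_iff_ne_zero] using hx
  have hbad : {r : ℝ | ∃ i, ∃ n : ℕ, μ i {r.toNNReal * ρ ^ n} ≠ 0 ∧ 0 < r}.Countable := by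
    have : {r : ℝ | ∃ i, ∃ n : ℕ, μ i {r.toNNReal * ρ ^ n} ≠ 0 ∧ 0 < r} ⊆
        ⋃ i, ⋃ n : ℕ, (fun x : ℝ≥0 => ((x / ρ ^ n : ℝ≥0) : ℝ)) '' {x : ℝ≥0 | μ i {x} ≠ 0} := by
      rintro r ⟨i, n, h, hr⟩
      rw [Set.mem_iUnion₂]
      refine ⟨i, n, r.toNNReal * ρ ^ n, h, ?_⟩
      simp only
      rw [mul_div_cancel_right₀ _ (pow_pos hρ n).ne', Real.coe_toNNReal _ hr.le]
    exact (Set.countable_iUnion fun i => Set.countable_iUnion fun n => (hat i).image _).mono this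
  obtain ⟨r, hr, hr1, hr2⟩ := (hbad.dense_compl ℝ).exists_mem_open isOpen_Ioo
    (Set.nonempty_Ioo.2 (NNReal.coe_pos.2 hb))
  refine ⟨r.toNNReal, Real.toNNReal_pos.2 hr1, ?_, fun i n => ?_⟩
  · rw [← NNReal.coe_lt_coe, Real.coe_toNNReal _ hr1.le]; exact hr2
  · by_contra h
    exact hr ⟨i, n, h, hr1⟩

/-! ### ### Weights from a nearly optimal mechanism -/

namespace BMUMD

variable {N J : Type*} [Fintype N] [DecidableEq N] [Fintype J] [DecidableEq J]

theorem Mechanism.measurableSet_alloc {I : BMUMD N J} (A : I.Mechanism) (p : Finset J → Prop) :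
    MeasurableSet {v | p (A.alloc v)} := by
  have h1 : ∀ S : Finset J, MeasurableSet {v | A.alloc v = S} := by
    intro S
    have : {v | A.alloc v = S} = ⋂ j, {v | j ∈ A.alloc v ↔ j ∈ S} := by
      ext v; simp [Finset.ext_iff]
    rw [this]
    refine MeasurableSet.iInter fun j => ?_
    by_cases hj : j ∈ S
    · simpa [hj] using A.measurable_alloc j
    · have h2 : {v | j ∈ A.alloc v ↔ j ∈ S} = {v | j ∈ A.alloc v}ᶜ := by ext v; simp [hj]
      rw [h2]
      exact (A.measurable_alloc j).compl
  have : {v | p (A.alloc v)} = ⋃ S ∈ {S : Finset J | p S}, {v | A.alloc v = S} := by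
    ext v; simp
  rw [this]
  exact MeasurableSet.biUnion (Set.to_countable _) fun S _ => h1 S

/-- Weights of the representatives at the prices of a geometric grid that bound the revenue of a
truthful mechanism and satisfy the linear constraints of the service system. -/
structure GridWeights (I : BMUMD N J) {E : Type*} [Fintype E] [DecidableEq E] (svc : E → J)
    (Ind : Finset E → Prop) (ε : ℝ) where
  top : ℕ
  grid : ℕ → ℝ≥0
  weight : E → ℕ → ℝ
  mass : J → ℕ → ℝ
  strictMono_grid : StrictMono grid
  dist_singleton : ∀ j n, I.dist j {grid n} = 0
  tail_le : ∀ j, (I.dist j).real (Set.Ioi (grid top)) ≤ ε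
  weight_nonneg : ∀ e n, 0 ≤ weight e n
  mass_nonneg : ∀ j n, 0 ≤ mass j n
  sum_mass_le : ∀ j, ∑ n ∈ Finset.range top, mass j n ≤ 1
  sum_weight_le : ∀ j n,
    ∑ e : {e // svc e = j}, weight e n ≤ mass j n * (I.dist j).real (Set.Ioi (grid n))
  sum_owner_le : ∀ i,
    ∑ e : {e // I.owner (svc e) = i}, ∑ n ∈ Finset.range top, weight e n ≤ 1
  sum_blocked_le : ∀ (a : ℕ) (T : Finset E), Ind T →
    (∑ e, open Classical in if e ∈ T ∨ ¬ Ind (insert e T) then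
      ∑ n ∈ Finset.Ico a top, weight e n else 0) ≤ 2 * T.card

theorem tendsto_measureReal_Ioi (μ : Measure ℝ≥0) [IsProbabilityMeasure μ] {c : ℕ → ℝ≥0}
    (hc : StrictMono c) (hlim : Filter.Tendsto c Filter.atTop Filter.atTop) :
    Filter.Tendsto (fun n => μ.real (Set.Ioi (c n))) Filter.atTop (nhds 0) := by
  have h1 := tendsto_measure_iInter_atTop (μ := μ) (s := fun n => Set.Ioi (c n))
    (fun n => measurableSet_Ioi.nullMeasurableSet)
    (fun a b h => Set.Ioi_subset_Ioi (hc.monotone h)) ⟨0, measure_ne_top μ _⟩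
  have h2 : ⋂ n, Set.Ioi (c n) = ∅ := by
    rw [Set.eq_empty_iff_forall_notMem]
    intro x hx
    obtain ⟨n, hn⟩ := (hlim.eventually_ge_atTop x).exists
    exact absurd (Set.mem_iInter.1 hx n) (not_lt.2 hn)
  rw [h2, measure_empty] at h1
  have h3 := (ENNReal.tendsto_toReal ENNReal.zero_ne_top).comp h1
  simpa [Function.comp_def, Measure.real] using h3

variable {I : BMUMD N J} {E : Type*} [Fintype E] [DecidableEq E] {svc : E → J}
  {IndServ : Finset J → Prop} {Ind : Finset E → Prop}

/-- The event that the threshold of the service of `e` lies in the `n`-th grid interval and `e`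
represents a sold service. -/
def Mechanism.soldSet (A : I.Mechanism) (c : ℕ → ℝ≥0) (svc : E → J)
    (L : Finset J → Finset E) (e : E) (n : ℕ) : Set (J → ℝ≥0) :=
  A.thresholdSet c (svc e) n ∩ {v | e ∈ L (A.alloc v)}

/-- A payment with threshold in cell `n` is at most `c (n + 1) = ρ * c n`. As `L` represents each
sold service, the event of such a sale is covered by the events `soldSet` of its representatives. -/
theorem Mechanism.revenue_le_tsum (A : I.Mechanism) (hIR : A.IndividuallyRational)
    (hA : A.Truthful) {c : ℕ → ℝ≥0} (hlim : Filter.Tendsto c Filter.atTop Filter.atTop)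
    {ρ : ℝ≥0} (hρ : ∀ n, c (n + 1) = ρ * c n) {L : Finset J → Finset E}
    (hL : ∀ S ∈ I.feasible, (L S).image svc = S) :
    A.revenue ≤ Fintype.card J * c 0 +
      ρ * ∑' n, c n * ∑ e, I.law (A.soldSet c svc L e n) := by
  have hm : ∀ j n, MeasurableSet (A.thresholdSet c j n ∩ {v | j ∈ A.alloc v}) := fun j n =>
    (A.measurableSet_thresholdSet c j n).inter (A.measurable_alloc j)
  have hmi : ∀ j n, Measurable ((A.thresholdSet c j n ∩ {v | j ∈ A.alloc v}).indicator
      (fun _ => (c (n + 1) : ℝ≥0∞))) := fun j n => measurable_const.indicator (hm j n)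
  refine (A.revenue_le_lintegral hIR (fun j v => (c 0 : ℝ≥0∞) +
    ∑' n, (A.thresholdSet c j n ∩ {v | j ∈ A.alloc v}).indicator
      (fun _ => (c (n + 1) : ℝ≥0∞)) v) fun v j hj => hA.ofReal_pay_le hIR hlim hj).trans ?_
  rw [lintegral_finsetSum _ fun j _ => (Measurable.tsum fun n => hmi j n).const_add _]
  have h1 : ∀ j, ∫⁻ v, ((c 0 : ℝ≥0∞) +
      ∑' n, (A.thresholdSet c j n ∩ {v | j ∈ A.alloc v}).indicator
        (fun _ => (c (n + 1) : ℝ≥0∞)) v) ∂I.law =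
      c 0 + ∑' n, (c (n + 1) : ℝ≥0∞) * I.law (A.thresholdSet c j n ∩ {v | j ∈ A.alloc v}) := by
    intro j
    rw [lintegral_add_left measurable_const, lintegral_const, measure_univ, mul_one,
      lintegral_tsum fun n => (hmi j n).aemeasurable]
    congr 1
    exact tsum_congr fun n => lintegral_indicator_const (hm j n) _
  simp_rw [h1]
  rw [Finset.sum_add_distrib, Finset.sum_const, Finset.card_univ, nsmul_eq_mul]
  refine add_le_add_right ?_ _
  rw [← Summable.tsum_finsetSum fun _ _ => ENNReal.summable, ← ENNReal.tsum_mul_left]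
  refine ENNReal.tsum_le_tsum fun n => ?_
  rw [← Finset.mul_sum, hρ, ENNReal.coe_mul, mul_assoc]
  refine mul_le_mul_right (mul_le_mul_right ?_ _) _
  rw [← Finset.sum_fiberwise Finset.univ svc]
  refine Finset.sum_le_sum fun j _ => ?_
  refine le_trans (measure_mono ?_) (measure_biUnion_finset_le _ _)
  intro v hv
  have hj : j ∈ (L (A.alloc v)).image svc := by
    rw [hL _ (A.alloc_feasible v)]; exact hv.2
  obtain ⟨e, he, rfl⟩ := Finset.mem_image.1 hj
  exact Set.mem_biUnion (Finset.mem_filter.2 ⟨Finset.mem_univ e, rfl⟩) ⟨hv.1, he⟩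

/-- All constraints are expectations of pointwise counts: for each valuation the sold
representatives form an independent set, injective on services, with at most one element per agent,
and every service has at most one threshold cell. -/
theorem exists_gridWeights (hsys : ServiceSystem I svc IndServ Ind) (hfin : I.optRevenue ≠ ⊤)
    (hpos : I.optRevenue ≠ 0) {ε : ℝ} (hε : 0 < ε) :
    ∃ G : GridWeights I svc Ind ε, I.optRevenue ≤
      ENNReal.ofReal (1.0003 * ∑ n ∈ Finset.range G.top, G.grid n * ∑ e, G.weight e n) := by
  classical
  set o := I.optRevenue.toReal with ho
  have hoo : I.optRevenue = ENNReal.ofReal o := (ENNReal.ofReal_toReal hfin).symm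
  have ho0 : 0 < o := ENNReal.toReal_pos hpos hfin
  obtain ⟨A, hIR, hA, hrev⟩ : ∃ A : I.Mechanism, A.IndividuallyRational ∧ A.Truthful ∧
      ENNReal.ofReal (0.99999 * o) < A.revenue := by
    have h1 : ENNReal.ofReal (0.99999 * o) < I.optRevenue := by
      rw [hoo]
      exact (ENNReal.ofReal_lt_ofReal_iff ho0).2 (by linarith)
    rw [optRevenue, lt_iSup_iff] at h1
    obtain ⟨A, hA⟩ := h1
    simp only [lt_iSup_iff] at hA
    obtain ⟨h1, h2, h3⟩ := hA
    exact ⟨A, h1, h2, h3⟩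
  -- Error budget: near-optimality, the payments below the first grid point and the truncation leave
  -- `0.99998` of OPT, and the rounding costs a factor `1.00001`; the quotient is below `1.0003`.
  set ρ : ℝ≥0 := 100001 / 100000 with hρ
  have hρ1 : 1 < ρ := by rw [hρ, one_lt_div (by norm_num)]; norm_num
  set b : ℝ≥0 := (0.00001 * o / (Fintype.card J + 1)).toNNReal with hb
  have hb0 : 0 < b := Real.toNNReal_pos.2 (by positivity)
  obtain ⟨c₀, hc₀, hc₀b, hat⟩ := exists_pos_forall_measure_singleton_eq_zero I.dist
    (zero_lt_one.trans hρ1) hb0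
  set c : ℕ → ℝ≥0 := fun n => c₀ * ρ ^ n with hc
  have hcm : StrictMono c := (pow_right_strictMono₀ hρ1).const_mul hc₀
  have hlim : Filter.Tendsto c Filter.atTop Filter.atTop :=
    (tendsto_pow_atTop_atTop_of_one_lt hρ1).const_mul_atTop hc₀
  have hstep : ∀ n, c (n + 1) = ρ * c n := fun n => by simp only [hc, pow_succ]; ring
  choose! L hLi hLinj hLim using fun S (hS : S ∈ I.feasible) =>
    hsys.exists_lift S ((hsys.feasible_iff S).1 hS).1
  set W := A.soldSet c svc L with hW
  have hWm : ∀ e n, MeasurableSet (W e n) := fun e n =>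
    (A.measurableSet_thresholdSet c _ n).inter (A.measurableSet_alloc fun S => e ∈ L S)
  have hsvc : ∀ e v, e ∈ L (A.alloc v) → svc e ∈ A.alloc v := by
    intro e v he
    have := Finset.mem_image_of_mem svc he
    rwa [hLim _ (A.alloc_feasible v)] at this
  have hrevle := A.revenue_le_tsum hIR hA hlim hstep hLim
  have hc0J : (Fintype.card J : ℝ≥0∞) * c 0 ≤ ENNReal.ofReal (0.00001 * o) := by
    have h1 : (Fintype.card J : ℝ) * c₀ ≤ 0.00001 * o := by
      have h2 : (c₀ : ℝ) ≤ 0.00001 * o / (Fintype.card J + 1) := by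
        rw [← Real.coe_toNNReal _ (by positivity : 0 ≤ 0.00001 * o / (Fintype.card J + 1))]
        exact NNReal.coe_le_coe.2 hc₀b.le
      rw [le_div_iff₀ (by positivity)] at h2
      have : (0 : ℝ) ≤ c₀ := c₀.2
      linarith
    have h3 : (Fintype.card J : ℝ≥0∞) * c 0 = ENNReal.ofReal ((Fintype.card J : ℝ) * c₀) := by
      rw [ENNReal.ofReal_mul (Nat.cast_nonneg _), ENNReal.ofReal_natCast,
        ENNReal.ofReal_coe_nnreal]
      simp [hc]
    rw [h3]
    exact ENNReal.ofReal_le_ofReal h1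
  have hlt : ENNReal.ofReal (0.99998 * o) < ρ * ∑' n, c n * ∑ e, I.law (W e n) := by
    have h1 := (hrev.trans_le hrevle).trans_le (add_le_add_left hc0J _)
    rw [show 0.99999 * o = 0.00001 * o + 0.99998 * o by ring,
      ENNReal.ofReal_add (by positivity) (by positivity)] at h1
    exact (ENNReal.add_lt_add_iff_left ENNReal.ofReal_ne_top).1 h1
  have htend : Filter.Tendsto (fun M => (ρ : ℝ≥0∞) *
      ∑ n ∈ Finset.range M, c n * ∑ e, I.law (W e n)) Filter.atTop
      (nhds (ρ * ∑' n, c n * ∑ e, I.law (W e n))) :=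
    ENNReal.Tendsto.const_mul (ENNReal.tendsto_nat_tsum _) (Or.inr ENNReal.coe_ne_top)
  have htail : ∀ᶠ M in Filter.atTop, ∀ j, (I.dist j).real (Set.Ioi (c M)) ≤ ε := by
    rw [Filter.eventually_all]
    exact fun j => (tendsto_measureReal_Ioi (I.dist j) hcm hlim).eventually_le_const hε
  obtain ⟨M, hM, hMtail⟩ := ((htend.eventually_const_lt hlt).and htail).exists
  refine ⟨⟨M, c, fun e n => I.law.real (W e n), fun j n => I.law.real (A.thresholdSet c j n),
    hcm, fun j n => hat j n, hMtail, fun _ _ => measureReal_nonneg, fun _ _ => measureReal_nonneg,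
    ?_, ?_, ?_, ?_⟩, ?_⟩
  · intro j
    have := sum_measureReal_le I.law (Finset.range M) (fun n => A.thresholdSet c j n)
      (fun n _ => A.measurableSet_thresholdSet c j n) MeasurableSet.univ
      (fun _ _ => Set.subset_univ _) 1 (fun v _ t _ ht => Finset.card_le_one.2 fun a ha b hb =>
        hA.eq_of_mem_thresholdSet hcm.monotone (ht a ha) (ht b hb))
    simpa using this
  · intro j n
    have h1 := sum_measureReal_le I.law (Finset.univ : Finset {e // svc e = j})
      (fun e => W e n) (fun e _ => hWm e n)
      ((A.measurableSet_thresholdSet c j n).inter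
        (measurableSet_Ioi.preimage (measurable_pi_apply j) :
          MeasurableSet {v : J → ℝ≥0 | v j ∈ Set.Ioi (c n)}))
      (by
        rintro ⟨e, rfl⟩ - v hv
        exact ⟨hv.1, hA.lt_of_mem_thresholdSet hv.1 (hsvc _ _ hv.2)⟩) 1
      (fun v _ t _ ht => Finset.card_le_one.2 fun a ha b hb => Subtype.ext
        (hLinj _ (A.alloc_feasible v) (ht a ha).2 (ht b hb).2 (a.2.trans b.2.symm)))
    change _ ≤ _ * (I.law (A.thresholdSet c j n ∩ {v | v j ∈ Set.Ioi (c n)})).toReal at h1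
    rw [Nat.cast_one, one_mul, A.law_thresholdSet_inter c j n measurableSet_Ioi,
      ENNReal.toReal_mul] at h1
    exact h1
  · intro i
    have h1 := sum_measureReal_le I.law
      ((Finset.univ : Finset {e // I.owner (svc e) = i}) ×ˢ Finset.range M)
      (fun p => W p.1 p.2) (fun p _ => hWm _ _) MeasurableSet.univ
      (fun _ _ => Set.subset_univ _) 1 (fun v _ t _ ht => Finset.card_le_one.2 fun a ha b hb => by
        have h1 := ht a ha
        have h2 := ht b hb
        have h3 : svc a.1 = svc b.1 := SPM.eq_of_mem_feasible (A.alloc_feasible v)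
          (hsvc _ _ h1.2) (hsvc _ _ h2.2) (a.1.2.trans b.1.2.symm)
        have h4 : (a.1 : E) = b.1 := hLinj _ (A.alloc_feasible v) h1.2 h2.2 h3
        refine Prod.ext (Subtype.ext h4) (hA.eq_of_mem_thresholdSet hcm.monotone h1.1 ?_)
        rw [h3]; exact h2.1)
    rw [Finset.sum_product] at h1
    simpa using h1
  -- For each valuation the blocked sold representatives form an independent set, so there are at
  -- most `2 * T.card`; each counts at a single level.
  · intro a T hT
    rw [← Finset.sum_filter]
    have h1 := sum_measureReal_le I.law
      ((Finset.univ.filter fun e => e ∈ T ∨ ¬ Ind (insert e T)) ×ˢ Finset.Ico a M)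
      (fun p => W p.1 p.2) (fun p _ => hWm _ _) MeasurableSet.univ
      (fun _ _ => Set.subset_univ _) (2 * T.card) (fun v _ t hts ht => by
        have h2 : Set.InjOn Prod.fst (t : Set (E × ℕ)) := by
          intro a ha b hb hab
          refine Prod.ext hab (hA.eq_of_mem_thresholdSet hcm.monotone (ht a ha).1 ?_)
          rw [hab]
          exact (ht b hb).1
        rw [← Finset.card_image_of_injOn h2]
        refine hsys.card_blocked_le _ T (hsys.pairSystem.mono _ _ (hLi _ (A.alloc_feasible v)) ?_)
          hT fun e he => ?_
        · intro e he
          obtain ⟨p, hp, rfl⟩ := Finset.mem_image.1 he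
          exact (ht p hp).2
        · obtain ⟨p, hp, rfl⟩ := Finset.mem_image.1 he
          exact (Finset.mem_filter.1 (Finset.mem_product.1 (hts hp)).1).2)
    rw [Finset.sum_product] at h1
    simpa using h1
  · set y := ∑ n ∈ Finset.range M, (c n : ℝ) * ∑ e, I.law.real (W e n) with hy
    have hyE : ∑ n ∈ Finset.range M, (c n : ℝ≥0∞) * ∑ e, I.law (W e n) = ENNReal.ofReal y := by
      rw [hy, ENNReal.ofReal_sum_of_nonneg fun n _ => mul_nonneg (c n).coe_nonneg
        (Finset.sum_nonneg fun _ _ => measureReal_nonneg)]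
      refine Finset.sum_congr rfl fun n _ => ?_
      rw [ENNReal.ofReal_mul (c n).coe_nonneg, ENNReal.ofReal_coe_nnreal,
        ENNReal.ofReal_sum_of_nonneg fun _ _ => measureReal_nonneg]
      congr 1
      exact Finset.sum_congr rfl fun e _ => (ofReal_measureReal).symm
    rw [hyE, ← ENNReal.ofReal_coe_nnreal, ← ENNReal.ofReal_mul ρ.coe_nonneg] at hM
    have hM' := lt_of_not_ge fun h => absurd hM (not_lt.2 (ENNReal.ofReal_le_ofReal h))
    have hρr : (ρ : ℝ) = 100001 / 100000 := by rw [hρ]; norm_num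
    rw [hρr] at hM'
    rw [hoo]
    refine ENNReal.ofReal_le_ofReal ?_
    have hy0 : 0 ≤ y := Finset.sum_nonneg fun n _ => mul_nonneg (c n).coe_nonneg
        (Finset.sum_nonneg fun _ _ => measureReal_nonneg)
    norm_num at hM' ⊢
    linarith

end BMUMD

/-! ### Price lotteries -/

section Lottery

/-- For `q > 0` take `(1 - exp (-q)) / q`, the mean of `exp (-t)` on `[0, q]`. Scaling all price
probabilities of a service by `α` makes its acceptance probability `1 - exp (-q)`, so that
rejections multiply to an exponential of the total weight. -/
theorem exists_mul_eq_one_sub_exp_neg (q : ℝ) (hq : 0 ≤ q) :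
    ∃ α : ℝ, 0 ≤ α ∧ α ≤ 1 ∧ α * q = 1 - Real.exp (-q) ∧ Real.exp (-q) ≤ α := by
  rcases hq.eq_or_lt with rfl | hq
  · exact ⟨1, by norm_num⟩
  have h1 : 1 - Real.exp (-q) ≤ q := by linarith [Real.add_one_le_exp (-q)]
  have h0 : 0 ≤ 1 - Real.exp (-q) := by
    rw [sub_nonneg, Real.exp_le_one_iff]; linarith
  refine ⟨(1 - Real.exp (-q)) / q, div_nonneg h0 hq.le, (div_le_one hq).2 h1,
    div_mul_cancel₀ _ hq.ne', ?_⟩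
  rw [le_div_iff₀ hq]
  have h2 : Real.exp (-q) * Real.exp q = 1 := by rw [← Real.exp_add]; simp
  nlinarith [Real.add_one_le_exp q, Real.exp_pos (-q)]

theorem exp_neg_one_bounds : 0.367879 < Real.exp (-1) ∧ (1 : ℝ) / 3 < Real.exp (-1) := by
  have h := Real.exp_one_lt_d9
  have h2 : Real.exp (-1) * Real.exp 1 = 1 := by rw [← Real.exp_add]; simp
  have h3 := Real.exp_pos (-1)
  constructor <;> nlinarith

variable {N J E : Type*} [Fintype J] [DecidableEq J] [DecidableEq N] [Fintype E]

/-- The level of an outcome of a lottery; the outcome `none` stands for the top level. -/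
def lotteryLevel {M : ℕ} : Option (Fin M × Option E) → ℕ
  | none => M
  | some (n, _) => n

/-- Up to `ε`, the product is at least `exp` of minus the total weight of the agent, hence at least
`exp (-1)`. As `q k ≤ 1` and `exp (-1) > 1 / 3`, each error `ε` costs at most a factor `1 - 3 * ε`;
finally `0.367879 * (1 - 0.00003) > 0.3678`. -/
theorem le_mul_prod_one_sub (own : J → N) {q d α : J → ℝ} {ε : ℝ} (hε : 0 ≤ ε)
    (hεJ : Fintype.card J * ε ≤ 0.00001) (hq : ∀ j, 0 ≤ q j)
    (hQ : ∀ i, ∑ j ∈ Finset.univ.filter (fun j => own j = i), q j ≤ 1)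
    (hd : ∀ j, d j ≤ 1 - Real.exp (-q j) + ε) (hα : ∀ j, Real.exp (-q j) ≤ α j) (j : J) :
    0.3678 ≤ α j *
      ∏ k ∈ Finset.univ.filter (fun k => own k = own j ∧ k ≠ j), (1 - d k) := by
  set S := Finset.univ.filter (fun k => own k = own j ∧ k ≠ j) with hS
  have hins : insert j S = Finset.univ.filter (fun k => own k = own j) := by
    ext k; by_cases h : k = j <;> simp [hS, h]
  have hjS : j ∉ S := by simp [hS]
  have hq1 : ∀ k, q k ≤ 1 := fun k => (Finset.single_le_sum (f := q)
    (s := Finset.univ.filter fun l => own l = own k) (fun k _ => hq k) (by simp)).trans (hQ (own k))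
  have hcard : 1 ≤ Fintype.card J := Fintype.card_pos_iff.2 ⟨j⟩
  have hε1 : ε ≤ 0.00001 := by
    have : (1 : ℝ) ≤ Fintype.card J := by exact_mod_cast hcard
    nlinarith
  obtain ⟨he, he3⟩ := exp_neg_one_bounds
  have h1 : ∀ k ∈ S, Real.exp (-q k) * (1 - 3 * ε) ≤ 1 - d k := by
    intro k _
    have h2 : Real.exp (-1) ≤ Real.exp (-q k) := Real.exp_le_exp.2 (by linarith [hq1 k])
    have := hd k
    nlinarith
  have h2 : ∏ k ∈ S, (Real.exp (-q k) * (1 - 3 * ε)) ≤ ∏ k ∈ S, (1 - d k) :=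
    Finset.prod_le_prod (fun k _ => mul_nonneg (Real.exp_pos _).le (by linarith)) h1
  rw [Finset.prod_mul_distrib, ← Real.exp_sum, Finset.prod_const] at h2
  have h3 : (1 - 3 * (Fintype.card J * ε)) ≤ (1 - 3 * ε) ^ S.card := by
    have h4 := one_add_mul_le_pow (a := -(3 * ε)) (by linarith) S.card
    have h5 : (S.card : ℝ) ≤ Fintype.card J := by exact_mod_cast Finset.card_le_univ S
    have : (1 + -(3 * ε)) = 1 - 3 * ε := by ring
    rw [this] at h4
    nlinarith
  have h4 : Real.exp (-1) ≤ Real.exp (-q j) * Real.exp (∑ k ∈ S, -q k) := by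
    rw [← Real.exp_add, Real.exp_le_exp, Finset.sum_neg_distrib]
    have := hQ (own j)
    rw [← hins, Finset.sum_insert hjS] at this
    linarith
  have h5 : 0 ≤ Real.exp (∑ k ∈ S, -q k) := (Real.exp_pos _).le
  calc (0.3678 : ℝ) ≤ Real.exp (-1) * (1 - 3 * (Fintype.card J * ε)) := by nlinarith
    _ ≤ (Real.exp (-q j) * Real.exp (∑ k ∈ S, -q k)) * (1 - 3 * ε) ^ S.card :=
        mul_le_mul h4 h3 (by linarith) (mul_nonneg (Real.exp_pos _).le h5)
    _ = Real.exp (-q j) * (Real.exp (∑ k ∈ S, -q k) * (1 - 3 * ε) ^ S.card) := by ring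
    _ ≤ α j * ∏ k ∈ S, (1 - d k) :=
        mul_le_mul (hα j) h2 (mul_nonneg h5 (pow_nonneg (by linarith) _))
          ((Real.exp_pos _).le.trans (hα j))

/-- There are independent lotteries over prices and representatives such that `e` is the only
representative that its owner likes, at level `n`, with probability `0.3678 * w e n`. -/
theorem exists_lottery (own : J → N) (svc : E → J) (M : ℕ) {w : E → ℕ → ℝ} {m x : J → ℕ → ℝ}
    {ε : ℝ} (hε : 0 ≤ ε) (hεJ : Fintype.card J * ε ≤ 0.00001)
    (hw : ∀ e n, 0 ≤ w e n) (hm : ∀ j n, 0 ≤ m j n) (hx : ∀ j n, 0 ≤ x j n)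
    (hxM : ∀ j, x j M ≤ ε)
    (hmass : ∀ j, ∑ n ∈ Finset.range M, m j n ≤ 1)
    (hwm : ∀ j n, ∑ e : {e // svc e = j}, w e n ≤ m j n * x j n)
    (hown : ∀ i, ∑ e : {e // own (svc e) = i}, ∑ n ∈ Finset.range M, w e n ≤ 1) :
    ∃ A : J → Option (Fin M × Option E) → ℝ, (∀ j κ, 0 ≤ A j κ) ∧ (∀ j, ∑ κ, A j κ = 1) ∧
      ∀ e (n : Fin M), A (svc e) (some (n, some e)) * x (svc e) n *
        ∏ k ∈ Finset.univ.filter (fun k => own k = own (svc e) ∧ k ≠ svc e),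
          (1 - ∑ κ, A k κ * x k (lotteryLevel κ)) = 0.3678 * w e n := by
  classical
  set W : J → ℕ → ℝ := fun j n => ∑ e ∈ Finset.univ.filter (fun e => svc e = j), w e n with hW
  have hWm : ∀ j n, W j n ≤ m j n * x j n := by
    intro j n
    refine le_trans (le_of_eq ?_) (hwm j n)
    exact Finset.sum_subtype _ (by simp) _
  have hW0 : ∀ j n, 0 ≤ W j n := fun j n => Finset.sum_nonneg fun e _ => hw e n
  -- Offering level `n` with probability `r j n` makes `j` be accepted there with probability
  -- exactly `W j n`; since `r j n ≤ m j n`, these probabilities sum to at most 1.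
  set r : J → ℕ → ℝ := fun j n => W j n / x j n with hr
  have hr0 : ∀ j n, 0 ≤ r j n := fun j n => div_nonneg (hW0 j n) (hx j n)
  have hrx : ∀ j n, r j n * x j n = W j n := by
    intro j n
    by_cases h : x j n = 0
    · have := hWm j n
      rw [h, mul_zero] at this
      rw [h, mul_zero]
      exact (hW0 j n).antisymm this
    · exact div_mul_cancel₀ _ h
  have hrm : ∀ j n, r j n ≤ m j n := by
    intro j n
    rcases (hx j n).eq_or_lt with h | h
    · simp only [hr, ← h, div_zero]; exact hm j n
    · exact (div_le_iff₀ h).2 (hWm j n)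
  set q : J → ℝ := fun j => ∑ n : Fin M, W j n with hq
  have hq0 : ∀ j, 0 ≤ q j := fun j => Finset.sum_nonneg fun n _ => hW0 j n
  have hQ : ∀ i, ∑ j ∈ Finset.univ.filter (fun j => own j = i), q j ≤ 1 := by
    intro i
    refine le_trans (le_of_eq ?_) (hown i)
    rw [← Finset.sum_subtype (Finset.univ.filter fun e => own (svc e) = i) (by simp)
      (fun e => ∑ n ∈ Finset.range M, w e n), ← Finset.sum_fiberwise_of_maps_to (g := svc)
      (t := Finset.univ.filter (fun j => own j = i)) (by simp)]
    refine Finset.sum_congr rfl fun j hj => ?_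
    rw [hq]
    simp only [hW]
    rw [Finset.sum_comm, Finset.filter_filter]
    have : Finset.univ.filter (fun e => own (svc e) = i ∧ svc e = j) =
        Finset.univ.filter (fun e => svc e = j) := by
      ext e
      simp only [Finset.mem_filter, Finset.mem_univ, true_and] at hj ⊢
      constructor
      · exact fun h => h.2
      · rintro rfl; exact ⟨hj, rfl⟩
    rw [this]
    exact Finset.sum_congr rfl fun e _ => (Finset.sum_range _).symm
  choose α hα0 hα1 hαq hαe using fun j => exists_mul_eq_one_sub_exp_neg (q j) (hq0 j)
  set rest : J → ℝ := fun j => 1 - ∑ n : Fin M, α j * r j n with hrest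
  have hrest0 : ∀ j, 0 ≤ rest j := by
    intro j
    rw [hrest, sub_nonneg]
    refine le_trans (Finset.sum_le_sum fun n _ => ?_) ((Finset.sum_range (m j)).symm.trans_le (hmass j))
    exact (mul_le_of_le_one_left (hr0 j n) (hα1 j)).trans (hrm j n)
  have hrest1 : ∀ j, rest j ≤ 1 := fun j =>
    sub_le_self _ (Finset.sum_nonneg fun n _ => mul_nonneg (hα0 j) (hr0 j n))
  set d : J → ℝ := fun j => 1 - Real.exp (-q j) + rest j * x j M with hd
  have hdε : ∀ j, d j ≤ 1 - Real.exp (-q j) + ε := fun j => by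
    have := mul_le_of_le_one_left (hx j M) (hrest1 j)
    have := hxM j
    simp only [hd]
    linarith
  set Q : J → ℝ := fun j =>
    ∏ k ∈ Finset.univ.filter (fun k => own k = own j ∧ k ≠ j), (1 - d k) with hQdef
  have hkey : ∀ j, 0.3678 ≤ α j * Q j := le_mul_prod_one_sub own hε hεJ hq0 hQ hdε hαe
  have hQpos : ∀ j, 0 < Q j := fun j => by
    by_contra! h
    have := mul_nonpos_of_nonneg_of_nonpos (hα0 j) h
    have := hkey j
    norm_num at this
    linarith
  -- A level is tagged with a representative just often enough to make the isolation probability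
  -- exact; `hkey` ensures that the tags fit into `α j * r j n`.
  set B : J → Fin M → E → ℝ := fun j n e =>
    if svc e = j then 0.3678 * w e n / (x j n * Q j) else 0 with hB
  have hB0 : ∀ j n e, 0 ≤ B j n e := fun j n e => by
    simp only [hB]
    split_ifs
    · exact div_nonneg (mul_nonneg (by norm_num) (hw _ _)) (mul_nonneg (hx _ _) (hQpos _).le)
    · exact le_rfl
  have hBsum : ∀ j n, ∑ e, B j n e = 0.3678 / Q j * r j n := by
    intro j n
    simp only [hB, hr, hW]
    rw [← Finset.sum_filter, Finset.sum_div, Finset.mul_sum]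
    refine Finset.sum_congr rfl fun e _ => ?_
    rw [div_mul_div_comm, mul_comm (Q j)]
  have hBle : ∀ j n, ∑ e, B j n e ≤ α j * r j n := by
    intro j n
    rw [hBsum]
    exact mul_le_mul_of_nonneg_right ((div_le_iff₀ (hQpos j)).2 (hkey j)) (hr0 j n)
  -- The remaining mass goes to the top level, which is accepted with probability at most `ε`.
  -- Surplus mass at a lower level stays untagged.
  set A : J → Option (Fin M × Option E) → ℝ := fun j κ => match κ with
    | none => rest j
    | some (n, some e) => B j n e
    | some (n, none) => α j * r j n - ∑ e, B j n e with hA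
  have hsumA : ∀ j (g : ℕ → ℝ), ∑ κ, A j κ * g (lotteryLevel κ) =
      rest j * g M + ∑ n : Fin M, α j * r j n * g n := by
    intro j g
    rw [Fintype.sum_option, Fintype.sum_prod_type]
    simp only [hA, lotteryLevel]
    congr 1
    refine Finset.sum_congr rfl fun n _ => ?_
    rw [Fintype.sum_option, ← Finset.sum_mul, ← add_mul, sub_add_cancel]
  refine ⟨A, ?_, ?_, ?_⟩
  · rintro j (_ | ⟨n, _ | e⟩)
    · exact hrest0 j
    · exact sub_nonneg.2 (hBle j n)
    · exact hB0 j n e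
  · intro j
    have := hsumA j fun _ => 1
    simp only [mul_one] at this
    rw [this, hrest]
    ring
  · intro e n
    have hdA : ∀ k, ∑ κ, A k κ * x k (lotteryLevel κ) = d k := by
      intro k
      rw [hsumA]
      simp only [mul_assoc, hrx]
      rw [← Finset.mul_sum, hαq, hd]
      ring
    simp_rw [hdA]
    change B (svc e) n e * x (svc e) n * Q (svc e) = _
    simp only [hB, if_true]
    by_cases h : x (svc e) n = 0
    · have h1 := hWm (svc e) n
      rw [h, mul_zero] at h1
      have h2 : w e n ≤ W (svc e) n :=
        Finset.single_le_sum (f := fun e => w e n) (fun e _ => hw e n) (by simp)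
      have h3 : w e n = 0 := le_antisymm (h2.trans h1) (hw e n)
      rw [h, h3]; simp
    · have := (hQpos (svc e)).ne'
      field_simp

end Lottery

/-! ### ### Functions of disjoint blocks of independent variables -/

section Blocks

variable {N J : Type*} [Fintype N] [DecidableEq N] [Fintype J] [DecidableEq J] {own : J → N}

/-- Families indexed by `J` as families of families on the fibres of a map. -/
def piFiberEquiv (own : J → N) (Ω : Type*) :
    (J → Ω) ≃ (∀ i, {j // own j = i} → Ω) where
  toFun y _ j := y j
  invFun z j := z (own j) ⟨j, rfl⟩
  left_inv _ := rfl
  right_inv z := by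
    funext i ⟨j, h⟩
    subst h
    rfl

/-- The joint law of functions of disjoint blocks of independent variables. -/
theorem prodExp_blocks {Ω : Type*} [Fintype Ω] {β : N → Type*} [∀ i, Fintype (β i)]
    [∀ i, DecidableEq (β i)] (μ : J → Ω → ℝ)
    (τ : ∀ i, ({j // own j = i} → Ω) → β i) (g : (∀ i, β i) → ℝ) :
    prodExp μ (fun y => g fun i => τ i fun j => y j) =
      prodExp (fun i b => ∑ z, if τ i z = b then ∏ j : {j // own j = i}, μ j (z j) else 0) g := by
  classical
  rw [prodExp, prodExp, ← Equiv.sum_comp (piFiberEquiv own Ω).symm]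
  have h1 : ∀ t : ∀ i, β i, (∏ i, ∑ z : {j // own j = i} → Ω,
      if τ i z = t i then ∏ j : {j // own j = i}, μ j (z j) else 0) * g t =
      ∑ Z : ∀ i, {j // own j = i} → Ω, if (fun i => τ i (Z i)) = t then
        (∏ i, ∏ j : {j // own j = i}, μ j (Z i j)) * g t else 0 := by
    intro t
    rw [Fintype.prod_sum, Finset.sum_mul]
    refine Finset.sum_congr rfl fun Z _ => ?_
    by_cases h : (fun i => τ i (Z i)) = t
    · rw [if_pos h]
      congr 1
      exact Finset.prod_congr rfl fun i _ => if_pos (congrFun h i)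
    · rw [if_neg h]
      obtain ⟨i, hi⟩ := Function.ne_iff.1 h
      rw [Finset.prod_eq_zero (Finset.mem_univ i) (if_neg hi), zero_mul]
  simp_rw [h1]
  rw [Finset.sum_comm]
  refine Finset.sum_congr rfl fun Z _ => ?_
  rw [Finset.sum_ite_eq, if_pos (Finset.mem_univ _)]
  have h2 : ∀ i (j : {j // own j = i}), (piFiberEquiv own Ω).symm Z j = Z i j := by
    rintro i ⟨j, rfl⟩
    rfl
  congr 1
  · rw [← Fintype.prod_fiberwise own]
    exact Finset.prod_congr rfl fun i _ => Finset.prod_congr rfl fun j _ => by rw [h2]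
  · congr 1
    funext i
    congr 1
    funext j
    exact h2 i j

end Blocks

/-! ### ### The law of the isolated representatives -/

section LotteryChoice

variable {N J E : Type*} [Fintype N] [DecidableEq N] [Fintype J] [DecidableEq J]
  [Fintype E] [DecidableEq E] {own : J → N} {svc : E → J} {M : ℕ}

/-- The weight of the outcome of a lottery together with the answer to the offer. -/
def lotteryWeight (A : J → Option (Fin M × Option E) → ℝ) (x : J → ℕ → ℝ) (j : J)
    (ω : Option (Fin M × Option E) × Bool) : ℝ :=
  A j ω.1 * if ω.2 then x j (lotteryLevel ω.1) else 1 - x j (lotteryLevel ω.1)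

/-- The representative `e` is drawn at level at least `a`, its offer is accepted, and no other offer
to its owner is. -/
def IsolatedAt (own : J → N) (svc : E → J) (a : ℕ) {i : N}
    (z : {j // own j = i} → Option (Fin M × Option E) × Bool)
    (e : {e // own (svc e) = i}) : Prop :=
  (∃ n : Fin M, a ≤ n ∧ z ⟨svc e, e.2⟩ = (some (n, some (e : E)), true)) ∧
    ∀ j : {j // own j = i}, (j : J) ≠ svc e → (z j).2 = false

open Classical in
/-- The isolated representative of agent `i`, if there is one. -/
noncomputable def isolatedChoice (own : J → N) (svc : E → J) (a : ℕ) (i : N)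
    (z : {j // own j = i} → Option (Fin M × Option E) × Bool) :
    Option {e // own (svc e) = i} :=
  if h : ∃ e, IsolatedAt own svc a z e then some h.choose else none

theorem isolatedChoice_eq_some {a : ℕ} {i : N}
    {z : {j // own j = i} → Option (Fin M × Option E) × Bool} {e : {e // own (svc e) = i}} :
    isolatedChoice own svc a i z = some e ↔ IsolatedAt own svc a z e := by
  classical
  unfold isolatedChoice
  constructor
  · intro h
    split_ifs at h with hex
    rw [Option.some.injEq] at h
    exact h ▸ hex.choose_spec
  · intro h
    have hex : ∃ e, IsolatedAt own svc a z e := ⟨e, h⟩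
    rw [dif_pos hex]
    congr 1
    have hc := hex.choose_spec
    set f := hex.choose
    obtain ⟨⟨n, -, hn⟩, h2⟩ := h
    obtain ⟨⟨m, -, hm⟩, -⟩ := hc
    by_cases hs : svc f = svc e
    · have h3 : (⟨svc f, f.2⟩ : {j // own j = i}) = ⟨svc e, e.2⟩ := Subtype.ext hs
      rw [h3, hn] at hm
      simp only [Prod.mk.injEq, Option.some.injEq, and_true] at hm
      exact Subtype.ext hm.2.symm
    · have := h2 ⟨svc f, f.2⟩ hs
      rw [hm] at this
      exact absurd this (by simp)

open Classical in
-- Isolation of `e` is one condition for each service of the agent: tag, level and acceptance at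
-- `svc e`, rejection elsewhere. Hence its probability factorizes.
theorem sum_isolatedAt (A : J → Option (Fin M × Option E) → ℝ) (x : J → ℕ → ℝ)
    (hA : ∀ j, ∑ κ, A j κ = 1) (a : ℕ) {i : N} (e : {e // own (svc e) = i}) :
    (∑ z : {j // own j = i} → Option (Fin M × Option E) × Bool,
      if IsolatedAt own svc a z e then ∏ j : {j // own j = i}, lotteryWeight A x j (z j) else 0) =
    (∑ n : Fin M, if a ≤ n then A (svc e) (some (n, some (e : E))) * x (svc e) n else 0) *
      ∏ k ∈ Finset.univ.filter (fun k => own k = own (svc e) ∧ k ≠ svc e),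
        (1 - ∑ κ, A k κ * x k (lotteryLevel κ)) := by
  set S : {j // own j = i} → Option (Fin M × Option E) × Bool → Prop := fun j ω =>
    if (j : J) = svc e then ∃ n : Fin M, a ≤ n ∧ ω = (some (n, some (e : E)), true)
    else ω.2 = false with hS
  have h1 : ∀ z : {j // own j = i} → Option (Fin M × Option E) × Bool,
      (if IsolatedAt own svc a z e then ∏ j : {j // own j = i}, lotteryWeight A x j (z j) else 0) =
      ∏ j : {j // own j = i}, if S j (z j) then lotteryWeight A x j (z j) else 0 := by
    intro z
    by_cases h : IsolatedAt own svc a z e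
    · rw [if_pos h]
      refine Finset.prod_congr rfl fun j _ => (if_pos ?_).symm
      simp only [hS]
      split_ifs with hj
      · have : j = ⟨svc e, e.2⟩ := Subtype.ext hj
        rw [this]; exact h.1
      · exact h.2 j hj
    · rw [if_neg h]
      have : ∃ j, ¬ S j (z j) := by
        by_contra! hall
        refine h ⟨?_, fun j hj => ?_⟩
        · have := hall ⟨svc e, e.2⟩
          simpa only [hS, if_true] using this
        · have := hall j
          simpa only [hS, if_neg hj] using this
      obtain ⟨j, hj⟩ := this
      exact (Finset.prod_eq_zero (Finset.mem_univ j) (if_neg hj)).symm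
  simp_rw [h1]
  rw [← Fintype.prod_sum (fun (j : {j // own j = i}) ω =>
    if S j ω then lotteryWeight A x j ω else 0),
    ← Finset.mul_prod_erase Finset.univ _ (Finset.mem_univ ⟨svc e, e.2⟩)]
  congr 1
  · rw [Fintype.sum_prod_type, Fintype.sum_option, Fintype.sum_prod_type]
    simp only [hS, if_true, Fintype.sum_bool, Prod.mk.injEq, reduceCtorEq, false_and, and_false,
      exists_false, if_false, add_zero, Finset.sum_const_zero, zero_add, and_true,
      Option.some.injEq]
    refine Finset.sum_congr rfl fun n _ => ?_
    rw [Finset.sum_eq_single (some (e : E))]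
    · by_cases ha : a ≤ n
      · rw [if_pos ⟨n, ha, rfl, rfl⟩, if_pos ha]
        simp [lotteryWeight, lotteryLevel]
      · rw [if_neg, if_neg ha]
        rintro ⟨n', h1, rfl, -⟩
        exact ha h1
    · intro o _ ho
      rw [if_neg]
      rintro ⟨n', h1, -, h2⟩
      exact ho h2
    · simp
  · have h2 : ∀ j ∈ Finset.univ.erase (⟨svc e, e.2⟩ : {j // own j = i}),
        (∑ ω, if S j ω then lotteryWeight A x j ω else 0) =
          1 - ∑ κ, A j κ * x j (lotteryLevel κ) := by
      intro j hj
      have hj' : (j : J) ≠ svc e := fun h => Finset.ne_of_mem_erase hj (Subtype.ext h)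
      rw [Fintype.sum_prod_type]
      simp only [hS, if_neg hj', Fintype.sum_bool, reduceCtorEq, if_false, if_true, zero_add,
        lotteryWeight, Bool.false_eq_true]
      refine (Finset.sum_congr rfl fun κ _ => ?_).trans
        ((Finset.sum_sub_distrib (A j) fun κ => A j κ * x j (lotteryLevel κ)).trans (by rw [hA]))
      ring
    rw [Finset.prod_congr rfl h2]
    refine Finset.prod_bij (fun j _ => (j : J)) ?_ ?_ ?_ ?_
    · intro j hj
      rw [Finset.mem_filter]
      exact ⟨Finset.mem_univ _, j.2.trans e.2.symm,
        fun h => Finset.ne_of_mem_erase hj (Subtype.ext h)⟩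
    · intro j _ k _ h
      exact Subtype.ext h
    · intro k hk
      rw [Finset.mem_filter] at hk
      exact ⟨⟨k, hk.2.1.trans e.2⟩, Finset.mem_erase.2
        ⟨fun h => hk.2.2 (congrArg Subtype.val h), Finset.mem_univ _⟩, rfl⟩
    · intro j _
      rfl

theorem sum_lotteryWeight (A : J → Option (Fin M × Option E) → ℝ) (x : J → ℕ → ℝ)
    (hA : ∀ j, ∑ κ, A j κ = 1) (j : J) : ∑ ω, lotteryWeight A x j ω = 1 := by
  rw [Fintype.sum_prod_type, ← hA j]
  refine Finset.sum_congr rfl fun κ _ => ?_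
  rw [Fintype.sum_bool]
  simp only [lotteryWeight, if_true, Bool.false_eq_true, if_false]
  ring

/-- The expected rank of the isolated representatives of level at least `a`. -/
theorem prodExp_isolatedChoice_ge {Ind : Finset E → Prop} (hI : PairSystem Ind)
    {A : J → Option (Fin M × Option E) → ℝ} {x : J → ℕ → ℝ}
    (hA : ∀ j, ∑ κ, A j κ = 1) {w : E → ℕ → ℝ} (hw : ∀ e n, 0 ≤ w e n)
    (hAw : ∀ e (n : Fin M), A (svc e) (some (n, some e)) * x (svc e) n *
        ∏ k ∈ Finset.univ.filter (fun k => own k = own (svc e) ∧ k ≠ svc e),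
          (1 - ∑ κ, A k κ * x k (lotteryLevel κ)) = 0.3678 * w e n)
    (hown : ∀ i, ∑ e : {e // own (svc e) = i}, ∑ n ∈ Finset.range M, w e n ≤ 1) (a : ℕ)
    (hP : ∀ T, Ind T → (∑ e, open Classical in if e ∈ T ∨ ¬ Ind (insert e T) then
      ∑ n ∈ Finset.Ico a M, w e n else 0) ≤ 2 * T.card) :
    0.25008 * ∑ e, ∑ n ∈ Finset.Ico a M, w e n ≤
      prodExp (lotteryWeight A x) fun y =>
        choiceRank (own := fun e => own (svc e)) Ind fun i =>
          isolatedChoice own svc a i fun j => y j := by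
  classical
  set v : E → ℝ := fun e => ∑ n ∈ Finset.Ico a M, w e n with hv
  have hv0 : ∀ e, 0 ≤ v e := fun e => Finset.sum_nonneg fun n _ => hw e n
  rw [prodExp_blocks (lotteryWeight A x) (isolatedChoice own svc a)
    (choiceRank (own := fun e => own (svc e)) Ind)]
  have hsome : ∀ i (e : {e // own (svc e) = i}),
      (∑ z : {j // own j = i} → Option (Fin M × Option E) × Bool,
        if isolatedChoice own svc a i z = some e then
          ∏ j : {j // own j = i}, lotteryWeight A x j (z j) else 0) = 0.3678 * v e := by
    intro i e
    simp_rw [isolatedChoice_eq_some]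
    rw [sum_isolatedAt A x hA, Finset.sum_mul, hv, Finset.mul_sum]
    have h1 : ∀ n : Fin M, (if a ≤ n then A (svc e) (some (n, some (e : E))) * x (svc e) n else 0) *
        ∏ k ∈ Finset.univ.filter (fun k => own k = own (svc e) ∧ k ≠ svc e),
          (1 - ∑ κ, A k κ * x k (lotteryLevel κ)) =
        (fun n : ℕ => if a ≤ n then 0.3678 * w e n else 0) n := by
      intro n
      simp only
      split_ifs
      · exact hAw e n
      · simp
    rw [Finset.sum_congr rfl fun n _ => h1 n,
      ← Finset.sum_range fun n => if a ≤ n then 0.3678 * w e n else 0, ← Finset.sum_filter]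
    refine Finset.sum_congr ?_ fun _ _ => rfl
    ext n
    simp only [Finset.mem_filter, Finset.mem_range, Finset.mem_Ico]
    tauto
  -- Agents depend on disjoint blocks of services, so their isolated elements are independent. The
  -- law is `choiceWeight` at `0.3678`; its value at `none` follows from total mass 1.
  have hlaw : (fun i b => ∑ z : {j // own j = i} → Option (Fin M × Option E) × Bool,
      if isolatedChoice own svc a i z = b then
        ∏ j : {j // own j = i}, lotteryWeight A x j (z j) else 0) =
      choiceWeight (fun e => own (svc e)) v 0.3678 := by
    funext i b
    cases b with
    | some e => exact hsome i e
    | none =>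
      have htot : ∑ b, (∑ z : {j // own j = i} → Option (Fin M × Option E) × Bool,
          if isolatedChoice own svc a i z = b then
            ∏ j : {j // own j = i}, lotteryWeight A x j (z j) else 0) = 1 := by
        rw [Finset.sum_comm]
        simp only [Finset.sum_ite_eq, Finset.mem_univ, if_true]
        rw [← Fintype.prod_sum fun (j : {j // own j = i}) ω => lotteryWeight A x j ω]
        exact Finset.prod_eq_one fun j _ => sum_lotteryWeight A x hA j
      rw [Fintype.sum_option, Finset.sum_congr rfl fun e _ => hsome i e, ← Finset.mul_sum] at htot
      simp only [choiceWeight]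
      linarith
  rw [hlaw]
  refine le_trans (mul_le_mul_of_nonneg_right quarter_lt_rankCurve
    (Finset.sum_nonneg fun e _ => hv0 e)) ?_
  refine prodExp_choiceRank_ge hI hv0 (fun i => le_trans (Finset.sum_le_sum fun e _ => ?_)
    (hown i)) hP (by norm_num) (by norm_num)
  exact Finset.sum_le_sum_of_subset_of_nonneg (fun n hn => by
    rw [Finset.mem_Ico] at hn; exact Finset.mem_range.2 hn.2) fun n _ _ => hw _ _

end LotteryChoice

/-! ### ### Fixing the lottery, and summation over price levels -/

section Derandomization

variable {J E : Type*} [Fintype J] [DecidableEq J] [Fintype E] [DecidableEq E] {M : ℕ}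

/-- Some outcomes of the lotteries are at least as good as the average. -/
theorem exists_le_sum_of_le_prodExp {A : J → Option (Fin M × Option E) → ℝ} {x : J → ℕ → ℝ}
    (hA0 : ∀ j κ, 0 ≤ A j κ) (hA : ∀ j, ∑ κ, A j κ = 1) {B : ℝ}
    {R : (J → Option (Fin M × Option E) × Bool) → ℝ} (h : B ≤ prodExp (lotteryWeight A x) R) :
    ∃ κ : J → Option (Fin M × Option E), B ≤ ∑ b : J → Bool,
      (∏ j, if b j then x j (lotteryLevel (κ j)) else 1 - x j (lotteryLevel (κ j))) *
        R fun j => (κ j, b j) := by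
  set p : (J → Option (Fin M × Option E)) → ℝ := fun κ => ∏ j, A j (κ j) with hp
  have hp0 : ∀ κ, 0 ≤ p κ := fun κ => Finset.prod_nonneg fun j _ => hA0 j _
  have hp1 : ∑ κ, p κ = 1 := by
    rw [hp, ← Fintype.prod_sum]
    exact Finset.prod_eq_one fun j _ => hA j
  have hsplit : prodExp (lotteryWeight A x) R = ∑ κ, p κ * ∑ b : J → Bool,
      (∏ j, if b j then x j (lotteryLevel (κ j)) else 1 - x j (lotteryLevel (κ j))) *
        R fun j => (κ j, b j) := by
    rw [prodExp, ← Equiv.sum_comp (Equiv.arrowProdEquivProdArrow J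
      (fun _ => Option (Fin M × Option E)) (fun _ => Bool)).symm, Fintype.sum_prod_type]
    refine Finset.sum_congr rfl fun κ _ => ?_
    rw [Finset.mul_sum]
    refine Finset.sum_congr rfl fun b _ => ?_
    rw [← mul_assoc, hp, ← Finset.prod_mul_distrib]
    rfl
  rw [hsplit] at h
  by_contra! hcon
  obtain ⟨κ, -, hκ⟩ : ∃ κ ∈ Finset.univ, 0 < p κ := Finset.exists_lt_of_sum_lt (by simp [hp1])
  have := Finset.sum_lt_sum (s := Finset.univ)
    (fun κ _ => mul_le_mul_of_nonneg_left (hcon κ).le (hp0 κ))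
    ⟨κ, Finset.mem_univ _, mul_lt_mul_of_pos_left (hcon κ) hκ⟩
  rw [← Finset.sum_mul, hp1, one_mul] at this
  linarith

/-- The differences of consecutive grid points. -/
def gridStep (c : ℕ → ℝ≥0) : ℕ → ℝ
  | 0 => c 0
  | n + 1 => c (n + 1) - c n

theorem gridStep_nonneg {c : ℕ → ℝ≥0} (hc : Monotone c) (n : ℕ) : 0 ≤ gridStep c n := by
  cases n with
  | zero => exact (c 0).coe_nonneg
  | succ n => exact sub_nonneg.2 (NNReal.coe_le_coe.2 (hc n.le_succ))

theorem sum_gridStep (c : ℕ → ℝ≥0) (n : ℕ) :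
    ∑ a ∈ Finset.range (n + 1), gridStep c a = c n := by
  induction n with
  | zero => simp [gridStep]
  | succ n ih => rw [Finset.sum_range_succ, ih, gridStep]; ring

theorem sum_gridStep_mul (c : ℕ → ℝ≥0) (w : E → ℕ → ℝ) :
    ∑ a ∈ Finset.range M, gridStep c a * ∑ e, ∑ n ∈ Finset.Ico a M, w e n =
      ∑ n ∈ Finset.range M, (c n : ℝ) * ∑ e, w e n := by
  have h1 : ∀ a e, ∑ n ∈ Finset.Ico a M, w e n =
      ∑ n ∈ Finset.range M, if a ≤ n then w e n else 0 := by
    intro a e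
    rw [← Finset.sum_filter]
    refine Finset.sum_congr ?_ fun _ _ => rfl
    ext n
    simp only [Finset.mem_filter, Finset.mem_range, Finset.mem_Ico]
    tauto
  have h2 : ∀ a, gridStep c a * ∑ e, ∑ n ∈ Finset.Ico a M, w e n =
      ∑ n ∈ Finset.range M, (if a ≤ n then gridStep c a else 0) * ∑ e, w e n := by
    intro a
    simp_rw [h1]
    rw [Finset.sum_comm, Finset.mul_sum]
    refine Finset.sum_congr rfl fun n _ => ?_
    split_ifs <;> simp
  simp_rw [h2]
  rw [Finset.sum_comm]
  refine Finset.sum_congr rfl fun n hn => ?_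
  rw [← Finset.sum_mul, ← sum_gridStep, ← Finset.sum_filter]
  congr 1
  refine Finset.sum_congr ?_ fun _ _ => rfl
  ext a
  rw [Finset.mem_range] at hn
  simp only [Finset.mem_filter, Finset.mem_range]
  omega

/-- Each price is the sum of the grid steps up to its level. Only `≤` holds, because services at the
top level `M` lose their last step. -/
theorem sum_gridStep_mul_card_le {c : ℕ → ℝ≥0} (hc : StrictMono c) (O : Finset J) (l : J → ℕ) :
    ∑ a ∈ Finset.range M, gridStep c a * ((O.filter fun j => c a ≤ c (l j)).card : ℝ) ≤
      ∑ j ∈ O, (c (l j) : ℝ) := by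
  have h1 : ∀ a, gridStep c a * ((O.filter fun j => c a ≤ c (l j)).card : ℝ) =
      ∑ j ∈ O, if a ≤ l j then gridStep c a else 0 := by
    intro a
    simp_rw [hc.le_iff_le]
    rw [← Finset.sum_filter, Finset.sum_const, nsmul_eq_mul, mul_comm]
  simp_rw [h1]
  rw [Finset.sum_comm]
  refine Finset.sum_le_sum fun j _ => ?_
  rw [← Finset.sum_filter, ← sum_gridStep]
  refine Finset.sum_le_sum_of_subset_of_nonneg (fun a ha => ?_) fun a _ _ =>
    gridStep_nonneg hc.monotone a
  rw [Finset.mem_filter] at ha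
  exact Finset.mem_range.2 (Nat.lt_succ_of_le ha.2)

end Derandomization

/-! ### ### Revenue of the posted-price mechanism -/

namespace BMUMD

variable {N J : Type*} [Fintype N] [DecidableEq N] [Fintype J] [DecidableEq J] {I : BMUMD N J}

theorem ae_ne (I : BMUMD N J) {p : J → ℝ≥0} (hp : ∀ j, I.dist j {p j} = 0) :
    ∀ᵐ v ∂I.law, ∀ j, v j ≠ p j := by
  rw [ae_all_iff]
  intro j
  rw [ae_iff]
  have h := (measurePreserving_eval I.dist j).measure_preimage
    (measurableSet_singleton (p j)).nullMeasurableSet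
  rw [hp] at h
  refine Eq.trans ?_ h
  congr 1
  ext v
  simp

theorem law_real_answers (I : BMUMD N J) (p : J → ℝ≥0) (b : J → Bool) :
    I.law.real {v | ∀ j, decide (p j < v j) = b j} =
      ∏ j, if b j then (I.dist j).real (Set.Ioi (p j)) else
        1 - (I.dist j).real (Set.Ioi (p j)) := by
  have h : {v : J → ℝ≥0 | ∀ j, decide (p j < v j) = b j} =
      Set.univ.pi fun j => if b j then Set.Ioi (p j) else (Set.Ioi (p j))ᶜ := by
    ext v
    simp only [Set.mem_ofPred_eq, Set.mem_univ_pi]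
    refine forall_congr' fun j => ?_
    cases b j <;> simp
  rw [h, Measure.real, law, Measure.pi_pi, ENNReal.toReal_prod]
  refine Finset.prod_congr rfl fun j _ => ?_
  split_ifs
  · rfl
  · exact probReal_compl_eq_one_sub measurableSet_Ioi

theorem measurableSet_answers (p : J → ℝ≥0) (b : J → Bool) :
    MeasurableSet {v : J → ℝ≥0 | ∀ j, decide (p j < v j) = b j} := by
  have : {v : J → ℝ≥0 | ∀ j, decide (p j < v j) = b j} =
      ⋂ j, {v : J → ℝ≥0 | decide (p j < v j) = b j} := by ext v; simp
  rw [this]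
  refine MeasurableSet.iInter fun j => ?_
  have h1 : MeasurableSet {v : J → ℝ≥0 | p j < v j} :=
    (measurableSet_Ioi (a := p j)).preimage (measurable_pi_apply j)
  cases b j
  · have h2 : {v : J → ℝ≥0 | decide (p j < v j) = false} = {v : J → ℝ≥0 | p j < v j}ᶜ := by
      ext v; simp
    rw [h2]; exact h1.compl
  · simpa using h1

/-- A lower bound in terms of the answers bounds the revenue from below. -/
theorem SPM.ofReal_sum_le_revenue (P : I.SPM) (s : ∀ i, I.Strategy i) {R : (J → Bool) → ℝ}
    (hR : ∀ b, 0 ≤ R b)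
    (h : ∀ᵐ v ∂I.law, R (fun j => decide (P.price j < v j)) ≤
      ∑ j ∈ P.outcome (fun i => s i fun k => v k), (P.price j : ℝ)) :
    ENNReal.ofReal (∑ b : J → Bool, (∏ j, if b j then (I.dist j).real (Set.Ioi (P.price j)) else
        1 - (I.dist j).real (Set.Ioi (P.price j))) * R b) ≤ P.revenue s := by
  set S : (J → Bool) → Set (J → ℝ≥0) := fun b => {v | ∀ j, decide (P.price j < v j) = b j} with hS
  have h1 : ENNReal.ofReal (∑ b : J → Bool, (∏ j, if b j then
      (I.dist j).real (Set.Ioi (P.price j)) else 1 - (I.dist j).real (Set.Ioi (P.price j))) * R b) =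
      ∫⁻ v, ∑ b, (S b).indicator (fun _ => ENNReal.ofReal (R b)) v ∂I.law := by
    rw [lintegral_finsetSum _ fun b _ => measurable_const.indicator (measurableSet_answers _ b)]
    simp_rw [← I.law_real_answers]
    rw [ENNReal.ofReal_sum_of_nonneg fun b _ => mul_nonneg measureReal_nonneg (hR b)]
    refine Finset.sum_congr rfl fun b _ => ?_
    rw [lintegral_indicator_const (measurableSet_answers _ b), mul_comm,
      ENNReal.ofReal_mul (hR b), ofReal_measureReal]
  rw [h1, revenue]
  refine lintegral_mono_ae ?_
  filter_upwards [h] with v hv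
  rw [Finset.sum_eq_single fun j => decide (P.price j < v j)]
  · rw [Set.indicator_of_mem (by simp [hS])]
    refine (ENNReal.ofReal_le_ofReal hv).trans (le_of_eq ?_)
    rw [ENNReal.ofReal_sum_of_nonneg fun j _ => (P.price j).coe_nonneg]
    exact Finset.sum_congr rfl fun j _ => ENNReal.ofReal_coe_nnreal
  · intro b _ hb
    refine Set.indicator_of_notMem (fun hmem => hb ?_) _
    funext j
    exact (hmem j).symm
  · simp

variable {E : Type*} [Fintype E] [DecidableEq E] {svc : E → J} {IndServ : Finset J → Prop}
  {Ind : Finset E → Prop}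

/-- The services sold at a price of at least `c a` are at least half as many as the isolated
representatives of level at least `a` that are independent. -/
theorem SPM.choiceRank_isolatedChoice_le (P : I.SPM) (hsys : ServiceSystem I svc IndServ Ind)
    (hord : P.order.Pairwise fun a b => P.price b ≤ P.price a) {M : ℕ} {c : ℕ → ℝ≥0}
    (hc : StrictMono c) {κ : J → Option (Fin M × Option E)}
    (hprice : ∀ j, P.price j = c (lotteryLevel (κ j))) {v : J → ℝ≥0}
    (hv : ∀ j, v j ≠ P.price j) {x : ∀ i, I.Plan i}
    (hx : ∀ i, x i ∈ P.unimprovable i fun k => v k) (a : ℕ) :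
    choiceRank (own := fun e => I.owner (svc e)) Ind (fun i =>
      isolatedChoice I.owner svc a i fun j => (κ j, decide (P.price j < v j))) ≤
    2 * (((P.outcome x).filter fun j => c a ≤ P.price j).card : ℝ) := by
  set t : ∀ i, Option {e // I.owner (svc e) = i} := fun i =>
    isolatedChoice I.owner svc a i fun j => (κ j, decide (P.price j < v j)) with ht
  obtain ⟨T, hT, hTi, hTc⟩ := exists_card_eq_indepRank hsys.pairSystem.empty (choiceSupport t)
  rw [choiceRank, ← hTc]
  have hO : IndServ ((P.outcome x).filter fun j => c a ≤ P.price j) :=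
    hsys.indServ_mono _ _ ((hsys.feasible_iff _).1 (P.outcome_feasible x)).1
      (Finset.filter_subset _ _)
  have hinj : Set.InjOn svc (T : Set E) := fun e he f hf h =>
    own_injOn_choiceSupport t (hT he) (hT hf) (congrArg I.owner h)
  have := hsys.card_cover_le _ T hO hTi hinj fun e he => ?_
  · exact_mod_cast this
  have hmem := mem_choiceSupport.1 (hT he)
  rw [ht] at hmem
  simp only at hmem
  rw [isolatedChoice_eq_some] at hmem
  obtain ⟨⟨n, han, hn⟩, hothers⟩ := hmem
  simp only [Prod.mk.injEq, decide_eq_true_eq] at hn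
  have hlt : P.price (svc e) < v (svc e) := hn.2
  -- Isolation is defined by strict comparisons of values with prices, affordability by weak ones;
  -- `hv` excludes the difference.
  refine P.mem_or_not_indServ_of_isolated hsys hord (hx (I.owner (svc e))) (fun k => hv k)
    (j := ⟨svc e, rfl⟩) hlt.le (fun l hl => ?_) ?_
  · by_contra hne
    have h1 := hothers l fun h => hne (Subtype.ext h)
    simp only [decide_eq_false_iff_not, not_lt] at h1
    exact hv l (h1.antisymm hl)
  · rw [hprice, hn.1]
    exact hc.monotone han

/-- The rank of the isolated representatives, summed over the levels. -/
noncomputable def levelRank (own : J → N) (svc : E → J) (Ind : Finset E → Prop) (c : ℕ → ℝ≥0)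
    {M : ℕ} (y : J → Option (Fin M × Option E) × Bool) : ℝ :=
  ∑ a ∈ Finset.range M, gridStep c a *
    choiceRank (own := fun e => own (svc e)) Ind fun i => isolatedChoice own svc a i fun j => y j

theorem levelRank_nonneg (own : J → N) {c : ℕ → ℝ≥0} (hc : Monotone c) {M : ℕ}
    (y : J → Option (Fin M × Option E) × Bool) : 0 ≤ levelRank own svc Ind c y :=
  Finset.sum_nonneg fun a _ => mul_nonneg (gridStep_nonneg hc a) (Nat.cast_nonneg _)

theorem prodExp_levelRank_ge {own : J → N} (hI : PairSystem Ind) {M : ℕ}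
    {A : J → Option (Fin M × Option E) → ℝ} {x : J → ℕ → ℝ}
    (hA : ∀ j, ∑ κ, A j κ = 1) {w : E → ℕ → ℝ} (hw : ∀ e n, 0 ≤ w e n)
    (hAw : ∀ e (n : Fin M), A (svc e) (some (n, some e)) * x (svc e) n *
        ∏ k ∈ Finset.univ.filter (fun k => own k = own (svc e) ∧ k ≠ svc e),
          (1 - ∑ κ, A k κ * x k (lotteryLevel κ)) = 0.3678 * w e n)
    (hown : ∀ i, ∑ e : {e // own (svc e) = i}, ∑ n ∈ Finset.range M, w e n ≤ 1)
    (hP : ∀ (a : ℕ) T, Ind T → (∑ e, open Classical in if e ∈ T ∨ ¬ Ind (insert e T) then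
      ∑ n ∈ Finset.Ico a M, w e n else 0) ≤ 2 * T.card) {c : ℕ → ℝ≥0} (hc : Monotone c) :
    0.25008 * ∑ n ∈ Finset.range M, (c n : ℝ) * ∑ e, w e n ≤
      prodExp (lotteryWeight A x) (levelRank own svc Ind c) := by
  have h1 : prodExp (lotteryWeight A x) (levelRank own svc Ind c) =
      ∑ a ∈ Finset.range M, gridStep c a * prodExp (lotteryWeight A x) fun y =>
        choiceRank (own := fun e => own (svc e)) Ind fun i =>
          isolatedChoice own svc a i fun j => y j := by
    simp_rw [← prodExp_const_mul]
    rw [← prodExp_sum]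
    rfl
  rw [h1, ← sum_gridStep_mul, Finset.mul_sum]
  refine Finset.sum_le_sum fun a _ => ?_
  rw [mul_left_comm]
  exact mul_le_mul_of_nonneg_left (prodExp_isolatedChoice_ge hI hA hw hAw hown a (hP a))
    (gridStep_nonneg hc a)

/-- One outcome of the lotteries is at least as good as their average. Its levels become the posted
prices, while its tags serve only the analysis. -/
theorem GridWeights.exists_levels {ε : ℝ} (G : GridWeights I svc Ind ε) (hI : PairSystem Ind)
    (hε : 0 ≤ ε) (hεJ : Fintype.card J * ε ≤ 0.00001) :
    ∃ κ : J → Option (Fin G.top × Option E),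
      0.25008 * ∑ n ∈ Finset.range G.top, (G.grid n : ℝ) * ∑ e, G.weight e n ≤
        ∑ b : J → Bool, (∏ j, if b j then
          (I.dist j).real (Set.Ioi (G.grid (lotteryLevel (κ j)))) else
          1 - (I.dist j).real (Set.Ioi (G.grid (lotteryLevel (κ j))))) *
          levelRank I.owner svc Ind G.grid fun j => (κ j, b j) := by
  obtain ⟨x, hx⟩ : ∃ x : J → ℕ → ℝ, x = fun j n => (I.dist j).real (Set.Ioi (G.grid n)) :=
    ⟨_, rfl⟩
  have hx' : ∀ j n, (I.dist j).real (Set.Ioi (G.grid n)) = x j n := fun j n => by rw [hx]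
  obtain ⟨A, hA0, hA1, hAw⟩ := exists_lottery I.owner svc G.top (x := x) hε hεJ
    G.weight_nonneg G.mass_nonneg (fun j n => hx' j n ▸ measureReal_nonneg)
    (fun j => hx' j _ ▸ G.tail_le j) G.sum_mass_le (fun j n => hx' j n ▸ G.sum_weight_le j n)
    G.sum_owner_le
  simp_rw [hx']
  exact exists_le_sum_of_le_prodExp hA0 hA1 (prodExp_levelRank_ge hI hA1 G.weight_nonneg hAw
    G.sum_owner_le G.sum_blocked_le G.strictMono_grid.monotone)

/-- Level by level, the sold services are at least half the rank of the isolated representatives;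
weighting with the grid steps turns the counts into at most the revenue. -/
theorem SPM.half_levelRank_le (P : I.SPM) (hsys : ServiceSystem I svc IndServ Ind)
    (hord : P.order.Pairwise fun a b => P.price b ≤ P.price a) {M : ℕ} {c : ℕ → ℝ≥0}
    (hc : StrictMono c) {κ : J → Option (Fin M × Option E)}
    (hprice : ∀ j, P.price j = c (lotteryLevel (κ j))) {v : J → ℝ≥0}
    (hv : ∀ j, v j ≠ P.price j) {x : ∀ i, I.Plan i}
    (hx : ∀ i, x i ∈ P.unimprovable i fun k => v k) :
    1 / 2 * levelRank I.owner svc Ind c (fun j => (κ j, decide (P.price j < v j))) ≤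
      ∑ j ∈ P.outcome x, (P.price j : ℝ) := by
  have h1 := sum_gridStep_mul_card_le (M := M) hc (P.outcome x) fun j => lotteryLevel (κ j)
  simp_rw [← hprice] at h1
  refine le_trans ?_ h1
  rw [levelRank, Finset.mul_sum]
  refine Finset.sum_le_sum fun a _ => ?_
  have h2 := P.choiceRank_isolatedChoice_le hsys hord hc hprice hv hx a
  rw [mul_left_comm]
  refine mul_le_mul_of_nonneg_left ?_ (gridStep_nonneg hc.monotone a)
  linarith

/-- Some sequential posted-price mechanism guarantees an eighth of the optimal revenue. -/
theorem _root_.ServiceSystem.exists_spm (hsys : ServiceSystem I svc IndServ Ind)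
    (hfin : I.optRevenue ≠ ⊤) : ∃ P : I.SPM, ∀ s : ∀ i, I.Strategy i,
      (∀ i v, s i v ∈ P.unimprovable i v) → I.optRevenue ≤ 8 * P.revenue s := by
  -- The approximations above have errors relative to OPT, so they need OPT to be positive.
  by_cases hpos : I.optRevenue = 0
  · obtain ⟨P, -⟩ := SPM.exists_price_eq I 0
    exact ⟨P, fun s _ => by rw [hpos]; exact zero_le⟩
  obtain ⟨ε, hε⟩ : ∃ ε : ℝ, ε = 0.00001 / (Fintype.card J + 1) := ⟨_, rfl⟩
  have hε0 : 0 < ε := by rw [hε]; positivity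
  have hεJ : Fintype.card J * ε ≤ 0.00001 := by
    rw [hε, mul_div_assoc', div_le_iff₀ (by positivity)]
    nlinarith [(Nat.cast_nonneg (Fintype.card J) : (0 : ℝ) ≤ Fintype.card J)]
  obtain ⟨G, hG⟩ := exists_gridWeights hsys hfin hpos hε0
  obtain ⟨κ, hκ⟩ := G.exists_levels hsys.pairSystem hε0.le hεJ
  set Y := ∑ n ∈ Finset.range G.top, (G.grid n : ℝ) * ∑ e, G.weight e n with hY
  have hY0 : 0 ≤ Y := Finset.sum_nonneg fun n _ => mul_nonneg (G.grid n).coe_nonneg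
    (Finset.sum_nonneg fun e _ => G.weight_nonneg e n)
  obtain ⟨P, hP, hord⟩ := SPM.exists_price_eq I fun j => G.grid (lotteryLevel (κ j))
  have hprice : ∀ j, P.price j = G.grid (lotteryLevel (κ j)) := fun j => by rw [hP]
  refine ⟨P, fun s hs => ?_⟩
  have hrev := P.ofReal_sum_le_revenue s
    (R := fun b => 1 / 2 * levelRank I.owner svc Ind G.grid fun j => (κ j, b j))
    (fun b => mul_nonneg (by norm_num) (levelRank_nonneg _ G.strictMono_grid.monotone _)) (by
      filter_upwards [I.ae_ne (p := P.price) fun j => by rw [hprice]; exact G.dist_singleton _ _]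
        with v hv
      exact P.half_levelRank_le hsys hord G.strictMono_grid hprice hv fun i => hs i fun k => v k)
  have hsum : 0.12504 * Y ≤ ∑ b : J → Bool, (∏ j, if b j then
      (I.dist j).real (Set.Ioi (P.price j)) else 1 - (I.dist j).real (Set.Ioi (P.price j))) *
        (1 / 2 * levelRank I.owner svc Ind G.grid fun j => (κ j, b j)) := by
    simp_rw [hprice, mul_left_comm _ (1 / 2 : ℝ)]
    rw [← Finset.mul_sum]
    linarith
  -- `8 * 0.12504 = 1.00032` exceeds the discretization factor `1.0003`.
  calc I.optRevenue ≤ ENNReal.ofReal (1.0003 * Y) := hG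
    _ ≤ ENNReal.ofReal (8 * (0.12504 * Y)) := ENNReal.ofReal_le_ofReal (by linarith)
    _ = 8 * ENNReal.ofReal (0.12504 * Y) := by
        rw [ENNReal.ofReal_mul (by norm_num), ENNReal.ofReal_ofNat]
    _ ≤ 8 * P.revenue s :=
        mul_le_mul_right ((ENNReal.ofReal_le_ofReal hsum).trans hrev) _

theorem _root_.ServiceSystem.exists_implements (hsys : ServiceSystem I svc IndServ Ind)
    (hfin : I.optRevenue ≠ ⊤) :
    ∃ P : I.SPM, P.ImplementsInUndominated 8 ∧ P.HasEasyImprovements 8 := by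
  obtain ⟨P, hP⟩ := hsys.exists_spm hfin
  exact ⟨P, P.implements_of_forall_unimprovable hP⟩

end BMUMD

theorem mainTheorem3 {N J K : Type*} [Fintype N] [DecidableEq N] [Fintype J] [DecidableEq J]
    [DecidableEq K] (I : BMUMD N J) (hfin : I.optRevenue ≠ ⊤) :
    (∀ M₁ M₂ : Matroid J, I.IsMatroidIntersection M₁ M₂ →
      ∃ P : I.SPM, P.ImplementsInUndominated 8 ∧ P.HasEasyImprovements 8) ∧
    (∀ (mult : K → ℕ) (bundle : J → Finset K), I.IsBundleAuction 2 mult bundle →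
      ∃ P : I.SPM, P.ImplementsInUndominated 8 ∧ P.HasEasyImprovements 8) := by
  exact ⟨fun M₁ M₂ h => h.serviceSystem.exists_implements hfin,
    fun mult bundle h => h.serviceSystem.exists_implements hfin⟩
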